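/- Let $M^7=\mathrm{SO}(5)/\mathrm{SO}(3)_{irr}$ be the Berger space, where $\mathrm{SO}(3)_{irr}\subset\mathrm{SO}(5)$ is the image of the irreducible $5$-dimensional real representation of $\mathrm{SO}(3)$ (on trace-free symmetric $3\times 3$ matrices). Let $B$ be the Killing form of $\mathfrak{so}(5)=\mathfrak{sp}(2)$, let $\mathfrak m$ be the $B$-orthogonal complement of the Lie algebra of $\mathrm{SO}(3)_{irr}$, and let $g$ be the $\mathrm{SO}(5)$-invariant Riemannian metric on $M$ given by $-B$ on $\mathfrak m\cong T_oM$. Let $\nabla$ be its Levi-Civita connection, $R$ its curvature, and let $\Delta_L h=\nabla^*\nabla h+h\circ\mathrm{Ric}+\mathrm{Ric}\circ h-2\mathring R h$ be the Lichnerowicz Laplacian on symmetric $2$-tensors, where $(\mathring Rh)(X,Y)=\sum_i h(R(e_i,X)Y,e_i)$. Then: 1. $g$ is the metric induced by an $\mathrm{SO}(5)$-invariant nearly parallel $\mathrm G_2$-structure on $M$, i.e. by an invariant $\mathrm G_2$-form $\varphi$ with $d\varphi=\tau_0*\varphi$; here $\tau_0^2=\tfrac65$. The metric $g$ is Einstein,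 $\mathrm{Ric}=E\,g$ with $E=\tfrac{9}{20}$. 2. $g$ is linearly unstable: there is a nonzero smooth symmetric $2$-tensor $h$ on $M$ with $\mathrm{tr}_g h=0$, $\delta_g h=0$ and $\langle\nabla^*\nabla h-2\mathring R h,h\rangle_{L^2}=\langle(\Delta_L-2E)h,h\rangle_{L^2}<0$. 3. $M$ admits an $\mathrm{SO}(5)$-invariant $5$-dimensional real vector space $V$ of smooth symmetric $2$-tensors which is isomorphic to the vector representation $\mathbb R^5$ of $\mathrm{SO}(5)$ (whose complexification is the $\mathrm{Sp}(2)$-module $V(1,1)$), such that every $h\in V$ is trace-free, divergence-free, a Killing tensor (i.e. $(\nabla_Xh)(X,X)=0$ for all tangent vectors $X$), and satisfies $$\Delta_L h=\tfrac{19}{30}\,h,\qquad \tfrac{19}{30}<2E=\tfrac{9}{10}.$$ -/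

import Mathlib

open scoped ContDiff Matrix

noncomputable section

namespace Berger

/-! ## The groups and the Lie algebras -/

/-- The group `SO(5)`. -/
abbrev SO5 : Type := Matrix.specialOrthogonalGroup (Fin 5) ℝ

/-- Its Lie algebra of skew-symmetric matrices. -/
abbrev so5 : Type := LieAlgebra.Orthogonal.so (Fin 5) ℝ

/-- The identification of `ℝ⁵` with the trace-free symmetric `3 × 3` matrices. It is isometric up to
the factor `√2` (Frobenius norm on the right). -/
def sym (v : Fin 5 → ℝ) : Matrix (Fin 3) (Fin 3) ℝ :=
  !![v 3 - v 4 / √3, v 0, v 1;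
     v 0, -v 3 - v 4 / √3, v 2;
     v 1, v 2, 2 * v 4 / √3]

theorem sym_add (v w : Fin 5 → ℝ) : sym (v + w) = sym v + sym w := by
  ext i j
  fin_cases i <;> fin_cases j <;> simp [sym] <;> ring

theorem sym_smul (c : ℝ) (v : Fin 5 → ℝ) : sym (c • v) = c • sym v := by
  ext i j
  fin_cases i <;> fin_cases j <;> simp [sym] <;> ring

theorem SO5.coe_inv (x : SO5) : ((x⁻¹ : SO5) : Matrix (Fin 5) (Fin 5) ℝ) = x.1ᵀ := rfl

theorem SO5.transpose_mul (x : SO5) : x.1ᵀ * x.1 = 1 :=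
  (Matrix.mem_orthogonalGroup_iff' _ _).1 (Matrix.mem_specialOrthogonalGroup_iff.1 x.2).1

theorem SO5.mul_transpose (x : SO5) : x.1 * x.1ᵀ = 1 :=
  (Matrix.mem_orthogonalGroup_iff _ _).1 (Matrix.mem_specialOrthogonalGroup_iff.1 x.2).1

/-- The subgroup `SO(3)_irr` of `SO(5)`: the image of the irreducible representation of `SO(3)` on
the trace-free symmetric `3 × 3` matrices `S`, on which `R` acts by `S ↦ R S Rᵀ`. -/
def SO3irr : Subgroup SO5 where
  carrier := {k | ∃ R ∈ Matrix.specialOrthogonalGroup (Fin 3) ℝ,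
    ∀ v, sym (k.1 *ᵥ v) = R * sym v * Rᵀ}
  one_mem' := ⟨1, one_mem _, fun v => by simp⟩
  mul_mem' := by
    rintro a b ⟨R, hR, h⟩ ⟨R', hR', h'⟩
    refine ⟨R * R', mul_mem hR hR', fun v => ?_⟩
    have : (a * b).1 *ᵥ v = a.1 *ᵥ (b.1 *ᵥ v) := by simp [Matrix.mulVec_mulVec]
    rw [this, h, h', Matrix.transpose_mul]
    simp only [Matrix.mul_assoc]
  inv_mem' := by
    rintro a ⟨R, hR, h⟩
    have h1 : Rᵀ * R = 1 :=
      (Matrix.mem_orthogonalGroup_iff' _ _).1 (Matrix.mem_specialOrthogonalGroup_iff.1 hR).1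
    refine ⟨Rᵀ, ?_, fun v => ?_⟩
    · rw [Matrix.mem_specialOrthogonalGroup_iff] at hR ⊢
      refine ⟨(Matrix.mem_orthogonalGroup_iff _ _).2 (by simpa using h1), by simpa using hR.2⟩
    · have h2 := h ((a⁻¹ : SO5).1 *ᵥ v)
      rw [SO5.coe_inv, Matrix.mulVec_mulVec, SO5.mul_transpose, Matrix.one_mulVec] at h2
      rw [SO5.coe_inv, h2]
      calc sym (a.1ᵀ *ᵥ v) = (Rᵀ * R) * sym (a.1ᵀ *ᵥ v) * (Rᵀ * R) := by simp [h1]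
        _ = _ := by simp only [Matrix.mul_assoc, Matrix.transpose_transpose]

/-- The Berger space `SO(5) / SO(3)_irr`. -/
abbrev BergerSpace : Type := SO5 ⧸ SO3irr

/-- The Lie algebra of `SO(3)_irr`: the image of `so(3)` under the differential of the irreducible
representation. -/
def isotropyAlgebra : Submodule ℝ so5 where
  carrier := {X | ∃ A ∈ LieAlgebra.Orthogonal.so (Fin 3) ℝ,
    ∀ v, sym (X.1 *ᵥ v) = A * sym v - sym v * A}
  zero_mem' := ⟨0, zero_mem _, fun v => by
    ext i j; fin_cases i <;> fin_cases j <;> simp [sym]⟩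
  add_mem' := by
    rintro X Y ⟨A, hA, h⟩ ⟨A', hA', h'⟩
    refine ⟨A + A', add_mem hA hA', fun v => ?_⟩
    have : (X + Y).1 *ᵥ v = X.1 *ᵥ v + Y.1 *ᵥ v := by simp [Matrix.add_mulVec]
    rw [this, sym_add, h, h', Matrix.add_mul, Matrix.mul_add]
    abel
  smul_mem' := by
    rintro c X ⟨A, hA, h⟩
    refine ⟨c • A, Submodule.smul_mem _ c hA, fun v => ?_⟩
    have : (c • X).1 *ᵥ v = c • (X.1 *ᵥ v) := by simp [Matrix.smul_mulVec]
    rw [this, sym_smul, h, smul_sub, Matrix.smul_mul, Matrix.mul_smul]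

/-- The tangent space at the base point: the orthogonal complement of the isotropy algebra in
`so(5)` with respect to the Killing form. -/
def 𝔪 : Submodule ℝ so5 := (killingForm ℝ so5).orthogonal isotropyAlgebra

/-- The inner product `-B`, where `B` is the Killing form. -/
def ip (X Y : so5) : ℝ := -killingForm ℝ so5 X Y

/-- The adjoint action of `SO(5)` on its Lie algebra. -/
def Ad (x : SO5) : so5 →ₗ[ℝ] so5 where
  toFun X := ⟨x.1 * X.1 * (x⁻¹ : SO5).1, by
    have hX := (LieAlgebra.Orthogonal.mem_so (Fin 5) ℝ X.1).1 X.2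
    rw [LieAlgebra.Orthogonal.mem_so, SO5.coe_inv]
    simp [Matrix.transpose_mul, hX, Matrix.mul_assoc]⟩
  map_add' X Y := by ext1; simp [Matrix.mul_add, Matrix.add_mul]
  map_smul' c X := by ext1; simp

theorem Ad_coe (x : SO5) (X : so5) : (Ad x X).1 = x.1 * X.1 * x.1ᵀ := rfl

/-- Coordinates on `so(5)`: the entries above the diagonal. -/
def skewEquiv : so5 ≃ₗ[ℝ] ({p : Fin 5 × Fin 5 // p.1 < p.2} → ℝ) where
  toFun X p := X.1 p.1.1 p.1.2
  map_add' _ _ := rfl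
  map_smul' _ _ := rfl
  invFun v := ⟨Matrix.of fun i j => if h : i < j then v ⟨(i, j), h⟩ else
      if h : j < i then -v ⟨(j, i), h⟩ else 0, by
    rw [LieAlgebra.Orthogonal.mem_so]
    ext i j
    rcases lt_trichotomy i j with h | h | h
    · simp [h, h.not_gt]
    · simp [h]
    · simp [h, h.not_gt]⟩
  left_inv X := by
    have hX := (LieAlgebra.Orthogonal.mem_so (Fin 5) ℝ X.1).1 X.2
    have hs : ∀ i j, X.1 j i = -X.1 i j := fun i j => congrFun (congrFun hX i) j
    ext i j
    rcases lt_trichotomy i j with h | h | h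
    · simp [h]
    · subst h
      have := hs i i
      simp
      linarith
    · simp [h, h.not_gt, hs i j]
  right_inv v := by
    ext ⟨⟨i, j⟩, h⟩
    simp [show i < j from h]

theorem skewEquiv_symm (p : {p : Fin 5 × Fin 5 // p.1 < p.2}) :
    (skewEquiv.symm (Pi.single p 1)).1
      = Matrix.single p.1.1 p.1.2 1 - Matrix.single p.1.2 p.1.1 1 := by
  obtain ⟨⟨i, j⟩, h⟩ := p
  ext a b
  have h' : i < j := h
  rcases lt_trichotomy a b with h1 | h1 | h1
  · have : ¬ (j = a ∧ i = b) := by rintro ⟨rfl, rfl⟩; exact absurd h' h1.not_gt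
    simp [skewEquiv, h1, Pi.single_apply, Matrix.single_apply, this, eq_comm]
  · subst h1
    have : ¬ (i = a ∧ j = a) := by rintro ⟨rfl, h2⟩; exact h'.ne h2.symm
    have h3 : ¬ (j = a ∧ i = a) := by rintro ⟨rfl, h2⟩; exact h'.ne h2
    simp [skewEquiv, this, h3]
  · have : ¬ (i = a ∧ j = b) := by rintro ⟨rfl, rfl⟩; exact absurd h' h1.not_gt
    simp [skewEquiv, h1, h1.not_gt, Pi.single_apply, Matrix.single_apply, this, eq_comm, and_comm]

theorem so5.coe_bracket (X Y : so5) : (⁅X, Y⁆ : so5).1 = X.1 * Y.1 - Y.1 * X.1 := rfl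

theorem killingForm_so5 (X Y : so5) : killingForm ℝ so5 X Y = 3 * (X.1 * Y.1).trace := by
  have hX := (LieAlgebra.Orthogonal.mem_so (Fin 5) ℝ X.1).1 X.2
  have hY := (LieAlgebra.Orthogonal.mem_so (Fin 5) ℝ Y.1).1 Y.2
  have sX : ∀ i j, X.1 j i = -X.1 i j := fun i j => congrFun (congrFun hX i) j
  have sY : ∀ i j, Y.1 j i = -Y.1 i j := fun i j => congrFun (congrFun hY i) j
  have dX : ∀ i, X.1 i i = 0 := fun i => by linarith [sX i i]
  have dY : ∀ i, Y.1 i i = 0 := fun i => by linarith [sY i i]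
  rw [LieModule.traceForm_apply_apply,
    LinearMap.trace_eq_matrix_trace ℝ (Module.Basis.ofEquivFun skewEquiv), Matrix.trace]
  have key : ∀ p : {p : Fin 5 × Fin 5 // p.1 < p.2},
      (LinearMap.toMatrix (Module.Basis.ofEquivFun skewEquiv) (Module.Basis.ofEquivFun skewEquiv)
        ((LieAlgebra.ad ℝ so5 X) ∘ₗ (LieAlgebra.ad ℝ so5 Y))).diag p =
      (X.1 * Y.1) p.1.1 p.1.1 + (Y.1 * X.1) p.1.2 p.1.2 + 2 * (X.1 p.1.1 p.1.2 * Y.1 p.1.1 p.1.2) := by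
    intro p
    rw [Matrix.diag_apply, LinearMap.toMatrix_apply, Module.Basis.coe_ofEquivFun,
      Module.Basis.ofEquivFun_repr_apply]
    change ((⁅X, ⁅Y, skewEquiv.symm (Pi.single p 1)⁆⁆ : so5)).1 p.1.1 p.1.2 = _
    rw [so5.coe_bracket, so5.coe_bracket, skewEquiv_symm]
    obtain ⟨⟨i, j⟩, h⟩ := p
    have h' : i ≠ j := ne_of_lt h
    have h1 : i < j := h
    simp only [Matrix.mul_apply, Matrix.sub_apply, Fin.sum_univ_five]
    fin_cases i <;> fin_cases j <;> simp at h1 <;>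
      simp [dX, dY, Fin.ext_iff] <;>
      linarith [sX 0 1, sX 0 2]
  have : ∀ F : Fin 5 → Fin 5 → ℝ, ∑ p : {p : Fin 5 × Fin 5 // p.1 < p.2}, F p.1.1 p.1.2
     = F 0 1 + F 0 2 + F 0 3 + F 0 4 + F 1 2 + F 1 3 + F 1 4 + F 2 3 + F 2 4 + F 3 4 := by
    intro F
    rw [← Finset.sum_subtype (Finset.univ.filter fun p : Fin 5 × Fin 5 => p.1 < p.2) (by simp)
      (fun p => F p.1 p.2), Finset.sum_filter, Fintype.sum_prod_type]
    simp [Fin.sum_univ_five]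
    ring
  refine (Finset.sum_congr rfl fun p _ => key p).trans ?_
  rw [this fun i j => (X.1 * Y.1) i i + (Y.1 * X.1) j j + 2 * (X.1 i j * Y.1 i j)]
  simp only [Matrix.trace, Matrix.diag_apply, Matrix.mul_apply, Fin.sum_univ_five, dX, dY, sX 0 1,
    sX 0 2, sX 0 3, sX 0 4, sX 1 2, sX 1 3, sX 1 4, sX 2 3, sX 2 4, sX 3 4, sY 0 1,
    sY 0 2, sY 0 3, sY 0 4, sY 1 2, sY 1 3, sY 1 4, sY 2 3, sY 2 4, sY 3 4]
  ring

theorem ip_eq (X Y : so5) : ip X Y = -3 * (X.1 * Y.1).trace := by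
  rw [ip, killingForm_so5]; ring

theorem ip_self (X : so5) : ip X X = 3 * ∑ i, ∑ j, X.1 i j ^ 2 := by
  have hX := (LieAlgebra.Orthogonal.mem_so (Fin 5) ℝ X.1).1 X.2
  have h : ∀ i j, X.1 j i = -X.1 i j := fun i j => congrFun (congrFun hX i) j
  rw [ip_eq, Matrix.trace, Finset.mul_sum, Finset.mul_sum]
  refine Finset.sum_congr rfl fun i _ => ?_
  rw [Matrix.diag_apply, Matrix.mul_apply, Finset.mul_sum, Finset.mul_sum]
  refine Finset.sum_congr rfl fun j _ => ?_
  rw [h i j]; ring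

theorem eq_zero_of_ip_self {X : so5} (h : ip X X = 0) : X = 0 := by
  rw [ip_self] at h
  ext i j
  have h1 : ∑ i, ∑ j, X.1 i j ^ 2 = 0 := by linarith
  rw [Finset.sum_eq_zero_iff_of_nonneg fun i _ => by positivity] at h1
  have h2 := h1 i (Finset.mem_univ _)
  rw [Finset.sum_eq_zero_iff_of_nonneg fun i _ => by positivity] at h2
  simpa using h2 j (Finset.mem_univ _)

theorem ip_Ad (x : SO5) (X Y : so5) : ip (Ad x X) (Ad x Y) = ip X Y := by
  rw [ip_eq, ip_eq, Ad_coe, Ad_coe]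
  have : x.1 * X.1 * x.1ᵀ * (x.1 * Y.1 * x.1ᵀ) = x.1 * (X.1 * Y.1 * x.1ᵀ) := by
    calc _ = x.1 * X.1 * (x.1ᵀ * x.1) * Y.1 * x.1ᵀ := by simp only [Matrix.mul_assoc]
      _ = _ := by rw [SO5.transpose_mul]; simp only [Matrix.mul_assoc, Matrix.one_mul]
  rw [this, Matrix.trace_mul_comm, Matrix.mul_assoc, SO5.transpose_mul, Matrix.mul_one]

theorem Ad_mul (x y : SO5) (X : so5) : Ad (x * y) X = Ad x (Ad y X) := by
  ext1
  simp [Ad_coe, Matrix.transpose_mul, Matrix.mul_assoc]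

theorem Ad_one (X : so5) : Ad 1 X = X := by
  ext1
  simp [Ad_coe]

theorem mem_𝔪 (X : so5) : X ∈ 𝔪 ↔ ∀ Y ∈ isotropyAlgebra, ip Y X = 0 := by
  simp [𝔪, LinearMap.BilinForm.mem_orthogonal_iff, ip]

theorem Ad_mem_isotropyAlgebra {k : SO5} (hk : k ∈ SO3irr) {X : so5} (hX : X ∈ isotropyAlgebra) :
    Ad k X ∈ isotropyAlgebra := by
  obtain ⟨R, hR, h⟩ := hk
  obtain ⟨A, hA, h'⟩ := hX
  have h1 : Rᵀ * R = 1 :=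
    (Matrix.mem_orthogonalGroup_iff' _ _).1 (Matrix.mem_specialOrthogonalGroup_iff.1 hR).1
  have h2 : R * Rᵀ = 1 :=
    (Matrix.mem_orthogonalGroup_iff _ _).1 (Matrix.mem_specialOrthogonalGroup_iff.1 hR).1
  rw [LieAlgebra.Orthogonal.mem_so] at hA
  refine ⟨R * A * Rᵀ, ?_, fun v => ?_⟩
  · rw [LieAlgebra.Orthogonal.mem_so]
    simp [Matrix.transpose_mul, hA, Matrix.mul_assoc]
  · have hv : sym v = R * sym (k.1ᵀ *ᵥ v) * Rᵀ := by
      rw [← h, Matrix.mulVec_mulVec, SO5.mul_transpose, Matrix.one_mulVec]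
    have : (Ad k X).1 *ᵥ v = k.1 *ᵥ (X.1 *ᵥ (k.1ᵀ *ᵥ v)) := by
      simp [Ad_coe, Matrix.mulVec_mulVec, Matrix.mul_assoc]
    rw [this, h, h', hv]
    generalize sym (k.1ᵀ *ᵥ v) = T
    have e1 : R * A * Rᵀ * (R * T * Rᵀ) = R * A * (Rᵀ * R) * T * Rᵀ := by
      simp only [Matrix.mul_assoc]
    have e2 : R * T * Rᵀ * (R * A * Rᵀ) = R * T * (Rᵀ * R) * A * Rᵀ := by
      simp only [Matrix.mul_assoc]
    rw [e1, e2, h1]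
    simp only [Matrix.mul_one, Matrix.mul_sub, Matrix.sub_mul, Matrix.mul_assoc]

theorem Ad_mem_𝔪 {k : SO5} (hk : k ∈ SO3irr) {X : so5} (hX : X ∈ 𝔪) : Ad k X ∈ 𝔪 := by
  rw [mem_𝔪] at hX ⊢
  intro Y hY
  have h : Y = Ad k (Ad k⁻¹ Y) := by rw [← Ad_mul, mul_inv_cancel, Ad_one]
  rw [h, ip_Ad]
  exact hX _ (Ad_mem_isotropyAlgebra (inv_mem hk) hY)

/-- The isotropy representation of `SO(3)_irr` on `𝔪`. -/
def isotropyRep (k : SO3irr) : 𝔪 →ₗ[ℝ] 𝔪 :=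
  (Ad k.1).restrict fun _ hX => Ad_mem_𝔪 k.2 hX

/-! ## The invariant metric -/

/-- The Riemannian metric `g = -B` on `𝔪`. -/
def g (X Y : 𝔪) : ℝ := ip X.1 Y.1

theorem exists_frame : ∃ e : Module.Basis (Fin (Module.finrank ℝ 𝔪)) ℝ 𝔪,
    ∀ i j, g (e i) (e j) = if i = j then 1 else 0 := by
  let c : InnerProductSpace.Core ℝ 𝔪 :=
    { inner := g
      conj_inner_symm := fun X Y => by
        simp only [g, ip_eq, Matrix.trace_mul_comm Y.1.1, conj_trivial]
      re_inner_nonneg := fun X => by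
        simp only [g, ip_self, RCLike.re_to_real]
        positivity
      add_left := fun X Y Z => by simp [g, ip_eq, Matrix.add_mul]; ring
      smul_left := fun X Y r => by simp [g, ip_eq]; ring
      definite := fun X h => Subtype.ext (eq_zero_of_ip_self h) }
  let _ : NormedAddCommGroup 𝔪 := c.toNormedAddCommGroup
  let _ : InnerProductSpace ℝ 𝔪 := InnerProductSpace.ofCore c.toCore
  have h := (stdOrthonormalBasis ℝ 𝔪).orthonormal
  rw [orthonormal_iff_ite] at h
  refine ⟨(stdOrthonormalBasis ℝ 𝔪).toBasis, fun i j => ?_⟩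
  rw [OrthonormalBasis.coe_toBasis]
  exact h i j

/-- A `g`-orthonormal basis of `𝔪`, used to take traces. -/
def frame : Module.Basis (Fin (Module.finrank ℝ 𝔪)) ℝ 𝔪 := exists_frame.choose

/-- The orthogonal projection of `so(5)` onto `𝔪`. -/
def proj : so5 →ₗ[ℝ] 𝔪 where
  toFun X := ∑ i, ip X (frame i) • frame i
  map_add' X Y := by
    simp [ip_eq, Matrix.add_mul, mul_add, add_smul, Finset.sum_add_distrib]
  map_smul' c X := by
    simp only [ip_eq, Finset.smul_sum, smul_smul]
    refine Finset.sum_congr rfl fun i _ => ?_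
    congr 1
    simp
    ring

theorem proj_val (X : so5) : proj X = ∑ i, ip X (frame i).1 • frame i := rfl

theorem g_frame (i j) : g (frame i) (frame j) = if i = j then 1 else 0 :=
  exists_frame.choose_spec i j

theorem ip_proj (X : so5) (Y : 𝔪) : ip (proj X).1 Y.1 = ip X Y.1 := by
  have h : (killingForm ℝ so5 (proj X).1) ∘ₗ 𝔪.subtype = (killingForm ℝ so5 X) ∘ₗ 𝔪.subtype := by
    refine frame.ext fun i => neg_injective ?_
    have h1 : ip (proj X).1 (frame i).1 = ∑ j, ip X (frame j).1 * g (frame j) (frame i) := by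
      simp [proj_val, g, ip]
    change ip (proj X).1 (frame i).1 = ip X (frame i).1
    rw [h1]
    simp [g_frame]
  exact congrArg Neg.neg (LinearMap.congr_fun h Y)

theorem eq_of_g_eq {X Y : 𝔪} (h : ∀ i, g X (frame i) = g Y (frame i)) : X = Y := by
  have h1 : (killingForm ℝ so5 (X - Y).1) ∘ₗ 𝔪.subtype = 0 := by
    refine frame.ext fun i => ?_
    have := h i
    simp only [g, ip, neg_inj] at this
    simp [this]
  have h2 : ip (X - Y).1 (X - Y).1 = 0 := by
    have := LinearMap.congr_fun h1 (X - Y)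
    simp only [LinearMap.comp_apply, Submodule.subtype_apply, LinearMap.zero_apply] at this
    rw [ip, this, neg_zero]
  exact sub_eq_zero.1 (Subtype.ext (eq_zero_of_ip_self h2))

theorem proj_of_mem (X : 𝔪) : proj X.1 = X :=
  eq_of_g_eq fun i => ip_proj X.1 (frame i)

theorem proj_Ad {k : SO5} (hk : k ∈ SO3irr) (X : so5) :
    proj (Ad k X) = isotropyRep ⟨k, hk⟩ (proj X) := by
  have hg : ∀ Y : 𝔪, ip (X - (proj X).1) Y.1 = 0 := fun Y => by
    have := ip_proj X Y
    simp only [ip, neg_inj] at this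
    simp [ip, this]
  have h1 : proj (Ad k (X - (proj X).1)) = 0 := by
    rw [proj_val]
    refine Finset.sum_eq_zero fun i _ => ?_
    have : (frame i).1 = Ad k (Ad k⁻¹ (frame i).1) := by rw [← Ad_mul, mul_inv_cancel, Ad_one]
    rw [this, ip_Ad]
    rw [hg ⟨_, Ad_mem_𝔪 (inv_mem hk) (frame i).2⟩, zero_smul]
  have h2 : proj (Ad k (proj X).1) = isotropyRep ⟨k, hk⟩ (proj X) :=
    proj_of_mem (isotropyRep ⟨k, hk⟩ (proj X))
  rw [map_sub, map_sub, h2] at h1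
  exact sub_eq_zero.1 h1

/-! ## Smooth functions and vector fields -/

/-- Smooth functions on `SO(5)`: the restrictions of smooth functions of the matrix entries. -/
def IsSmooth (f : SO5 → ℝ) : Prop :=
  ∃ F : (Fin 5 → Fin 5 → ℝ) → ℝ, ContDiff ℝ ∞ F ∧ ∀ x : SO5, f x = F fun i j => x.1 i j

theorem exp_mem (X : so5) :
    NormedSpace.exp X.1 ∈ Matrix.specialOrthogonalGroup (Fin 5) ℝ := by
  have horth : ∀ Y : so5, (NormedSpace.exp Y.1)ᵀ * NormedSpace.exp Y.1 = 1 := by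
    intro Y
    have hY := (LieAlgebra.Orthogonal.mem_so (Fin 5) ℝ Y.1).1 Y.2
    rw [← Matrix.exp_transpose, hY,
      ← Matrix.exp_add_of_commute _ _ (Commute.neg_left (Commute.refl Y.1)), neg_add_cancel,
      NormedSpace.exp_zero]
  rw [Matrix.mem_specialOrthogonalGroup_iff, Matrix.mem_orthogonalGroup_iff']
  refine ⟨horth X, ?_⟩
  have h1 : (NormedSpace.exp ((1 / 2 : ℝ) • X).1).det ^ 2 = 1 := by
    have := congrArg Matrix.det (horth ((1 / 2 : ℝ) • X))
    rw [Matrix.det_mul, Matrix.det_transpose, Matrix.det_one] at this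
    rw [sq, this]
  have h2 : X.1 = ((1 / 2 : ℝ) • X).1 + ((1 / 2 : ℝ) • X).1 := by
    simp only [SetLike.val_smul, ← add_smul]
    norm_num
  rw [h2, Matrix.exp_add_of_commute _ _ (Commute.refl _), Matrix.det_mul, ← sq, h1]

/-- The exponential map of `SO(5)`. -/
def expSO (X : so5) : SO5 := ⟨NormedSpace.exp X.1, exp_mem X⟩

/-- The derivative `d/dt f(x exp(tX))` at `t = 0`. If `f` is the lift to `SO(5)` of a function on
the Berger space and `X ∈ 𝔪`, this is its derivative along the tangent vector `[x, X]`. -/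
def lieDeriv (f : SO5 → ℝ) (x : SO5) (X : so5) : ℝ :=
  deriv (fun t : ℝ => f (x * expSO (t • X))) 0

/-- Smooth vector fields on the Berger space. The tangent bundle is the associated bundle
`SO(5) ×_{SO(3)_irr} 𝔪`, in which `[x, X]` is the velocity at `t = 0` of the curve
`x exp(tX) SO(3)_irr`; its sections are the equivariant maps `SO(5) → 𝔪`. -/
structure VectorField where
  toFun : SO5 → 𝔪
  smooth : ∀ i j, IsSmooth fun x => (toFun x).1.1 i j
  equivariant : ∀ (x : SO5) (k : SO3irr), toFun (x * k) = isotropyRep k⁻¹ (toFun x)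

instance : CoeFun VectorField fun _ => SO5 → 𝔪 := ⟨VectorField.toFun⟩

/-- The vector field of the one-parameter group `exp(t Ad(x) X)` of isometries. At `x` it takes the
value `X`; it is used to extend a tangent vector to a vector field. -/
def extend (x : SO5) (X : 𝔪) : VectorField where
  toFun y := proj (Ad (y⁻¹ * x) X.1)
  smooth i j := by
    refine ⟨fun y => ∑ a, (-3 * ((Matrix.of y)ᵀ * (Ad x X.1).1 * Matrix.of y *
      (frame a).1.1).trace) * (frame a).1.1 i j, ?_, fun y => ?_⟩
    · simp only [Matrix.trace, Matrix.diag_apply, Matrix.mul_apply, Matrix.transpose_apply,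
        Matrix.of_apply]
      fun_prop
    · have h : ∀ a, ip (Ad y⁻¹ (Ad x X.1)) (frame a).1 =
          -3 * (y.1ᵀ * (Ad x X.1).1 * y.1 * (frame a).1.1).trace := fun a => by
        rw [ip_eq, Ad_coe, SO5.coe_inv, Matrix.transpose_transpose]
      simp only [Ad_mul, proj_val, h]
      simp [Matrix.sum_apply]
      rfl
  equivariant y k := by
    rw [mul_inv_rev, mul_assoc, Ad_mul, proj_Ad (inv_mem k.2)]
    rfl

theorem extend_self (x : SO5) (X : 𝔪) : extend x X x = X := by
  change proj (Ad (x⁻¹ * x) X.1) = X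
  rw [inv_mul_cancel, Ad_one, proj_of_mem]

/-! ## The Levi-Civita connection -/

/-- Axioms for the Levi-Civita connection `D ξ η = ∇_ξ η` of `g = -B`. -/
structure IsLeviCivita (D : VectorField → VectorField → VectorField) : Prop where
  add_left : ∀ ξ₁ ξ₂ ξ₃ η : VectorField, (∀ x, ξ₃ x = ξ₁ x + ξ₂ x) →
    ∀ x, D ξ₃ η x = D ξ₁ η x + D ξ₂ η x
  smul_left : ∀ (f : BergerSpace → ℝ), IsSmooth (fun x => f x) →
    ∀ ξ ξ' η : VectorField, (∀ x : SO5, ξ' x = f x • ξ x) → ∀ x : SO5, D ξ' η x = f x • D ξ η x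
  add_right : ∀ ξ η₁ η₂ η₃ : VectorField, (∀ x, η₃ x = η₁ x + η₂ x) →
    ∀ x, D ξ η₃ x = D ξ η₁ x + D ξ η₂ x
  leibniz : ∀ (f : BergerSpace → ℝ), IsSmooth (fun x => f x) →
    ∀ ξ η η' : VectorField, (∀ x : SO5, η' x = f x • η x) →
    ∀ x : SO5, D ξ η' x = f x • D ξ η x + lieDeriv (fun y => f y) x (ξ x) • η x
  /-- The connection is metric: `ξ(g(η, ζ)) = g(∇_ξ η, ζ) + g(η, ∇_ξ ζ)`. -/
  metric : ∀ (ξ η ζ : VectorField) (x : SO5),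
    lieDeriv (fun y => g (η y) (ζ y)) x (ξ x) = g (D ξ η x) (ζ x) + g (η x) (D ξ ζ x)
  /-- The connection is torsion-free: `ξ(η(f)) - η(ξ(f)) = (∇_ξ η)(f) - (∇_η ξ)(f)`. -/
  torsion_free : ∀ (f : BergerSpace → ℝ), IsSmooth (fun x => f x) →
    ∀ (ξ η : VectorField) (x : SO5),
    lieDeriv (fun y => lieDeriv (fun z => f z) y (η y)) x (ξ x)
      - lieDeriv (fun y => lieDeriv (fun z => f z) y (ξ y)) x (η x)
      = lieDeriv (fun y => f y) x (D ξ η x) - lieDeriv (fun y => f y) x (D η ξ x)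

/-! ## Tensor calculus -/

/-- Covariant `k`-tensor fields on the Berger space, given by the (equivariant) functions with
`t x Y = t_{[x]}([x, Y₀], …, [x, Y_{k-1}])`. -/
abbrev Tensor (k : ℕ) : Type := SO5 → (Fin k → 𝔪) → ℝ

variable (D : VectorField → VectorField → VectorField)

/-- The covariant derivative
`(∇t)(Y₀, Y₁, …, Y_k) = Y₀(t(Y₁, …, Y_k)) - ∑ i, t(Y₁, …, ∇_{Y₀} Y_i, …, Y_k)`. -/
def covDeriv {k : ℕ} (t : Tensor k) : Tensor (k + 1) := fun x Y =>
  lieDeriv (fun y => t y fun i => extend x (Y i.succ) y) x (Y 0)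
    - ∑ i : Fin k, t x (Function.update (fun j => Y j.succ) i
        (D (extend x (Y 0)) (extend x (Y i.succ)) x))

/-- The curvature `R(X, Y)Z = ∇_X ∇_Y Z - ∇_Y ∇_X Z - ∇_{[X, Y]} Z`, with
`[X, Y] = ∇_X Y - ∇_Y X`. -/
def curvature (x : SO5) (X Y Z : 𝔪) : 𝔪 :=
  let ξ := extend x X
  let η := extend x Y
  let ζ := extend x Z
  D ξ (D η ζ) x - D η (D ξ ζ) x - (D (D ξ η) ζ x - D (D η ξ) ζ x)

/-- The Ricci tensor `Ric(X, Y) = ∑ i, g(R(e_i, X)Y, e_i)`. -/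
def ricci (x : SO5) (X Y : 𝔪) : ℝ := ∑ i, g (curvature D x (frame i) X Y) (frame i)

/-- `g` is Einstein with Einstein constant `E`. -/
def IsEinstein (E : ℝ) : Prop := ∀ x X Y, ricci D x X Y = E * g X Y

/-- Smooth symmetric `2`-tensor fields on the Berger space. -/
def SymTensor : Submodule ℝ (SO5 → 𝔪 →ₗ[ℝ] 𝔪 →ₗ[ℝ] ℝ) where
  carrier := {h | (∀ X Y, IsSmooth fun x => h x X Y) ∧ (∀ x X Y, h x X Y = h x Y X) ∧
    ∀ (x : SO5) (k : SO3irr) (X Y : 𝔪),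
      h (x * k) X Y = h x (isotropyRep k X) (isotropyRep k Y)}
  zero_mem' := ⟨fun _ _ => ⟨fun _ => 0, contDiff_const, fun _ => rfl⟩, fun _ _ _ => rfl,
    fun _ _ _ _ => rfl⟩
  add_mem' := by
    rintro h h' ⟨a, b, c⟩ ⟨a', b', c'⟩
    refine ⟨fun X Y => ?_, fun x X Y => ?_, fun x k X Y => ?_⟩
    · obtain ⟨F, hF, e⟩ := a X Y
      obtain ⟨F', hF', e'⟩ := a' X Y
      exact ⟨F + F', hF.add hF', fun x => by simp [e, e']⟩
    · simp [b x X Y, b' x X Y]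
    · simp [c, c']
  smul_mem' := by
    rintro r h ⟨a, b, c⟩
    refine ⟨fun X Y => ?_, fun x X Y => ?_, fun x k X Y => ?_⟩
    · obtain ⟨F, hF, e⟩ := a X Y
      exact ⟨fun z => r * F z, contDiff_const.mul hF, fun x => by simp [e]⟩
    · simp [b x X Y]
    · simp [c]

/-- A symmetric `2`-tensor field as a covariant tensor field. -/
def toTensor (h : SymTensor) : Tensor 2 := fun x Y => h.1 x (Y 0) (Y 1)

/-- `tr_g h = 0`. -/
def IsTraceFree (h : SymTensor) : Prop := ∀ x, ∑ i, h.1 x (frame i) (frame i) = 0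

/-- `δ_g h = 0`, where `(δ_g h)(Y) = -∑ i, (∇_{e_i} h)(e_i, Y)`. -/
def IsDivergenceFree (h : SymTensor) : Prop :=
  ∀ x Y, -∑ i, covDeriv D (toTensor h) x ![frame i, frame i, Y] = 0

/-- Killing tensors: `(∇_X h)(X, X) = 0` for all tangent vectors `X`. -/
def IsKilling (h : SymTensor) : Prop := ∀ x X, covDeriv D (toTensor h) x ![X, X, X] = 0

/-- The rough Laplacian `∇*∇h = -∑ i, ∇²_{e_i, e_i} h`. -/
def roughLaplacian (h : SymTensor) : Tensor 2 := fun x Y =>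
  -∑ i, covDeriv D (covDeriv D (toTensor h)) x ![frame i, frame i, Y 0, Y 1]

/-- The curvature action `(R̊h)(X, Y) = ∑ i, h(R(e_i, X)Y, e_i)`. -/
def curvatureAction (h : SymTensor) : Tensor 2 := fun x Y =>
  ∑ i, h.1 x (curvature D x (frame i) (Y 0) (Y 1)) (frame i)

/-- The Lichnerowicz Laplacian
`(Δ_L h)(X, Y) = (∇*∇h)(X, Y) + h(Ric X, Y) + h(X, Ric Y) - 2 (R̊h)(X, Y)`. -/
def lichnerowicz (h : SymTensor) : Tensor 2 := fun x Y =>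
  roughLaplacian D h x Y
    + (∑ i, ricci D x (Y 0) (frame i) * h.1 x (frame i) (Y 1)
      + ∑ i, ricci D x (Y 1) (frame i) * h.1 x (Y 0) (frame i))
    - 2 * curvatureAction D h x Y

/-- `V` is an `SO(5)`-invariant space of symmetric tensor fields that is isomorphic to the vector
representation `ℝ⁵` of `SO(5)`; an element `a` acts on tensor fields by push-forward along the
isometry `a`, so by `(a h)(x) = h(a⁻¹ x)`. As a representation of the double cover `Sp(2)`, the
complexification of `ℝ⁵` is the irreducible module `V(1,1)`. -/
def IsVectorModule (V : Submodule ℝ SymTensor) : Prop :=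
  ∃ Φ : (Fin 5 → ℝ) ≃ₗ[ℝ] V, ∀ (a : SO5) (v : Fin 5 → ℝ) (x : SO5),
    (Φ (a.1 *ᵥ v)).1.1 x = (Φ v).1.1 (a⁻¹ * x)

/-! ## Integration and linear instability -/

instance : IsTopologicalGroup SO5 where
  continuous_mul := by
    refine Continuous.subtype_mk ?_ _
    fun_prop
  continuous_inv := by
    refine Continuous.subtype_mk ?_ _
    exact continuous_subtype_val.matrix_transpose

instance : CompactSpace SO5 := by
  have hK : IsCompact (Set.univ.pi fun _ : Fin 5 => Set.univ.pi fun _ : Fin 5 =>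
      Set.Icc (-1 : ℝ) 1) :=
    isCompact_univ_pi fun _ => isCompact_univ_pi fun _ => isCompact_Icc
  have hc : IsClosed {M : Matrix (Fin 5) (Fin 5) ℝ | M * Mᵀ = 1 ∧ M.det = 1} :=
    (isClosed_eq (by fun_prop) continuous_const).inter (isClosed_eq (by fun_prop) continuous_const)
  have hs : {M : Matrix (Fin 5) (Fin 5) ℝ | M * Mᵀ = 1 ∧ M.det = 1}
      = (Matrix.specialOrthogonalGroup (Fin 5) ℝ : Set (Matrix (Fin 5) (Fin 5) ℝ)) := by
    ext M
    rw [SetLike.mem_coe, Matrix.mem_specialOrthogonalGroup_iff, Matrix.mem_orthogonalGroup_iff]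
    rfl
  refine isCompact_iff_compactSpace.1 (?_ :
    IsCompact (Matrix.specialOrthogonalGroup (Fin 5) ℝ : Set (Matrix (Fin 5) (Fin 5) ℝ)))
  rw [← hs]
  refine IsCompact.of_isClosed_subset (X := Matrix (Fin 5) (Fin 5) ℝ) hK hc ?_
  rintro M ⟨hM, -⟩ i - j -
  have h1 : ∑ l, M i l * M i l = 1 := by
    have := congrFun (congrFun hM i) i
    simpa [Matrix.mul_apply] using this
  have h2 : M i j * M i j ≤ 1 := by
    rw [← h1]
    exact Finset.single_le_sum (f := fun l => M i l * M i l) (fun l _ => mul_self_nonneg _)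
      (Finset.mem_univ j)
  exact abs_le.1 (abs_le_one_iff_mul_self_le_one.2 h2)

instance : MeasurableSpace SO5 := borel SO5

instance : BorelSpace SO5 := ⟨rfl⟩

/-- The `L²` inner product of `2`-tensor fields. The Riemannian measure of the Berger space is, up to
a positive constant, the image of the Haar measure of `SO(5)`. -/
def innerL2 (s t : Tensor 2) : ℝ :=
  ∫ x : SO5, ∑ i, ∑ j, s x ![frame i, frame j] * t x ![frame i, frame j]
    ∂(MeasureTheory.Measure.haar : MeasureTheory.Measure SO5)

/-- Linear instability: there is a nonzero trace-free and divergence-free symmetric `2`-tensor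
field `h` with `⟨∇*∇h - 2 R̊h, h⟩ < 0` in `L²`. -/
def IsLinearlyUnstable : Prop :=
  ∃ h : SymTensor, h ≠ 0 ∧ IsTraceFree h ∧ IsDivergenceFree D h ∧
    innerL2 (fun x Y => roughLaplacian D h x Y - 2 * curvatureAction D h x Y) (toTensor h) < 0

/-! ## Nearly parallel `G₂`-structures -/

/-- The coefficients of `e¹²³ + e¹⁴⁵ + e¹⁶⁷ + e²⁴⁶ - e²⁵⁷ - e³⁴⁷ - e³⁵⁶`. -/
def g2Coeff (i j k : Fin 7) : ℝ :=
  if (i, j, k) ∈ [(0, 1, 2), (0, 3, 4), (0, 5, 6), (1, 3, 5)] then 1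
  else if (i, j, k) ∈ [(1, 4, 6), (2, 3, 6), (2, 4, 5)] then -1 else 0

/-- The exterior derivative of a `3`-form, computed with the Levi-Civita connection. -/
def extDeriv (φ : Tensor 3) : Tensor 4 := fun x Y =>
  ∑ i : Fin 4, (-1) ^ (i : ℕ) * covDeriv D φ x (Fin.cons (Y i) fun j => Y (i.succAbove j))

/-- `φ` is an `SO(5)`-invariant `G₂`-structure on the Berger space (that is, an
`SO(3)_irr`-invariant `3`-form on `𝔪`) that induces the metric `g` and is nearly parallel,
`dφ = τ *φ`. The first condition on the basis `e` is the normal form of a `G₂`-structure, and the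
second one is `dφ = τ *φ` for the Hodge star operator of the metric and orientation for which `e` is
an oriented orthonormal basis. -/
def IsNearlyParallelG2 (φ : 𝔪 [⋀^Fin 3]→ₗ[ℝ] ℝ) (τ : ℝ) : Prop :=
  τ ≠ 0 ∧ (∀ k : SO3irr, φ.compLinearMap (isotropyRep k) = φ) ∧
  ∃ e : Module.Basis (Fin 7) ℝ 𝔪,
    (∀ i j, g (e i) (e j) = if i = j then 1 else 0) ∧
    (∀ i j k, i < j → j < k → φ ![e i, e j, e k] = g2Coeff i j k) ∧
    ∀ (x : SO5) (σ : Equiv.Perm (Fin 7)),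
      extDeriv D (fun _ Y => φ Y) x ![e (σ 3), e (σ 4), e (σ 5), e (σ 6)]
        = τ * ((Equiv.Perm.sign σ : ℤ) * φ ![e (σ 0), e (σ 1), e (σ 2)])

end Berger

end

noncomputable section
namespace Berger

/-! ## Weak derivatives of vector-valued functions on `SO(5)` -/

/-! The Berger space is normal homogeneous, so its geometry reduces to algebra in `so(5)`. Fields
are lifted to equivariant functions on `SO(5)`, and there the Levi-Civita connection is `∇_ξ η =
ξ(η) + ½[ξ, η]_𝔪` (`isLeviCivita_leviCivita`). It is the only one by Koszul's argument
(`IsLeviCivita.eq_leviCivita`). Since torsion is tested on functions, this needs functions on the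
quotient that separate tangent vectors; the `SO(3)`-invariant cubic form `tr S³` on `ℝ⁵` supplies
them (`eq_of_lieDeriv_eq`). So everything concerns one explicit connection, whose curvature is an
expression in brackets (`curvature_eq`).

Under `SO(3)` the space `ℝ⁵` is the irreducible module of spin 2 and `𝔪` that of spin 3, while `Sym²
𝔪` has spins 0, 2, 4, 6 and so contains `ℝ⁵` exactly once. An embedding is `quad`, and by Frobenius
reciprocity `x ↦ quad (x⁻¹v)` is a copy of `ℝ⁵` among the symmetric tensor fields. These fields are
trace-free by Schur's lemma. By multiplicity one, `quad w X X` is a multiple of the Hodge dual of `w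
∧ X ∧ X`. As `X` annihilates the vector dual to `X ∧ X`, `quad (Xw) X X` vanishes, which is the
Killing equation. Trace-free Killing tensors are divergence-free.

The rough Laplacian and the curvature action again give equivariant maps from `ℝ⁵` to `Sym² 𝔪`,
hence multiples of `quad`; the factors are `19/60` and `7/24` (`roughLaplacian_tensorField`,
`curvatureAction_tensorField`). With `Ric = 9/20`, `Δ_L = 19/60 + 9/10 - 7/12 = 19/30`, and `∇*∇ -
2R̊ = -4/15` is negative.

The `G₂`-form is `√30 g([X, Y], Z)`; its covariant derivative is again made of brackets, and `dφ =
-(6/√30) *φ`.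

Representation theory explains why scalars appear. Their values, and the vanishing statements, are
verified in an orthogonal basis of `so(5)` that is integral after one coordinate is rescaled by
`√3`, so that each identity becomes a finite table of integers. -/

theorem hasDerivAt_exp_entry (X : so5) (i j : Fin 5) :
    HasDerivAt (fun t : ℝ => (expSO (t • X)).1 i j) (X.1 i j) 0 := by
  -- An auxiliary submultiplicative norm makes the exponential differentiable; only the derivative
  -- of a real-valued entry leaves the proof.
  let _ : NormedRing (Matrix (Fin 5) (Fin 5) ℝ) := Matrix.linftyOpNormedRing
  let _ : NormedAlgebra ℝ (Matrix (Fin 5) (Fin 5) ℝ) := Matrix.linftyOpNormedAlgebra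
  have h := hasDerivAt_exp_smul_const (𝕂 := ℝ) X.1 (0 : ℝ)
  let L : Matrix (Fin 5) (Fin 5) ℝ →L[ℝ] ℝ := LinearMap.toContinuousLinearMap
    (Matrix.entryLinearMap ℝ ℝ i j)
  have h2 := L.hasFDerivAt.comp_hasDerivAt (0 : ℝ) h
  have e : L (NormedSpace.exp ((0 : ℝ) • X.1) * X.1) = X.1 i j := by
    rw [zero_smul, NormedSpace.exp_zero, one_mul]
    rfl
  exact e ▸ h2

theorem expSO_zero (X : so5) : expSO ((0 : ℝ) • X) = 1 := by
  apply Subtype.ext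
  change NormedSpace.exp ((0 : ℝ) • X).1 = 1
  simp

theorem hasDerivAt_mul_expSO (x : SO5) (X : so5) :
    HasDerivAt (fun t : ℝ => (fun i j => (x * expSO (t • X)).1 i j : Fin 5 → Fin 5 → ℝ))
      (fun i j => (x.1 * X.1) i j) 0 := by
  rw [hasDerivAt_pi]
  intro i
  rw [hasDerivAt_pi]
  intro j
  have : (fun t : ℝ => (x * expSO (t • X)).1 i j)
      = fun t => ∑ k, x.1 i k * (expSO (t • X)).1 k j := by
    ext t
    exact Matrix.mul_apply
  rw [this, Matrix.mul_apply]
  exact HasDerivAt.fun_sum fun k _ => (hasDerivAt_exp_entry X k j).const_mul _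

theorem hasDerivAt_ambient {F : (Fin 5 → Fin 5 → ℝ) → ℝ} (hF : ContDiff ℝ ∞ F) (x : SO5) (X : so5) :
    HasDerivAt (fun t : ℝ => F fun i j => (x * expSO (t • X)).1 i j)
      (fderiv ℝ F (fun i j => x.1 i j) fun i j => (x.1 * X.1) i j) 0 := by
  have h1 : DifferentiableAt ℝ F (fun i j => (x * expSO ((0 : ℝ) • X)).1 i j) :=
    (hF.differentiable (by simp)).differentiableAt
  have h2 := h1.hasFDerivAt.comp_hasDerivAt (0 : ℝ) (hasDerivAt_mul_expSO x X)
  rw [expSO_zero, mul_one] at h2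
  exact h2

namespace IsSmooth

variable {f f' : SO5 → ℝ}

theorem const (c : ℝ) : IsSmooth fun _ => c := ⟨fun _ => c, contDiff_const, fun _ => rfl⟩

theorem add (h : IsSmooth f) (h' : IsSmooth f') : IsSmooth fun x => f x + f' x := by
  obtain ⟨F, hF, e⟩ := h
  obtain ⟨F', hF', e'⟩ := h'
  exact ⟨fun y => F y + F' y, hF.add hF', fun x => congrArg₂ _ (e x) (e' x)⟩

theorem mul (h : IsSmooth f) (h' : IsSmooth f') : IsSmooth fun x => f x * f' x := by
  obtain ⟨F, hF, e⟩ := h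
  obtain ⟨F', hF', e'⟩ := h'
  exact ⟨fun y => F y * F' y, hF.mul hF', fun x => congrArg₂ _ (e x) (e' x)⟩

theorem sum {ι : Type*} {s : Finset ι} {f : ι → SO5 → ℝ} (h : ∀ i, IsSmooth (f i)) :
    IsSmooth fun x => ∑ i ∈ s, f i x := by
  choose F hF e using h
  exact ⟨fun y => ∑ i ∈ s, F i y, ContDiff.sum fun i _ => hF i,
    fun x => Finset.sum_congr rfl fun i _ => e i x⟩

theorem coe (i j : Fin 5) : IsSmooth fun x => x.1 i j :=
  ⟨fun y => y i j, by fun_prop, fun _ => rfl⟩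

theorem hasDerivAt (h : IsSmooth f) (x : SO5) (X : so5) :
    HasDerivAt (fun t : ℝ => f (x * expSO (t • X))) (lieDeriv f x X) 0 := by
  obtain ⟨F, hF, e⟩ := h
  have := hasDerivAt_ambient hF x X
  simp only [← e] at this
  exact this.differentiableAt.hasDerivAt

end IsSmooth

/-- The chain rule through an ambient extension. It makes linearity in the direction and smoothness
in the base point visible, neither of which is apparent from a derivative along a curve. -/
theorem lieDeriv_eq_fderiv {f : SO5 → ℝ} {F : (Fin 5 → Fin 5 → ℝ) → ℝ} (hF : ContDiff ℝ ∞ F)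
    (e : ∀ x : SO5, f x = F fun i j => x.1 i j) (x : SO5) (X : so5) :
    lieDeriv f x X = fderiv ℝ F (fun i j => x.1 i j) fun i j => (x.1 * X.1) i j := by
  have := hasDerivAt_ambient hF x X
  simp only [← e] at this
  exact this.deriv

section

variable {V W U : Type*} [AddCommGroup V] [Module ℝ V] [AddCommGroup W] [Module ℝ W]
  [AddCommGroup U] [Module ℝ U]

/-- `f` has the derivative `f'` along `t ↦ x exp(tX)` at `t = 0`, after composition with any linear
functional. -/
def HasLieDeriv (f : SO5 → V) (x : SO5) (X : so5) (f' : V) : Prop :=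
  ∀ ℓ : V →ₗ[ℝ] ℝ, HasDerivAt (fun t : ℝ => ℓ (f (x * expSO (t • X)))) (ℓ f') 0

/-- A vector-valued function is smooth if its composition with any linear functional is. -/
def SmoothMap (f : SO5 → V) : Prop := ∀ ℓ : V →ₗ[ℝ] ℝ, IsSmooth fun x => ℓ (f x)

theorem linearMap_real_apply (ℓ : ℝ →ₗ[ℝ] ℝ) (a : ℝ) : ℓ a = ℓ 1 * a := by
  conv_lhs => rw [← mul_one a, ← smul_eq_mul, map_smul, smul_eq_mul, mul_comm]

theorem smoothMap_real {f : SO5 → ℝ} : SmoothMap f ↔ IsSmooth f := by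
  refine ⟨fun h => h LinearMap.id, fun h ℓ => ?_⟩
  simp only [linearMap_real_apply ℓ (f _)]
  exact (IsSmooth.const _).mul h

theorem hasLieDeriv_real {f : SO5 → ℝ} {x : SO5} {X : so5} {f' : ℝ} :
    HasLieDeriv f x X f' ↔ HasDerivAt (fun t : ℝ => f (x * expSO (t • X))) f' 0 := by
  refine ⟨fun h => h LinearMap.id, fun h ℓ => ?_⟩
  simp only [linearMap_real_apply ℓ (f _), linearMap_real_apply ℓ f']
  exact h.const_mul _

theorem HasLieDeriv.lieDeriv_eq {f : SO5 → ℝ} {x : SO5} {X : so5} {f' : ℝ}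
    (h : HasLieDeriv f x X f') : lieDeriv f x X = f' :=
  (hasLieDeriv_real.1 h).deriv

theorem bilin_expand {ι κ : Type*} [Fintype ι] [Fintype κ] (b : Module.Basis ι ℝ V)
    (c : Module.Basis κ ℝ W) (B : V →ₗ[ℝ] W →ₗ[ℝ] ℝ) (v : V) (w : W) :
    B v w = ∑ i, ∑ j, (b.coord i v * c.coord j w) * B (b i) (c j) := by
  conv_lhs => rw [← b.sum_repr v, ← c.sum_repr w]
  simp only [map_sum, LinearMap.sum_apply, map_smul, LinearMap.smul_apply, smul_eq_mul,
    Module.Basis.coord_apply, mul_assoc]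
  rw [Finset.sum_comm]
  simp only [mul_left_comm, Finset.mul_sum]

namespace HasLieDeriv

variable {f f₁ : SO5 → V} {g : SO5 → W} {x : SO5} {X : so5} {f' f₁' : V} {g' : W}

theorem add (h : HasLieDeriv f x X f') (h₁ : HasLieDeriv f₁ x X f₁') :
    HasLieDeriv (fun y => f y + f₁ y) x X (f' + f₁') := fun ℓ => by
  simp only [map_add]; exact (h ℓ).add (h₁ ℓ)

theorem map (L : V →ₗ[ℝ] W) (h : HasLieDeriv f x X f') :
    HasLieDeriv (fun y => L (f y)) x X (L f') := fun ℓ => h (ℓ ∘ₗ L)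

theorem smul (c : ℝ) (h : HasLieDeriv f x X f') : HasLieDeriv (fun y => c • f y) x X (c • f') :=
  h.map (c • LinearMap.id)

theorem neg (h : HasLieDeriv f x X f') : HasLieDeriv (fun y => -f y) x X (-f') :=
  h.map (-LinearMap.id)

/-- The product rule. Derivatives are tested by functionals, so `B` is expanded in bases and the
scalar product rule is applied to the coordinates; this is where finite dimension enters. -/
theorem bilin [FiniteDimensional ℝ V] [FiniteDimensional ℝ W] (B : V →ₗ[ℝ] W →ₗ[ℝ] U)
    (hf : HasLieDeriv f x X f') (hg : HasLieDeriv g x X g') :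
    HasLieDeriv (fun y => B (f y) (g y)) x X (B f' (g x) + B (f x) g') := by
  intro ℓ
  let b := Module.finBasis ℝ V
  let c := Module.finBasis ℝ W
  let B' : V →ₗ[ℝ] W →ₗ[ℝ] ℝ := B.compr₂ ℓ
  have hB : ∀ v w, ℓ (B v w) = ∑ i, ∑ j, (b.coord i v * c.coord j w) * B' (b i) (c j) :=
    fun v w => bilin_expand b c B' v w
  simp only [map_add, hB]
  rw [← Finset.sum_add_distrib]
  refine HasDerivAt.fun_sum fun i _ => ?_
  rw [← Finset.sum_add_distrib]
  refine HasDerivAt.fun_sum fun j _ => ?_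
  have := ((hf (b.coord i)).mul (hg (c.coord j))).mul_const (B' (b i) (c j))
  rw [expSO_zero, mul_one, add_mul] at this
  exact this

theorem of_injective {L : V →ₗ[ℝ] W} (hL : Function.Injective L)
    (h : HasLieDeriv (fun y => L (f y)) x X (L f')) : HasLieDeriv f x X f' := by
  obtain ⟨M, hM⟩ := L.exists_leftInverse_of_injective (LinearMap.ker_eq_bot.2 hL)
  have hM' : ∀ v, M (L v) = v := fun v => LinearMap.congr_fun hM v
  have := h.map M
  simp only [hM'] at this
  exact this

end HasLieDeriv

theorem hasLieDeriv_coe (x : SO5) (X : so5) : HasLieDeriv (fun y => y.1) x X (x.1 * X.1) := by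
  intro ℓ
  have hℓ : ∀ M : Matrix (Fin 5) (Fin 5) ℝ, ℓ M = ∑ i, ∑ j, M i j * ℓ (Matrix.single i j 1) := by
    intro M
    conv_lhs => rw [Matrix.matrix_eq_sum_single M]
    simp only [map_sum]
    refine Finset.sum_congr rfl fun i _ => Finset.sum_congr rfl fun j _ => ?_
    rw [← smul_eq_mul, ← map_smul, Matrix.smul_single, smul_eq_mul, mul_one]
  simp only [hℓ (Subtype.val _), hℓ (x.1 * X.1)]
  refine HasDerivAt.fun_sum fun i _ => HasDerivAt.fun_sum fun j _ => HasDerivAt.mul_const ?_ _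
  have h := hasDerivAt_mul_expSO x X
  rw [hasDerivAt_pi] at h
  exact hasDerivAt_pi.1 (h i) j

theorem hasLieDeriv_coe_inv (x : SO5) (X : so5) :
    HasLieDeriv (fun y => (y⁻¹ : SO5).1) x X (-(X.1 * (x⁻¹ : SO5).1)) := by
  have h := (hasLieDeriv_coe x X).map (Matrix.transposeLinearEquiv (Fin 5) (Fin 5) ℝ ℝ).toLinearMap
  have hX := (LieAlgebra.Orthogonal.mem_so (Fin 5) ℝ X.1).1 X.2
  have e : (Matrix.transposeLinearEquiv (Fin 5) (Fin 5) ℝ ℝ).toLinearMap (x.1 * X.1)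
      = -(X.1 * (x⁻¹ : SO5).1) := by
    change (x.1 * X.1)ᵀ = _
    rw [Matrix.transpose_mul, hX, SO5.coe_inv, Matrix.neg_mul]
  rw [e] at h
  exact h

namespace SmoothMap

variable {f f₁ : SO5 → V} {g : SO5 → W}

theorem add (h : SmoothMap f) (h₁ : SmoothMap f₁) : SmoothMap fun y => f y + f₁ y := fun ℓ => by
  simp only [map_add]; exact (h ℓ).add (h₁ ℓ)

theorem map (L : V →ₗ[ℝ] W) (h : SmoothMap f) : SmoothMap fun y => L (f y) := fun ℓ => h (ℓ ∘ₗ L)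

theorem bilin [FiniteDimensional ℝ V] [FiniteDimensional ℝ W] (B : V →ₗ[ℝ] W →ₗ[ℝ] U)
    (hf : SmoothMap f) (hg : SmoothMap g) : SmoothMap fun y => B (f y) (g y) := by
  intro ℓ
  let b := Module.finBasis ℝ V
  let c := Module.finBasis ℝ W
  have hB : ∀ v w, ℓ (B v w) = ∑ i, ∑ j, (b.coord i v * c.coord j w) * (B.compr₂ ℓ) (b i) (c j) :=
    fun v w => bilin_expand b c (B.compr₂ ℓ) v w
  simp only [hB]
  exact IsSmooth.sum fun i => IsSmooth.sum fun j =>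
    ((hf (b.coord i)).mul (hg (c.coord j))).mul (IsSmooth.const _)

theorem of_injective {L : V →ₗ[ℝ] W} (hL : Function.Injective L)
    (h : SmoothMap fun y => L (f y)) : SmoothMap f := by
  obtain ⟨M, hM⟩ := L.exists_leftInverse_of_injective (LinearMap.ker_eq_bot.2 hL)
  have hM' : ∀ v, M (L v) = v := fun v => LinearMap.congr_fun hM v
  have := h.map M
  simp only [hM'] at this
  exact this

theorem of_entries {f : SO5 → Matrix (Fin 5) (Fin 5) ℝ} (h : ∀ i j, IsSmooth fun x => f x i j) :
    SmoothMap f := by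
  intro ℓ
  have hℓ : ∀ M : Matrix (Fin 5) (Fin 5) ℝ, ℓ M = ∑ i, ∑ j, M i j * ℓ (Matrix.single i j 1) := by
    intro M
    conv_lhs => rw [Matrix.matrix_eq_sum_single M]
    simp only [map_sum]
    refine Finset.sum_congr rfl fun i _ => Finset.sum_congr rfl fun j _ => ?_
    rw [← smul_eq_mul, ← map_smul, Matrix.smul_single, smul_eq_mul, mul_one]
  simp only [hℓ (f _)]
  exact IsSmooth.sum fun i => IsSmooth.sum fun j => (h i j).mul (IsSmooth.const _)

theorem coe : SmoothMap fun x : SO5 => x.1 := of_entries IsSmooth.coe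

end SmoothMap

/-- The derivative of a vector-valued function along `t ↦ x exp(tX)`. -/
def lieD [FiniteDimensional ℝ V] (f : SO5 → V) (x : SO5) (X : so5) : V :=
  ∑ i, lieDeriv (fun y => (Module.finBasis ℝ V).coord i (f y)) x X • Module.finBasis ℝ V i

theorem SmoothMap.hasLieDeriv [FiniteDimensional ℝ V] {f : SO5 → V} (h : SmoothMap f) (x : SO5)
    (X : so5) : HasLieDeriv f x X (lieD f x X) := by
  intro ℓ
  have hℓ : ∀ v, ℓ v = ∑ i, (Module.finBasis ℝ V).coord i v * ℓ (Module.finBasis ℝ V i) := by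
    intro v
    conv_lhs => rw [← (Module.finBasis ℝ V).sum_repr v]
    simp only [map_sum, map_smul, smul_eq_mul, Module.Basis.coord_apply]
  simp only [lieD, map_sum, map_smul, smul_eq_mul]
  simp only [hℓ (f _)]
  exact HasDerivAt.fun_sum fun i _ => ((h _).hasDerivAt x X).mul_const _

theorem HasLieDeriv.lieD_eq [FiniteDimensional ℝ V] {f : SO5 → V} {x : SO5} {X : so5} {f' : V}
    (h : HasLieDeriv f x X f') : lieD f x X = f' := by
  rw [lieD]
  conv_rhs => rw [← (Module.finBasis ℝ V).sum_repr f']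
  exact Finset.sum_congr rfl fun i _ => by rw [(h.map _).lieDeriv_eq]; rfl

/-- The matrix entries as linear functionals on `so(5)`. -/
def entry (i j : Fin 5) : so5 →ₗ[ℝ] ℝ where
  toFun X := X.1 i j
  map_add' _ _ := rfl
  map_smul' _ _ := rfl

theorem IsSmooth.lieDeriv {f : SO5 → ℝ} (hf : IsSmooth f) {ξ : SO5 → so5} (hξ : SmoothMap ξ) :
    IsSmooth fun x => lieDeriv f x (ξ x) := by
  obtain ⟨F, hF, e⟩ := hf
  have h : ∀ i j, IsSmooth fun x => (ξ x).1 i j := fun i j =>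
    hξ (entry i j)
  choose N hN eN using h
  refine ⟨fun y => fderiv ℝ F y fun i j => ∑ k, y i k * N k j y, ?_, fun x => ?_⟩
  · refine (hF.fderiv_right (m := ∞) (by simp)).clm_apply ?_
    refine contDiff_pi.2 fun i => contDiff_pi.2 fun j => ContDiff.sum fun k _ => ?_
    exact ContDiff.mul (by fun_prop) (hN k j)
  · refine (lieDeriv_eq_fderiv hF e x (ξ x)).trans (congrArg _ ?_)
    ext i j
    exact Matrix.mul_apply.trans (Finset.sum_congr rfl fun k _ => congrArg _ (eN k j x))

theorem SmoothMap.lieD [FiniteDimensional ℝ V] {f : SO5 → V} (hf : SmoothMap f) {ξ : SO5 → so5}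
    (hξ : SmoothMap ξ) : SmoothMap fun x => lieD f x (ξ x) := by
  intro ℓ
  simp only [Berger.lieD, map_sum, map_smul, smul_eq_mul]
  exact IsSmooth.sum fun i => ((hf _).lieDeriv hξ).mul (IsSmooth.const _)

theorem IsSmooth.lieDeriv_add {f : SO5 → ℝ} (hf : IsSmooth f) (x : SO5) (X Y : so5) :
    Berger.lieDeriv f x (X + Y) = Berger.lieDeriv f x X + Berger.lieDeriv f x Y := by
  obtain ⟨F, hF, e⟩ := hf
  simp only [lieDeriv_eq_fderiv hF e]
  rw [← map_add]
  congr 1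
  ext i j
  exact congrFun (congrFun (Matrix.mul_add x.1 X.1 Y.1) i) j

theorem IsSmooth.lieDeriv_smul {f : SO5 → ℝ} (hf : IsSmooth f) (x : SO5) (c : ℝ) (X : so5) :
    Berger.lieDeriv f x (c • X) = c * Berger.lieDeriv f x X := by
  obtain ⟨F, hF, e⟩ := hf
  simp only [lieDeriv_eq_fderiv hF e]
  refine Eq.trans (congrArg _ ?_) (map_smul _ c _)
  ext i j
  exact congrFun (congrFun (Matrix.mul_smul x.1 c X.1) i) j

/-- The derivative of a smooth function as a linear function of the direction. -/
def lieDerivLinear {f : SO5 → ℝ} (hf : IsSmooth f) (x : SO5) : so5 →ₗ[ℝ] ℝ where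
  toFun := lieDeriv f x
  map_add' := hf.lieDeriv_add x
  map_smul' := hf.lieDeriv_smul x

/-- The derivative of a smooth map as a linear function of the direction. -/
def lieDLinear [FiniteDimensional ℝ V] {f : SO5 → V} (hf : SmoothMap f) (x : SO5) : so5 →ₗ[ℝ] V :=
  ∑ i, (lieDerivLinear (hf ((Module.finBasis ℝ V).coord i)) x).smulRight (Module.finBasis ℝ V i)

theorem lieDLinear_apply [FiniteDimensional ℝ V] {f : SO5 → V} (hf : SmoothMap f) (x : SO5) (X : so5) :
    lieDLinear hf x X = lieD f x X := by
  rw [lieDLinear, LinearMap.sum_apply]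
  rfl

end

/-! ## The isotropy group and its Lie algebra -/

theorem ip_comm (X Y : so5) : ip X Y = ip Y X := by
  rw [ip_eq, ip_eq, Matrix.trace_mul_comm]

theorem ip_lie (X Y Z : so5) : ip ⁅X, Y⁆ Z = -ip Y ⁅X, Z⁆ := by
  rw [← lie_skew, ip, map_neg, LinearMap.neg_apply, LieModule.traceForm_apply_lie_apply]
  simp [ip]

/-- `sym` as a linear map. -/
def symL : (Fin 5 → ℝ) →ₗ[ℝ] Matrix (Fin 3) (Fin 3) ℝ where
  toFun := sym
  map_add' := sym_add
  map_smul' := sym_smul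

theorem exp_mem_SO3 {A : Matrix (Fin 3) (Fin 3) ℝ} (hA : Aᵀ = -A) :
    NormedSpace.exp A ∈ Matrix.specialOrthogonalGroup (Fin 3) ℝ := by
  have horth : ∀ B : Matrix (Fin 3) (Fin 3) ℝ, Bᵀ = -B →
      (NormedSpace.exp B)ᵀ * NormedSpace.exp B = 1 := by
    intro B hB
    rw [← Matrix.exp_transpose, hB,
      ← Matrix.exp_add_of_commute _ _ (Commute.neg_left (Commute.refl B)), neg_add_cancel,
      NormedSpace.exp_zero]
  have hdet : (NormedSpace.exp A).det = 1 := by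
    have h1 := congrArg Matrix.det (horth ((1 / 2 : ℝ) • A) (by simp [hA]))
    rw [Matrix.det_mul, Matrix.det_transpose, Matrix.det_one] at h1
    -- Orthogonality gives only determinant `±1`; writing `exp A` as the square of `exp (A/2)`
    -- removes the sign.
    have h2 : A = (1 / 2 : ℝ) • A + (1 / 2 : ℝ) • A := by
      rw [← add_smul]; norm_num
    rw [h2, Matrix.exp_add_of_commute _ _ (Commute.refl _), Matrix.det_mul, h1]
  exact Matrix.mem_specialOrthogonalGroup_iff.2
    ⟨(Matrix.mem_orthogonalGroup_iff' _ _).2 (horth A hA), hdet⟩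

theorem expSO_mem {X : so5} (hX : X ∈ isotropyAlgebra) : expSO X ∈ SO3irr := by
  obtain ⟨A, hA, h⟩ := hX
  rw [LieAlgebra.Orthogonal.mem_so] at hA
  refine ⟨NormedSpace.exp A, exp_mem_SO3 hA, fun v => ?_⟩
  let _ : NormedRing (Matrix (Fin 5) (Fin 5) ℝ) := Matrix.linftyOpNormedRing
  let _ : NormedAlgebra ℝ (Matrix (Fin 5) (Fin 5) ℝ) := Matrix.linftyOpNormedAlgebra
  let _ : NormedRing (Matrix (Fin 3) (Fin 3) ℝ) := Matrix.linftyOpNormedRing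
  let _ : NormedAlgebra ℝ (Matrix (Fin 3) (Fin 3) ℝ) := Matrix.linftyOpNormedAlgebra
  let T : Matrix (Fin 5) (Fin 5) ℝ →L[ℝ] Matrix (Fin 3) (Fin 3) ℝ := LinearMap.toContinuousLinearMap
    (symL ∘ₗ (Matrix.mulVecBilin ℝ ℝ).flip v)
  have hT : ∀ M, T M = sym (M *ᵥ v) := fun _ => rfl
  -- Conjugating back the transported matrix gives a constant function of `t`: its derivative
  -- vanishes by the infinitesimal intertwining relation. Comparing `t = 1` with `t = 0` gives the
  -- relation for the groups.
  let G : ℝ → Matrix (Fin 3) (Fin 3) ℝ := fun t =>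
    NormedSpace.exp (t • -A) * T (NormedSpace.exp (t • X.1)) * NormedSpace.exp (t • A)
  have hG : ∀ t, HasDerivAt G 0 t := by
    intro t
    have h1 := hasDerivAt_exp_smul_const (𝕂 := ℝ) (-A) t
    have h3 := hasDerivAt_exp_smul_const' (𝕂 := ℝ) A t
    have e : T (X.1 * NormedSpace.exp (t • X.1))
        = A * T (NormedSpace.exp (t • X.1)) - T (NormedSpace.exp (t • X.1)) * A := by
      rw [hT, hT, ← Matrix.mulVec_mulVec, h]
    have h2 : HasDerivAt (fun u : ℝ => T (NormedSpace.exp (u • X.1)))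
        (A * T (NormedSpace.exp (t • X.1)) - T (NormedSpace.exp (t • X.1)) * A) t :=
      (T.hasFDerivAt.comp_hasDerivAt t (hasDerivAt_exp_smul_const' (𝕂 := ℝ) X.1 t)).congr_deriv e
    refine ((h1.mul h2).mul h3).congr_deriv ?_
    simp only [Pi.mul_apply]
    noncomm_ring
  have hc := is_const_of_deriv_eq_zero (fun t => (hG t).differentiableAt)
    (fun t => (hG t).deriv) 1 0
  simp only [G, one_smul, zero_smul, NormedSpace.exp_zero, one_mul, mul_one, hT,
    Matrix.one_mulVec] at hc
  have hT' : (NormedSpace.exp A)ᵀ = NormedSpace.exp (-A) := by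
    rw [← Matrix.exp_transpose, hA]
  have hR : NormedSpace.exp A * NormedSpace.exp (-A) = 1 := by
    rw [← Matrix.exp_add_of_commute _ _ (Commute.neg_right (Commute.refl A)), add_neg_cancel,
      NormedSpace.exp_zero]
  rw [hT', ← hc]
  calc sym ((expSO X).1 *ᵥ v) = (NormedSpace.exp A * NormedSpace.exp (-A)) *
        sym ((expSO X).1 *ᵥ v) * (NormedSpace.exp A * NormedSpace.exp (-A)) := by
        rw [hR, one_mul, mul_one]
    _ = _ := by simp only [mul_assoc]; rfl

/-- The Killing form is definite, hence nondegenerate, so the isotropy algebra is its own double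
orthogonal complement, and the difference is orthogonal to `𝔪`. -/
theorem sub_proj_mem (X : so5) : X - (proj X).1 ∈ isotropyAlgebra := by
  have hn : (killingForm ℝ so5).Nondegenerate := by
    have hr : (killingForm ℝ so5).IsRefl := (LieModule.traceForm_isSymm ℝ so5 so5).isRefl
    refine hr.nondegenerate_iff_separatingLeft.2 fun Y hY => ?_
    exact eq_zero_of_ip_self (by rw [ip, hY, neg_zero])
  have h := LinearMap.BilinForm.orthogonal_orthogonal hn
    (LieModule.traceForm_isSymm ℝ so5 so5).isRefl isotropyAlgebra
  rw [← h, LinearMap.BilinForm.mem_orthogonal_iff]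
  intro Y hY
  have h1 := ip_proj X ⟨Y, hY⟩
  have h2 : ip Y (X - (proj X).1) = 0 := by
    rw [ip, map_sub, neg_sub, sub_eq_zero]
    have := ip_comm Y X
    have := ip_comm Y (proj X).1
    simp only [ip] at *
    linarith
  exact neg_eq_zero.1 h2

theorem expSO_Ad (k : SO5) (X : so5) : expSO (Ad k X) = k * expSO X * k⁻¹ := by
  apply Subtype.ext
  have hk : IsUnit k.1 := ⟨⟨k.1, k.1ᵀ, SO5.mul_transpose k, SO5.transpose_mul k⟩, rfl⟩
  have h := Matrix.exp_conj k.1 X.1 hk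
  have hi : k.1⁻¹ = k.1ᵀ := Matrix.inv_eq_right_inv (SO5.mul_transpose k)
  rw [hi] at h
  exact h

theorem lieDeriv_eq_zero_of_mem {f : BergerSpace → ℝ} {x : SO5} {X : so5}
    (hX : X ∈ isotropyAlgebra) : lieDeriv (fun y => f y) x X = 0 := by
  have : (fun t : ℝ => f ((x * expSO (t • X) : SO5) : BergerSpace)) = fun _ => f x := by
    ext t
    congr 1
    exact QuotientGroup.mk_mul_of_mem x (expSO_mem (Submodule.smul_mem _ t hX))
  rw [lieDeriv, this, deriv_const]

/-- Functions on the quotient are constant along isotropy directions, so only the `𝔪`-part of a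
direction acts on them. This absorbs the isotropy part of `[ξ, η]` in the torsion. -/
theorem lieDeriv_proj {f : BergerSpace → ℝ} (hf : IsSmooth fun x => f x) (x : SO5) (X : so5) :
    lieDeriv (fun y => f y) x (proj X).1 = lieDeriv (fun y => f y) x X := by
  have h := lieDeriv_eq_zero_of_mem (f := f) (x := x) (sub_proj_mem X)
  have h2 := hf.lieDeriv_add x (X - (proj X).1) (proj X).1
  rw [h, sub_add_cancel, zero_add] at h2
  exact h2.symm

/-! ## The canonical form of the Levi-Civita connection -/

/-- The Lie bracket as a bilinear map. -/
def lieBil : so5 →ₗ[ℝ] so5 →ₗ[ℝ] so5 := (LieAlgebra.ad ℝ so5 : so5 →ₗ[ℝ] Module.End ℝ so5)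

/-- The `𝔪`-part of the bracket of two elements of `𝔪`. -/
def br : 𝔪 →ₗ[ℝ] 𝔪 →ₗ[ℝ] 𝔪 := (lieBil.compl₁₂ 𝔪.subtype 𝔪.subtype).compr₂ proj

theorem br_apply (X Y : 𝔪) : br X Y = proj ⁅X.1, Y.1⁆ := rfl

/-- The metric as a bilinear map. -/
def gL : 𝔪 →ₗ[ℝ] 𝔪 →ₗ[ℝ] ℝ := -((killingForm ℝ so5).compl₁₂ 𝔪.subtype 𝔪.subtype)

theorem gL_apply (X Y : 𝔪) : gL X Y = g X Y := rfl

theorem g_comm (X Y : 𝔪) : g X Y = g Y X := ip_comm _ _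

theorem br_skew (X Y : 𝔪) : br X Y = -br Y X := by
  rw [br_apply, br_apply, ← lie_skew, map_neg]

theorem br_self (X : 𝔪) : br X X = 0 := by
  rw [br_apply, lie_self, map_zero]

/-- Natural reductivity, inherited from the ad-invariance of the Killing form. It makes the
connection metric and the `G₂`-form alternating. -/
theorem g_br (X Y Z : 𝔪) : g (br X Y) Z = -g Y (br X Z) := by
  have h1 : g (br X Y) Z = ip ⁅X.1, Y.1⁆ Z.1 := ip_proj _ _
  have h2 : g (br X Z) Y = ip ⁅X.1, Z.1⁆ Y.1 := ip_proj _ _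
  rw [h1, g_comm Y, h2, ip_lie, ip_comm]

theorem Ad_lie (x : SO5) (X Y : so5) : Ad x ⁅X, Y⁆ = ⁅Ad x X, Ad x Y⁆ := by
  apply Subtype.ext
  have : ∀ U V : so5, x.1 * U.1 * x.1ᵀ * (x.1 * V.1 * x.1ᵀ) = x.1 * (U.1 * V.1) * x.1ᵀ := by
    intro U V
    calc _ = x.1 * U.1 * (x.1ᵀ * x.1) * V.1 * x.1ᵀ := by simp only [Matrix.mul_assoc]
      _ = _ := by rw [SO5.transpose_mul]; simp only [Matrix.mul_assoc, Matrix.one_mul]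
  rw [Ad_coe, so5.coe_bracket, so5.coe_bracket, Ad_coe, Ad_coe, this, this]
  simp only [Matrix.mul_sub, Matrix.sub_mul]

theorem isotropyRep_br (k : SO3irr) (X Y : 𝔪) :
    isotropyRep k (br X Y) = br (isotropyRep k X) (isotropyRep k Y) := by
  rw [br_apply, ← proj_Ad k.2, Ad_lie]
  rfl

/-- Since `xk exp(t Ad(k⁻¹)X) = x exp(tX) k`, differentiating an equivariant function yields an
equivariant function; hence `leviCivita` returns vector fields on the quotient. -/
theorem HasLieDeriv.right_translate {V : Type*} [AddCommGroup V] [Module ℝ V] {f : SO5 → V}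
    {x : SO5} {X : so5} {f' : V} (h : HasLieDeriv f x X f') (k : SO5) (L : V →ₗ[ℝ] V)
    (hL : ∀ y, f (y * k) = L (f y)) : HasLieDeriv f (x * k) (Ad k⁻¹ X) (L f') := by
  intro ℓ
  have e : ∀ t : ℝ, x * k * expSO (t • Ad k⁻¹ X) = x * expSO (t • X) * k := by
    intro t
    rw [← map_smul, expSO_Ad]
    group
  simp only [e, hL]
  exact h.map L ℓ

/-- The inclusion of `so(5)` into the matrices. -/
def coeL : so5 →ₗ[ℝ] Matrix (Fin 5) (Fin 5) ℝ where
  toFun X := X.1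
  map_add' _ _ := rfl
  map_smul' _ _ := rfl

theorem VectorField.smoothMap (η : VectorField) : SmoothMap fun x => η x :=
  SmoothMap.of_injective (L := coeL ∘ₗ 𝔪.subtype)
    (fun _ _ h => Subtype.ext (Subtype.ext h)) (SmoothMap.of_entries η.smooth)

theorem VectorField.smoothMap_coe (η : VectorField) : SmoothMap fun x => (η x).1 :=
  η.smoothMap.map 𝔪.subtype

theorem VectorField.ext {ξ η : VectorField} (h : ∀ x, ξ x = η x) : ξ = η := by
  cases ξ; cases η
  congr
  exact funext h

/-- The Levi-Civita connection of the normal metric: `∇_ξ η = ξ(η) + ½ [ξ, η]_𝔪`. -/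
def leviCivita (ξ η : VectorField) : VectorField where
  toFun x := lieD (fun y => η y) x (ξ x).1 + (1 / 2 : ℝ) • br (ξ x) (η x)
  smooth i j := by
    have h := ((η.smoothMap.lieD ξ.smoothMap_coe).add (ξ.smoothMap.bilin ((1 / 2 : ℝ) • br)
      η.smoothMap)) (entry i j ∘ₗ 𝔪.subtype)
    exact h
  equivariant x k := by
    have h := ((η.smoothMap.hasLieDeriv x (ξ x).1).right_translate k.1 (isotropyRep k⁻¹)
      fun y => η.equivariant y k).lieD_eq
    have e : Ad (k.1)⁻¹ (ξ x).1 = (ξ (x * k)).1 := by rw [ξ.equivariant]; rfl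
    rw [e] at h
    rw [h, ξ.equivariant, η.equivariant, ← isotropyRep_br, map_add, map_smul]

theorem leviCivita_apply (ξ η : VectorField) (x : SO5) :
    leviCivita ξ η x = lieD (fun y => η y) x (ξ x).1 + (1 / 2 : ℝ) • br (ξ x) (η x) := rfl

/-- In the commutator the second derivatives of the ambient extension cancel by symmetry. What
remains is the matrix commutator, from moving the base point `x`, and the derivatives of the
coefficients `ξ` and `η`. -/
theorem lieDeriv_lieDeriv {f : SO5 → ℝ} (hf : IsSmooth f) {ξ η : SO5 → so5} (hξ : SmoothMap ξ)
    (hη : SmoothMap η) (x : SO5) :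
    lieDeriv (fun y => lieDeriv f y (η y)) x (ξ x) - lieDeriv (fun y => lieDeriv f y (ξ y)) x (η x)
      = lieDeriv f x (⁅ξ x, η x⁆ + (lieD η x (ξ x) - lieD ξ x (η x))) := by
  obtain ⟨F, hF, e⟩ := hf
  have key : ∀ {ζ : SO5 → so5}, SmoothMap ζ → ∀ X : so5,
      lieDeriv (fun y => lieDeriv f y (ζ y)) x X
        = fderiv ℝ (fderiv ℝ F) (fun i j => x.1 i j) (fun i j => (x.1 * X.1) i j)
            (fun i j => (x.1 * (ζ x).1) i j)
          + fderiv ℝ F (fun i j => x.1 i j) (fun i j => (x.1 * X.1 * (ζ x).1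
            + x.1 * (lieD ζ x X).1) i j) := by
    intro ζ hζ X
    have h1 : HasDerivAt (fun t : ℝ => fderiv ℝ F (fun i j => (x * expSO (t • X)).1 i j))
        (fderiv ℝ (fderiv ℝ F) (fun i j => x.1 i j) fun i j => (x.1 * X.1) i j) 0 := by
      have d : DifferentiableAt ℝ (fderiv ℝ F) (fun i j => (x * expSO ((0 : ℝ) • X)).1 i j) :=
        ((hF.fderiv_right (m := ∞) (by simp)).differentiable (by simp)).differentiableAt
      have := d.hasFDerivAt.comp_hasDerivAt (0 : ℝ) (hasDerivAt_mul_expSO x X)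
      rw [expSO_zero, mul_one] at this
      exact this
    have h2 : HasDerivAt (fun t : ℝ => (fun i j => ((x * expSO (t • X)).1 *
        (ζ (x * expSO (t • X))).1) i j : Fin 5 → Fin 5 → ℝ))
        (fun i j => (x.1 * X.1 * (ζ x).1 + x.1 * (lieD ζ x X).1) i j) 0 := by
      have hm := (hasLieDeriv_coe x X).bilin (LinearMap.mul ℝ (Matrix (Fin 5) (Fin 5) ℝ))
        ((hζ.hasLieDeriv x X).map coeL)
      exact hasDerivAt_pi.2 fun i => hasDerivAt_pi.2 fun j => hm (Matrix.entryLinearMap ℝ ℝ i j)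
    have h3 := h1.clm_apply h2
    rw [expSO_zero, mul_one] at h3
    have h4 : (fun t : ℝ => lieDeriv f (x * expSO (t • X)) (ζ (x * expSO (t • X)))) = _ :=
      funext fun t => lieDeriv_eq_fderiv hF e _ _
    rw [lieDeriv, h4]
    exact h3.deriv
  rw [key hη, key hξ, lieDeriv_eq_fderiv hF e]
  have hs : IsSymmSndFDerivAt ℝ F (fun i j => x.1 i j) :=
    hF.contDiffAt.isSymmSndFDerivAt (by simp only [minSmoothness_of_isRCLikeNormedField]; exact ENat.LEInfty.out)
  rw [hs.eq (fun i j => (x.1 * (ξ x).1) i j), add_sub_add_left_eq_sub, ← map_sub]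
  congr 1
  ext i j
  have : x.1 * (ξ x).1 * (η x).1 + x.1 * (lieD η x (ξ x)).1
      - (x.1 * (η x).1 * (ξ x).1 + x.1 * (lieD ξ x (η x)).1)
      = x.1 * (⁅ξ x, η x⁆ + (lieD η x (ξ x) - lieD ξ x (η x)) : so5).1 := by
    change _ = x.1 * ((ξ x).1 * (η x).1 - (η x).1 * (ξ x).1
      + ((lieD η x (ξ x)).1 - (lieD ξ x (η x)).1))
    noncomm_ring
  exact congrFun (congrFun this i) j

/-- The bracket term drops out of the metric condition by `g_br`. Skew-symmetrised, `½[ξ, η]_𝔪`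
becomes `[ξ, η]_𝔪`, which is all that functions on the quotient see of `[ξ, η]`, so the torsion
vanishes. -/
theorem isLeviCivita_leviCivita : IsLeviCivita leviCivita where
  add_left ξ₁ ξ₂ ξ₃ η h x := by
    simp only [leviCivita_apply, h, ← lieDLinear_apply η.smoothMap]
    rw [Submodule.coe_add, map_add, map_add, LinearMap.add_apply, smul_add]
    abel
  smul_left f _ ξ ξ' η h x := by
    simp only [leviCivita_apply, h, ← lieDLinear_apply η.smoothMap]
    rw [Submodule.coe_smul, map_smul, map_smul, LinearMap.smul_apply, smul_add,
      smul_comm (1 / 2 : ℝ)]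
  add_right ξ η₁ η₂ η₃ h x := by
    have e := ((η₁.smoothMap.hasLieDeriv x (ξ x).1).add (η₂.smoothMap.hasLieDeriv x (ξ x).1)).lieD_eq
    simp only [leviCivita_apply, h, e, map_add, smul_add]
    abel
  leibniz f hf ξ η η' h x := by
    have e := ((smoothMap_real.2 hf).hasLieDeriv x (ξ x).1).bilin (LinearMap.lsmul ℝ 𝔪)
      (η.smoothMap.hasLieDeriv x (ξ x).1)
    rw [← ((smoothMap_real.2 hf).hasLieDeriv x (ξ x).1).lieDeriv_eq] at e
    simp only [leviCivita_apply, h]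
    rw [show (fun y : SO5 => f (y : BergerSpace) • η y) =
      fun y : SO5 => LinearMap.lsmul ℝ 𝔪 (f (y : BergerSpace)) (η y) from rfl, e.lieD_eq,
      map_smul, smul_comm (1 / 2 : ℝ), smul_add]
    simp only [LinearMap.lsmul_apply]
    abel
  metric ξ η ζ x := by
    have e := (η.smoothMap.hasLieDeriv x (ξ x).1).bilin gL (ζ.smoothMap.hasLieDeriv x (ξ x).1)
    refine e.lieDeriv_eq.trans ?_
    simp only [leviCivita_apply, ← gL_apply, map_add, map_smul, LinearMap.add_apply,
      LinearMap.smul_apply, smul_eq_mul]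
    have := g_br (ξ x) (η x) (ζ x)
    simp only [← gL_apply] at this
    rw [this]
    ring
  torsion_free f hf ξ η x := by
    have h := lieDeriv_lieDeriv hf ξ.smoothMap_coe η.smoothMap_coe x
    have hc : ∀ (ζ : VectorField) (X : so5),
        lieD (fun y => (ζ y).1) x X = (lieD (fun y => ζ y) x X).1 := fun ζ X =>
      ((ζ.smoothMap.hasLieDeriv x X).map 𝔪.subtype).lieD_eq
    rw [h, hc, hc, hf.lieDeriv_add, ← lieDeriv_proj hf x ⁅(ξ x).1, (η x).1⁆]
    change _ = lieDerivLinear hf x _ - lieDerivLinear hf x _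
    change lieDerivLinear hf x _ + lieDerivLinear hf x _ = _
    rw [← map_sub, ← map_add, leviCivita_apply, leviCivita_apply, br_skew (η x), br_apply]
    congr 1
    simp only [Submodule.coe_add, Submodule.coe_smul, Submodule.coe_neg, smul_neg]
    module

/-! ## An adapted basis of `so(5)` -/

/-- Ten times the structure constants of the adapted basis. -/
def bracketTable : List (List (List ℤ)) := [
  [[0, 0, 0, 0, 0, 0, 0, 0, 0, 0],
   [0, 0, 10, 0, 0, 0, 0, 0, 0, 0],
   [0, -10, 0, 0, 0, 0, 0, 0, 0, 0],
   [0, 0, 0, 0, 10, 0, 0, 0, 0, 0],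
   [0, 0, 0, -10, 0, 0, 0, 0, 0, 0],
   [0, 0, 0, 0, 0, 0, 10, 0, 0, 60],
   [0, 0, 0, 0, 0, -10, 0, 0, -60, 0]],
  [[0, 0, -10, 0, 0, 0, 0, 0, 0, 0],
   [0, 0, 0, 0, 0, 0, 0, 0, 0, 0],
   [6, 0, 0, 0, 0, 0, 0, -12, 0, 0],
   [0, 0, 0, 0, 0, 2, 0, 0, -6, 0],
   [0, 0, 0, 0, 0, 0, -2, 0, 0, 6],
   [0, 0, 0, -30, 0, 0, 0, 0, 30, 0],
   [0, 0, 0, 0, 30, 0, 0, 0, 0, -30]],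
  [[0, 10, 0, 0, 0, 0, 0, 0, 0, 0],
   [-6, 0, 0, 0, 0, 0, 0, 12, 0, 0],
   [0, 0, 0, 0, 0, 0, 0, 0, 0, 0],
   [0, 0, 0, 0, 0, 0, -2, 0, 0, 6],
   [0, 0, 0, 0, 0, -2, 0, 0, 6, 0],
   [0, 0, 0, 0, 30, 0, 0, 0, 0, 30],
   [0, 0, 0, 30, 0, 0, 0, 0, 30, 0]],
  [[0, 0, 0, 0, -10, 0, 0, 0, 0, 0],
   [0, 0, 0, 0, 0, -2, 0, 0, 6, 0],
   [0, 0, 0, 0, 0, 0, 2, 0, 0, -6],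
   [0, 0, 0, 0, 0, 0, 0, 0, 0, 0],
   [4, 0, 0, 0, 0, 0, 0, 12, 0, 0],
   [0, 20, 0, 0, 0, 0, 0, 0, 0, 0],
   [0, 0, -20, 0, 0, 0, 0, 0, 0, 0]],
  [[0, 0, 0, 10, 0, 0, 0, 0, 0, 0],
   [0, 0, 0, 0, 0, 0, 2, 0, 0, -6],
   [0, 0, 0, 0, 0, 2, 0, 0, -6, 0],
   [-4, 0, 0, 0, 0, 0, 0, -12, 0, 0],
   [0, 0, 0, 0, 0, 0, 0, 0, 0, 0],
   [0, 0, -20, 0, 0, 0, 0, 0, 0, 0],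
   [0, -20, 0, 0, 0, 0, 0, 0, 0, 0]],
  [[0, 0, 0, 0, 0, 0, -10, 0, 0, -60],
   [0, 0, 0, 30, 0, 0, 0, 0, -30, 0],
   [0, 0, 0, 0, -30, 0, 0, 0, 0, -30],
   [0, -20, 0, 0, 0, 0, 0, 0, 0, 0],
   [0, 0, 20, 0, 0, 0, 0, 0, 0, 0],
   [0, 0, 0, 0, 0, 0, 0, 0, 0, 0],
   [60, 0, 0, 0, 0, 0, 0, -60, 0, 0]],
  [[0, 0, 0, 0, 0, 10, 0, 0, 60, 0],
   [0, 0, 0, 0, -30, 0, 0, 0, 0, 30],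
   [0, 0, 0, -30, 0, 0, 0, 0, -30, 0],
   [0, 0, 20, 0, 0, 0, 0, 0, 0, 0],
   [0, 20, 0, 0, 0, 0, 0, 0, 0, 0],
   [-60, 0, 0, 0, 0, 0, 0, 60, 0, 0],
   [0, 0, 0, 0, 0, 0, 0, 0, 0, 0]],
  [[0, 0, 0, 0, 0, 0, 0, 0, 0, 0],
   [0, 0, -20, 0, 0, 0, 0, 0, 0, 0],
   [0, 20, 0, 0, 0, 0, 0, 0, 0, 0],
   [0, 0, 0, 0, 30, 0, 0, 0, 0, 0],
   [0, 0, 0, -30, 0, 0, 0, 0, 0, 0],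
   [0, 0, 0, 0, 0, 0, -10, 0, 0, 0],
   [0, 0, 0, 0, 0, 10, 0, 0, 0, 0]],
  [[0, 0, 0, 0, 0, 0, -10, 0, 0, 0],
   [0, 0, 0, -15, 0, 5, 0, 0, 0, 0],
   [0, 0, 0, 0, 15, 0, 5, 0, 0, 0],
   [0, 10, 0, 0, 0, 0, 0, 0, 0, 0],
   [0, 0, -10, 0, 0, 0, 0, 0, 0, 0],
   [0, -50, 0, 0, 0, 0, 0, 0, 0, 0],
   [60, 0, -50, 0, 0, 0, 0, 0, 0, 0]],
  [[0, 0, 0, 0, 0, 10, 0, 0, 0, 0],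
   [0, 0, 0, 0, 15, 0, -5, 0, 0, 0],
   [0, 0, 0, 15, 0, 5, 0, 0, 0, 0],
   [0, 0, -10, 0, 0, 0, 0, 0, 0, 0],
   [0, -10, 0, 0, 0, 0, 0, 0, 0, 0],
   [-60, 0, -50, 0, 0, 0, 0, 0, 0, 0],
   [0, 50, 0, 0, 0, 0, 0, 0, 0, 0]]]

/-- The adapted basis in rescaled coordinates. -/
def basisTable : List (List (List ℤ)) := [
  [[0, 0, 0, 1, 0], [0, 0, 2, 0, 0], [0, -2, 0, 0, 0], [-1, 0, 0, 0, 0], [0, 0, 0, 0, 0]],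
  [[0, 0, 0, 0, 0], [0, 0, 0, 0, 0], [0, 0, 0, 0, 0], [0, 0, 0, 0, 3], [0, 0, 0, -1, 0]],
  [[0, 0, 0, 0, 3], [0, 0, 0, 0, 0], [0, 0, 0, 0, 0], [0, 0, 0, 0, 0], [-1, 0, 0, 0, 0]],
  [[0, 0, 1, 0, 0], [0, 0, 0, 1, 0], [-1, 0, 0, 0, 0], [0, -1, 0, 0, 0], [0, 0, 0, 0, 0]],
  [[0, 1, 0, 0, 0], [-1, 0, 0, 0, 0], [0, 0, 0, -1, 0], [0, 0, 1, 0, 0], [0, 0, 0, 0, 0]],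
  [[0, 0, 3, 0, 0], [0, 0, 0, -3, -6], [-3, 0, 0, 0, 0], [0, 3, 0, 0, 0], [0, 2, 0, 0, 0]],
  [[0, 3, 0, 0, 0], [-3, 0, 0, 0, 0], [0, 0, 0, 3, -6], [0, 0, -3, 0, 0], [0, 0, 2, 0, 0]],
  [[0, 0, 0, -2, 0], [0, 0, 1, 0, 0], [0, -1, 0, 0, 0], [2, 0, 0, 0, 0], [0, 0, 0, 0, 0]],
  [[0, 0, 1, 0, 0], [0, 0, 0, -1, 3], [-1, 0, 0, 0, 0], [0, 1, 0, 0, 0], [0, -1, 0, 0, 0]],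
  [[0, 1, 0, 0, 0], [-1, 0, 0, 0, 0], [0, 0, 0, 1, 3], [0, 0, -1, 0, 0], [0, 0, -1, 0, 0]]]

/-- Entries of a three-dimensional table of integers. -/
def lookup (t : List (List (List ℤ))) (a b c : ℕ) : ℤ := ((t.getD a []).getD b []).getD c 0

/-- The adapted basis in the rescaled coordinates `v₄ / √3`; the first seven elements belong to
`𝔪`, the other ones to the isotropy algebra. -/
def M (a : Fin 10) : Matrix (Fin 5) (Fin 5) ℤ := Matrix.of fun i j => lookup basisTable a i j

/-- Ten times the structure constants of the basis `M`. -/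
def cst (a : Fin 10) (b : Fin 7) (c : Fin 10) : ℤ := lookup bracketTable a b c

/-- Half the squared norms of the matrices in the basis. -/
def nrm (a : Fin 10) : ℤ := [5, 3, 3, 2, 2, 30, 30, 5, 5, 5].getD a 0

/-- The first seven indices. -/
abbrev emb (a : Fin 7) : Fin 10 := a.castLE (by decide)

/-- The cast of an integer matrix to the real numbers. -/
abbrev castR {m n : Type*} (A : Matrix m n ℤ) : Matrix m n ℝ := A.map (Int.cast : ℤ → ℝ)

/-! ### From integral matrices to real skew-symmetric ones -/

theorem castR_mul {l : Type*} {m : Type*} {n : Type*} [Fintype m] (A : Matrix l m ℤ)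
    (B : Matrix m n ℤ) : castR (A * B) = castR A * castR B :=
  Matrix.map_mul (f := Int.castRingHom ℝ)

/-- The rescaling of the coordinates. -/
def dil : Matrix (Fin 5) (Fin 5) ℝ := Matrix.diagonal ![1, 1, 1, 1, √3]

/-- The inverse of the rescaling. -/
def dil' : Matrix (Fin 5) (Fin 5) ℝ := Matrix.diagonal ![1, 1, 1, 1, 1 / √3]

theorem dil'_mul_dil : dil' * dil = 1 := by
  rw [dil, dil', Matrix.diagonal_mul_diagonal, ← Matrix.diagonal_one]
  congr 1
  ext i
  fin_cases i <;> simp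

theorem dil_mul_dil' : dil * dil' = 1 := by
  rw [dil, dil', Matrix.diagonal_mul_diagonal, ← Matrix.diagonal_one]
  congr 1
  ext i
  fin_cases i <;> simp

/-- The metric in the rescaled coordinates. -/
def gram : Matrix (Fin 5) (Fin 5) ℤ := Matrix.diagonal ![1, 1, 1, 1, 3]

theorem dil_mul_dil : dil * dil = castR gram := by
  rw [dil, gram, Matrix.diagonal_mul_diagonal, castR, Matrix.diagonal_map (by simp)]
  congr 1
  ext i
  fin_cases i <;> simp

-- In the coordinates that make `sym` integral, the invariant inner product has the Gram matrix
-- `gram = dil²`. Skewness for it turns into ordinary skewness after conjugation by `dil`.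
set_option maxRecDepth 100000 in
theorem M_transpose : ∀ a, (M a)ᵀ * gram = -(gram * M a) := by decide +kernel

/-- The adapted basis as matrices. -/
def bmat (a : Fin 10) : Matrix (Fin 5) (Fin 5) ℝ := dil * castR (M a) * dil'

theorem bmat_mem (a : Fin 10) : bmat a ∈ LieAlgebra.Orthogonal.so (Fin 5) ℝ := by
  rw [LieAlgebra.Orthogonal.mem_so]
  have h : (castR (M a))ᵀ * castR gram = -(castR gram * castR (M a)) := by
    rw [← Matrix.transpose_map, ← castR_mul, M_transpose, ← castR_mul]
    ext; simp
  have d : dilᵀ = dil := Matrix.diagonal_transpose _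
  have d' : dil'ᵀ = dil' := Matrix.diagonal_transpose _
  rw [bmat, Matrix.transpose_mul, Matrix.transpose_mul, d, d']
  calc dil' * ((castR (M a))ᵀ * dil)
      = dil' * ((castR (M a))ᵀ * dil) * (dil * dil') := by rw [dil_mul_dil', Matrix.mul_one]
    _ = dil' * ((castR (M a))ᵀ * (dil * dil)) * dil' := by simp only [Matrix.mul_assoc]
    _ = -((dil' * dil) * dil * castR (M a) * dil') := by
        rw [dil_mul_dil, h, ← dil_mul_dil]
        simp only [Matrix.mul_assoc, Matrix.neg_mul, Matrix.mul_neg]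
    _ = _ := by rw [dil'_mul_dil, Matrix.one_mul]

/-- The adapted basis of `so(5)`. -/
def bas (a : Fin 10) : so5 := ⟨bmat a, bmat_mem a⟩

theorem bmat_mul (a b : Fin 10) : bmat a * bmat b = dil * castR (M a * M b) * dil' := by
  rw [castR_mul]
  calc bmat a * bmat b = dil * castR (M a) * (dil' * dil) * castR (M b) * dil' := by
        simp only [bmat, Matrix.mul_assoc]
    _ = _ := by rw [dil'_mul_dil, Matrix.mul_one]; simp only [Matrix.mul_assoc]

theorem trace_conj (A : Matrix (Fin 5) (Fin 5) ℝ) : (dil * A * dil').trace = A.trace := by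
  rw [Matrix.trace_mul_comm, ← Matrix.mul_assoc, dil'_mul_dil, Matrix.one_mul]

theorem trace_castR (A : Matrix (Fin 5) (Fin 5) ℤ) : (castR A).trace = (A.trace : ℝ) := by
  simp [Matrix.trace]

set_option maxRecDepth 100000 in
theorem M_trace : ∀ a b, (M a * M b).trace = if a = b then -2 * nrm a else 0 := by decide +kernel

theorem ip_bas (a b : Fin 10) : ip (bas a) (bas b) = if a = b then 6 * (nrm a : ℝ) else 0 := by
  rw [ip_eq]
  change -3 * (bmat a * bmat b).trace = _
  rw [bmat_mul, trace_conj, trace_castR, M_trace]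
  split_ifs <;> push_cast <;> ring

theorem nrm_pos : ∀ a, 0 < nrm a := by decide

theorem nrm_pos' (a : Fin 10) : (0 : ℝ) < nrm a := by exact_mod_cast nrm_pos a

-- The factor 10 clears the denominators. The second index stays below 7 because every bracket
-- needed has an element of `𝔪` on the right, although the left one may lie in the isotropy algebra.
set_option maxRecDepth 100000 in
theorem M_bracket : ∀ (a : Fin 10) (b : Fin 7) (i j : Fin 5),
    10 * (M a * M (emb b) - M (emb b) * M a) i j = ∑ c, cst a b c * M c i j := by decide +kernel

theorem sum_smul_bas (f : Fin 10 → ℤ) : (∑ c, (f c : ℝ) • bas c : so5).1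
    = dil * castR (∑ c, f c • M c) * dil' := by
  have h1 : (∑ c, (f c : ℝ) • bas c : so5).1 = ∑ c, (f c : ℝ) • bmat c := by
    change coeL (∑ c, (f c : ℝ) • bas c) = _
    rw [map_sum]
    rfl
  have h2 : castR (∑ c, f c • M c) = ∑ c, (f c : ℝ) • castR (M c) := by
    ext i j
    simp [Matrix.sum_apply, -zsmul_eq_mul]
  rw [h1, h2, Matrix.mul_sum, Matrix.sum_mul]
  refine Finset.sum_congr rfl fun c _ => ?_
  rw [Matrix.mul_smul, Matrix.smul_mul, bmat]

theorem lie_bas (a : Fin 10) (b : Fin 7) :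
    ⁅bas a, bas (emb b)⁆ = (1 / 10 : ℝ) • ∑ c, (cst a b c : ℝ) • bas c := by
  have h : (10 : ℝ) • ⁅bas a, bas (emb b)⁆ = ∑ c, (cst a b c : ℝ) • bas c := by
    apply Subtype.ext
    rw [sum_smul_bas]
    change (10 : ℝ) • (bmat a * bmat (emb b) - bmat (emb b) * bmat a) = _
    have e : ∑ c, cst a b c • M c = 10 • (M a * M (emb b) - M (emb b) * M a) := by
      ext i j
      rw [Matrix.smul_apply, nsmul_eq_mul, Nat.cast_ofNat, M_bracket]
      simp [Matrix.sum_apply, -zsmul_eq_mul]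
    have e' : castR (10 • (M a * M (emb b) - M (emb b) * M a)) =
        (10 : ℝ) • (castR (M a * M (emb b)) - castR (M (emb b) * M a)) := by
      ext i j
      simp [-nsmul_eq_mul]
    rw [e, e', bmat_mul, bmat_mul, Matrix.mul_smul, Matrix.smul_mul, Matrix.mul_sub, Matrix.sub_mul]
  rw [← h, smul_smul]
  norm_num

theorem linearIndependent_bas : LinearIndependent ℝ bas := by
  rw [Fintype.linearIndependent_iff]
  intro f hf a
  have h := congrArg (fun X => ip X (bas a)) hf
  simp only [ip, map_sum, map_smul, LinearMap.sum_apply, LinearMap.smul_apply, map_zero,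
    LinearMap.zero_apply, neg_zero, neg_eq_zero] at h
  have h' : ∀ b, killingForm ℝ so5 (bas b) (bas a) = -if b = a then 6 * (nrm b : ℝ) else 0 :=
    fun b => by rw [← ip_bas, ip, neg_neg]
  simp only [h', smul_eq_mul] at h
  have := nrm_pos' a
  simpa [this.ne'] using h

theorem finrank_so5 : Module.finrank ℝ so5 = 10 := by
  rw [skewEquiv.finrank_eq, Module.finrank_fintype_fun_eq_card]
  decide

theorem span_bas (X : so5) : ∃ f : Fin 10 → ℝ, X = ∑ a, f a • bas a := by
  let b := basisOfLinearIndependentOfCardEqFinrank linearIndependent_bas (by simp [finrank_so5])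
  refine ⟨b.repr X, ?_⟩
  conv_lhs => rw [← b.sum_repr X]
  simp [b]

/-! ### The isotropy algebra -/

/-- The trace-free symmetric matrices of the rescaled coordinate vectors. -/
def symInt (u : Fin 5 → ℤ) : Matrix (Fin 3) (Fin 3) ℤ :=
  !![u 3 - u 4, u 0, u 1; u 0, -u 3 - u 4, u 2; u 1, u 2, 2 * u 4]

/-- The rescaled coordinate vectors of `ℝ⁵`. -/
def fvec (j : Fin 5) : Fin 5 → ℝ := dil *ᵥ Pi.single j 1

/-- Vectors with integral coefficients in the basis `fvec`. -/
theorem sym_dil (u : Fin 5 → ℤ) : sym (dil *ᵥ fun i => (u i : ℝ)) = castR (symInt u) := by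
  have h : ∀ i, (dil *ᵥ fun i => (u i : ℝ)) i = (![1, 1, 1, 1, √3] : Fin 5 → ℝ) i * u i :=
    fun i => Matrix.mulVec_diagonal _ _ _
  have h3 : (√3 : ℝ) ≠ 0 := by positivity
  ext i j
  fin_cases i <;> fin_cases j <;> (simp [sym, symInt, h]; try field_simp)

theorem sym_fvec (j : Fin 5) : sym (fvec j) = castR (symInt (Pi.single j 1)) := by
  rw [← sym_dil, fvec]
  congr 2
  ext i
  simp [Pi.single_apply]

theorem bmat_fvec (a : Fin 10) (j : Fin 5) :
    bmat a *ᵥ fvec j = dil *ᵥ fun i => (M a i j : ℝ) := by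
  rw [fvec, bmat, Matrix.mulVec_mulVec, Matrix.mul_assoc, dil'_mul_dil, Matrix.mul_one,
    ← Matrix.mulVec_mulVec, Matrix.mulVec_single_one]
  rfl

theorem bmat_fvec' (a : Fin 10) (j : Fin 5) :
    bmat a *ᵥ fvec j = ∑ i, (M a i j : ℝ) • fvec i := by
  rw [bmat_fvec]
  simp only [fvec, ← Matrix.mulVec_smul, ← Matrix.mulVec_sum]
  congr 1
  ext i
  simp [Pi.single_apply]

theorem fvec_ext {V : Type*} [AddCommGroup V] [Module ℝ V] {S T : (Fin 5 → ℝ) →ₗ[ℝ] V}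
    (h : ∀ j, S (fvec j) = T (fvec j)) : S = T := by
  have e : S ∘ₗ dil.mulVecLin = T ∘ₗ dil.mulVecLin := by
    refine (Pi.basisFun ℝ (Fin 5)).ext fun j => ?_
    rw [Pi.basisFun_apply]
    exact h j
  refine LinearMap.ext fun v => ?_
  have := fun v => LinearMap.congr_fun e (dil' *ᵥ v)
  simp only [LinearMap.comp_apply, Matrix.mulVecLin_apply, Matrix.mulVec_mulVec, dil_mul_dil',
    Matrix.one_mulVec] at this
  exact this v

/-- The basis of `so(3)` that corresponds to the last three elements of the basis. -/
def rot (r : Fin 3) : Matrix (Fin 3) (Fin 3) ℤ :=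
  ![!![0, 1, 0; -1, 0, 0; 0, 0, 0], !![0, 0, 1; 0, 0, 0; -1, 0, 0],
    !![0, 0, 0; 0, 0, 1; 0, -1, 0]] r

theorem M_rot : ∀ (r : Fin 3) (j : Fin 5), symInt (fun i => M (r.natAdd 7) i j)
    = rot r * symInt (Pi.single j 1) - symInt (Pi.single j 1) * rot r := by decide +kernel

theorem sym_bas_rot (r : Fin 3) (v : Fin 5 → ℝ) : sym ((bas (r.natAdd 7)).1 *ᵥ v)
    = castR (rot r) * sym v - sym v * castR (rot r) := by
  have : symL ∘ₗ (bas (r.natAdd 7)).1.mulVecLin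
      = (LinearMap.mulLeft ℝ (castR (rot r)) - LinearMap.mulRight ℝ (castR (rot r))) ∘ₗ symL := by
    refine fvec_ext fun j => ?_
    change sym (bmat _ *ᵥ fvec j) = castR (rot r) * sym (fvec j) - sym (fvec j) * castR (rot r)
    rw [bmat_fvec, sym_dil, sym_fvec, ← castR_mul, ← castR_mul, M_rot]
    ext; simp
  exact LinearMap.congr_fun this v

theorem sym_injective : Function.Injective sym := by
  intro v w h
  have e := fun i j => congrFun (congrFun h i) j
  have h3 : (√3 : ℝ) ≠ 0 := by positivity
  have e0 := e 0 1
  have e1 := e 0 2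
  have e2 := e 1 2
  have e3 := e 0 0
  have e4 := e 2 2
  simp [sym, h3] at e0 e1 e2 e3 e4
  ext i
  fin_cases i <;> simp_all

theorem castR_rot_mem (r : Fin 3) : castR (rot r) ∈ LieAlgebra.Orthogonal.so (Fin 3) ℝ := by
  rw [LieAlgebra.Orthogonal.mem_so]
  ext i j
  fin_cases r <;> fin_cases i <;> fin_cases j <;> simp [rot]

theorem bas_rot_mem (r : Fin 3) : bas (r.natAdd 7) ∈ isotropyAlgebra :=
  ⟨_, castR_rot_mem r, sym_bas_rot r⟩

/-- By injectivity of `sym`, an element of the isotropy algebra is determined by the matrix in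
`so(3)` that it represents, and the latter is a combination of the three rotations `rot r`. -/
theorem exists_of_mem_isotropyAlgebra {X : so5} (hX : X ∈ isotropyAlgebra) :
    ∃ f : Fin 3 → ℝ, X = ∑ r, f r • bas (r.natAdd 7) := by
  obtain ⟨A, hA, h⟩ := hX
  rw [LieAlgebra.Orthogonal.mem_so] at hA
  have sA : ∀ i j, A j i = -A i j := fun i j => congrFun (congrFun hA i) j
  have dA : ∀ i, A i i = 0 := fun i => by linarith [sA i i]
  let f : Fin 3 → ℝ := ![A 0 1, A 0 2, A 1 2]
  have hf : A = ∑ r, f r • castR (rot r) := by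
    ext i j
    fin_cases i <;> fin_cases j <;> simp [f, rot, Fin.sum_univ_three, dA, sA 0 1, sA 0 2, sA 1 2]
  refine ⟨f, ?_⟩
  have hs : ∀ v, X.1 *ᵥ v = (∑ r, f r • bas (r.natAdd 7) : so5).1 *ᵥ v := by
    intro v
    apply sym_injective
    rw [h]
    have e1 : (∑ r, f r • bas (r.natAdd 7) : so5).1 *ᵥ v
        = ∑ r, f r • ((bas (r.natAdd 7)).1 *ᵥ v) := by
      change coeL (∑ r, f r • bas (r.natAdd 7)) *ᵥ v = _
      simp only [map_sum, map_smul, Matrix.sum_mulVec, Matrix.smul_mulVec]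
      rfl
    rw [e1]
    change _ = symL _
    rw [map_sum]
    simp only [map_smul]
    change _ = ∑ r, f r • sym _
    simp only [sym_bas_rot]
    rw [hf]
    simp only [smul_sub, Finset.sum_sub_distrib, Matrix.smul_mul, Matrix.mul_smul,
      Matrix.sum_mul, Matrix.mul_sum]
  apply Subtype.ext
  refine Matrix.ext_of_mulVec_single fun j => hs _

theorem bas_emb_mem (a : Fin 7) : bas (emb a) ∈ 𝔪 := by
  rw [mem_𝔪]
  intro Y hY
  obtain ⟨f, rfl⟩ := exists_of_mem_isotropyAlgebra hY
  rw [ip, map_sum, LinearMap.sum_apply, neg_eq_zero]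
  refine Finset.sum_eq_zero fun r _ => ?_
  have h : ip (bas (r.natAdd 7)) (bas (emb a)) = 0 := by
    rw [ip_bas, if_neg]
    intro h
    have := congrArg Fin.val h
    simp at this
    omega
  rw [ip, neg_eq_zero] at h
  rw [map_smul, LinearMap.smul_apply, h, smul_zero]

/-! ### The basis of `𝔪` -/

/-- The adapted basis vectors of `𝔪`. -/
def mvec (a : Fin 7) : 𝔪 := ⟨bas (emb a), bas_emb_mem a⟩

theorem linearIndependent_mvec : LinearIndependent ℝ mvec :=
  LinearIndependent.of_comp 𝔪.subtype
    (linearIndependent_bas.comp emb (Fin.castLE_injective (by decide)))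

theorem g_mvec (a b : Fin 7) :
    g (mvec a) (mvec b) = if a = b then 6 * (nrm (emb a) : ℝ) else 0 := by
  rw [g, mvec, mvec, ip_bas]
  simp

theorem sum_split {V : Type*} [AddCommMonoid V] (F : Fin 10 → V) :
    ∑ c, F c = ∑ a : Fin 7, F (emb a) + ∑ r : Fin 3, F (r.natAdd 7) :=
  Fin.sum_univ_add (a := 7) (b := 3) F

theorem span_mvec (X : 𝔪) : ∃ f : Fin 7 → ℝ, X = ∑ a, f a • mvec a := by
  obtain ⟨f, hf⟩ := span_bas X.1
  have h0 : ∀ r : Fin 3, f (r.natAdd 7) = 0 := by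
    intro r
    have h := (mem_𝔪 X.1).1 X.2 _ (bas_rot_mem r)
    have h' : ∀ b, killingForm ℝ so5 (bas (r.natAdd 7)) (bas b)
        = -if r.natAdd 7 = b then 6 * (nrm (r.natAdd 7) : ℝ) else 0 :=
      fun b => by rw [← ip_bas, ip, neg_neg]
    rw [hf, ip, map_sum] at h
    simp only [map_smul, h'] at h
    have := nrm_pos' (r.natAdd 7)
    simpa [this.ne'] using h
  refine ⟨fun a => f (emb a), Subtype.ext ?_⟩
  rw [hf, sum_split]
  simp only [h0, zero_smul, Finset.sum_const_zero, add_zero]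
  exact (map_sum 𝔪.subtype (fun a => f (emb a) • mvec a) Finset.univ).symm

/-- The adapted basis of `𝔪`. -/
def mbas : Module.Basis (Fin 7) ℝ 𝔪 := Module.Basis.mk linearIndependent_mvec (by
  intro X _
  obtain ⟨f, rfl⟩ := span_mvec X
  exact Submodule.sum_mem _ fun a _ => Submodule.smul_mem _ _ (Submodule.subset_span ⟨a, rfl⟩))

theorem mbas_apply (a : Fin 7) : mbas a = mvec a := by simp [mbas]

theorem proj_eq_zero {X : so5} (hX : X ∈ isotropyAlgebra) : proj X = 0 :=
  eq_of_g_eq fun i => by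
    have h1 : g (proj X) (frame i) = ip X (frame i).1 := ip_proj X (frame i)
    rw [h1, (mem_𝔪 _).1 (frame i).2 X hX]
    simp [g, ip]

theorem proj_sum_bas (f : Fin 10 → ℝ) :
    proj (∑ c, f c • bas c) = ∑ c : Fin 7, f (emb c) • mvec c := by
  rw [map_sum, sum_split]
  have h0 : ∀ r : Fin 3, proj (bas (r.natAdd 7)) = 0 := fun r => proj_eq_zero (bas_rot_mem r)
  simp only [map_smul, h0, smul_zero, Finset.sum_const_zero, add_zero]
  exact Finset.sum_congr rfl fun a _ => congrArg _ (proj_of_mem (mvec a))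

theorem proj_lie_bas (a : Fin 10) (b : Fin 7) :
    proj ⁅bas a, bas (emb b)⁆ = (1 / 10 : ℝ) • ∑ c : Fin 7, (cst a b (emb c) : ℝ) • mvec c := by
  rw [lie_bas, map_smul, proj_sum_bas]

theorem br_mvec (a b : Fin 7) :
    br (mvec a) (mvec b) = (1 / 10 : ℝ) • ∑ c : Fin 7, (cst (emb a) b (emb c) : ℝ) • mvec c :=
  proj_lie_bas (emb a) b

/-! ### Traces -/

/-- Basis independence of the trace, with an orthogonal basis on the right: `h2` says that the
transition matrix has orthogonal columns of squared length `n a`. -/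
theorem sum_diag_eq {ι κ W V : Type*} [Fintype ι] [Fintype κ] [DecidableEq κ] [AddCommGroup W]
    [Module ℝ W] [AddCommGroup V] [Module ℝ V] {e : ι → W} {m : κ → W} {c : ι → κ → ℝ} {n : κ → ℝ}
    (h1 : ∀ i, e i = ∑ a, c i a • m a) (h2 : ∀ a b, ∑ i, c i a * c i b = if a = b then n a else 0)
    (q : W →ₗ[ℝ] W →ₗ[ℝ] V) : ∑ i, q (e i) (e i) = ∑ a, n a • q (m a) (m a) := by
  have h3 : ∀ i, q (e i) (e i) = ∑ a, ∑ b, (c i a * c i b) • q (m a) (m b) := by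
    intro i
    rw [h1 i]
    simp only [map_sum, LinearMap.sum_apply, map_smul, LinearMap.smul_apply, Finset.smul_sum,
      smul_smul]
    rw [Finset.sum_comm]
    exact Finset.sum_congr rfl fun a _ => Finset.sum_congr rfl fun b _ => by rw [mul_comm]
  simp only [h3]
  rw [Finset.sum_comm]
  refine Finset.sum_congr rfl fun a _ => ?_
  rw [Finset.sum_comm]
  simp only [← Finset.sum_smul, h2]
  simp

theorem eq_sum_mvec (X : 𝔪) :
    X = ∑ a, (g X (mvec a) / (6 * (nrm (emb a) : ℝ))) • mvec a := by
  obtain ⟨f, rfl⟩ := span_mvec X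
  refine Finset.sum_congr rfl fun b _ => ?_
  congr 1
  have h : g (∑ a, f a • mvec a) (mvec b) = f b * (6 * (nrm (emb b) : ℝ)) := by
    rw [← gL_apply, map_sum, LinearMap.sum_apply, Finset.sum_eq_single b]
    · rw [map_smul, LinearMap.smul_apply, gL_apply, g_mvec, if_pos rfl, smul_eq_mul]
    · intro a _ ha
      rw [map_smul, LinearMap.smul_apply, gL_apply, g_mvec, if_neg ha, smul_zero]
    · simp
  have := nrm_pos' (emb b)
  rw [h, mul_div_cancel_right₀]
  positivity

theorem eq_sum_frame (X : 𝔪) : X = ∑ i, g X (frame i) • frame i := by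
  refine eq_of_g_eq fun j => ?_
  rw [← gL_apply _ (frame j), ← gL_apply _ (frame j), map_sum, LinearMap.sum_apply,
    Finset.sum_eq_single j]
  · rw [map_smul, LinearMap.smul_apply, gL_apply, gL_apply, g_frame, if_pos rfl, smul_eq_mul, mul_one]
  · intro i _ hi
    rw [map_smul, LinearMap.smul_apply, gL_apply, g_frame, if_neg hi, smul_zero]
  · simp

theorem sum_g_frame (X Y : 𝔪) : ∑ i, g (frame i) X * g (frame i) Y = g X Y := by
  conv_rhs => rw [eq_sum_frame X, ← gL_apply, map_sum, LinearMap.sum_apply]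
  refine Finset.sum_congr rfl fun i _ => ?_
  rw [map_smul, LinearMap.smul_apply, gL_apply, smul_eq_mul, g_comm X]

/-- Traces with respect to the orthonormal frame can be taken in the adapted basis. -/
theorem sum_frame {V : Type*} [AddCommGroup V] [Module ℝ V] (q : 𝔪 →ₗ[ℝ] 𝔪 →ₗ[ℝ] V) :
    ∑ i, q (frame i) (frame i)
      = ∑ a, (1 / (6 * (nrm (emb a) : ℝ))) • q (mvec a) (mvec a) := by
  refine sum_diag_eq (fun i => eq_sum_mvec (frame i)) (fun a b => ?_) q
  have h : ∀ i, g (frame i) (mvec a) / (6 * (nrm (emb a) : ℝ)) *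
      (g (frame i) (mvec b) / (6 * (nrm (emb b) : ℝ)))
      = (g (frame i) (mvec a) * g (frame i) (mvec b)) *
        (1 / (6 * (nrm (emb a) : ℝ) * (6 * (nrm (emb b) : ℝ)))) := fun i => by ring
  simp only [h]
  rw [← Finset.sum_mul, sum_g_frame, g_mvec]
  split_ifs with hab
  · subst hab
    have := nrm_pos' (emb a)
    field_simp
  · rw [zero_mul]

/-! ## The invariant cubic form and the uniqueness of the connection -/

/-- The trilinear form `tr(sym u sym v sym w)` on `ℝ⁵`. -/
def tri : (Fin 5 → ℝ) →ₗ[ℝ] (Fin 5 → ℝ) →ₗ[ℝ] (Fin 5 → ℝ) →ₗ[ℝ] ℝ :=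
  ((LinearMap.mul ℝ (Matrix (Fin 3) (Fin 3) ℝ)).compl₁₂ symL symL).compr₂
    (((LinearMap.mul ℝ (Matrix (Fin 3) (Fin 3) ℝ)).compr₂
      (Matrix.traceLinearMap (Fin 3) ℝ ℝ)).compl₂ symL)

theorem tri_apply (u v w : Fin 5 → ℝ) : tri u v w = (sym u * sym v * sym w).trace := rfl

theorem tri_invariant {k : SO5} (hk : k ∈ SO3irr) (u v w : Fin 5 → ℝ) :
    tri (k.1 *ᵥ u) (k.1 *ᵥ v) (k.1 *ᵥ w) = tri u v w := by
  obtain ⟨R, hR, h⟩ := hk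
  have h1 : Rᵀ * R = 1 :=
    (Matrix.mem_orthogonalGroup_iff' _ _).1 (Matrix.mem_specialOrthogonalGroup_iff.1 hR).1
  rw [tri_apply, tri_apply, h, h, h]
  calc (R * sym u * Rᵀ * (R * sym v * Rᵀ) * (R * sym w * Rᵀ)).trace
      = (R * (sym u * (Rᵀ * R) * sym v * (Rᵀ * R) * sym w * Rᵀ)).trace := by
        simp only [Matrix.mul_assoc]
    _ = _ := by
      rw [h1, Matrix.trace_mul_comm]
      simp only [Matrix.mul_one, Matrix.mul_assoc, h1]

/-- The coefficients of the cubic form. -/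
def triInt (i j k : Fin 5) : ℤ :=
  (symInt (Pi.single i 1) * symInt (Pi.single j 1) * symInt (Pi.single k 1)).trace

theorem tri_fvec (i j k : Fin 5) : tri (fvec i) (fvec j) (fvec k) = triInt i j k := by
  rw [tri_apply, sym_fvec, sym_fvec, sym_fvec, ← castR_mul, ← castR_mul, triInt]
  simp [Matrix.trace]

/-- The coefficients of the derivative of the cubic form along the adapted basis. -/
def triDeriv (a : Fin 7) (i j k : Fin 5) : ℤ :=
  ∑ l, (M (emb a) l i * triInt l j k + M (emb a) l j * triInt i l k + M (emb a) l k * triInt i j l)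

/-- The inverse of the metric in the rescaled coordinates, up to a factor. -/
def wt (i : Fin 5) : ℤ := [3, 3, 3, 3, 1].getD i 0

theorem mvec_fvec (a : Fin 7) (j : Fin 5) :
    (mvec a).1.1 *ᵥ fvec j = ∑ i, (M (emb a) i j : ℝ) • fvec i := bmat_fvec' _ _

theorem tri_mvec (a : Fin 7) (i j k : Fin 5) :
    tri ((mvec a).1.1 *ᵥ fvec i) (fvec j) (fvec k) + tri (fvec i) ((mvec a).1.1 *ᵥ fvec j) (fvec k)
      + tri (fvec i) (fvec j) ((mvec a).1.1 *ᵥ fvec k) = triDeriv a i j k := by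
  simp only [mvec_fvec, map_sum, map_smul, LinearMap.sum_apply, LinearMap.smul_apply, tri_fvec,
    smul_eq_mul, triDeriv, Finset.sum_add_distrib]
  push_cast
  rfl

-- The infinitesimal action on the cubic form sends `𝔪` equivariantly to trilinear forms, so by
-- irreducibility the induced inner product is proportional to `g`; it is nonzero. Hence no nonzero
-- element of `𝔪` preserves the cubic form.
set_option maxRecDepth 100000 in
theorem triDeriv_orthogonal : ∀ a b : Fin 7, ∑ i, ∑ j, ∑ k, wt i * wt j * wt k *
    (triDeriv a i j k * triDeriv b i j k) = if a = b then 1620 * nrm (emb a) else 0 := by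
  decide +kernel

theorem eq_zero_of_tri {X : 𝔪} (h : ∀ u v w, tri (X.1.1 *ᵥ u) v w + tri u (X.1.1 *ᵥ v) w
    + tri u v (X.1.1 *ᵥ w) = 0) : X = 0 := by
  obtain ⟨f, rfl⟩ := span_mvec X
  have h1 : ∀ i j k, ∑ a, f a * (triDeriv a i j k : ℝ) = 0 := by
    intro i j k
    have e : ∀ v, (∑ a, f a • mvec a : 𝔪).1.1 *ᵥ v = ∑ a, f a • ((mvec a).1.1 *ᵥ v) := by
      intro v
      change (coeL ∘ₗ 𝔪.subtype) (∑ a, f a • mvec a) *ᵥ v = _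
      simp only [map_sum, map_smul, Matrix.sum_mulVec, Matrix.smul_mulVec]
      rfl
    rw [← h (fvec i) (fvec j) (fvec k)]
    simp only [e, map_sum, map_smul, LinearMap.sum_apply, LinearMap.smul_apply, ← tri_mvec,
      smul_eq_mul, mul_add, Finset.sum_add_distrib]
  have h2 : ∀ b, f b = 0 := by
    intro b
    have h3 : ∑ a, f a * ((∑ i, ∑ j, ∑ k, wt i * wt j * wt k *
        (triDeriv a i j k * triDeriv b i j k) : ℤ) : ℝ) = 0 := by
      push_cast
      simp only [Finset.mul_sum]
      rw [Finset.sum_comm]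
      refine Finset.sum_eq_zero fun i _ => ?_
      rw [Finset.sum_comm]
      refine Finset.sum_eq_zero fun j _ => ?_
      rw [Finset.sum_comm]
      refine Finset.sum_eq_zero fun k _ => ?_
      have : ∀ a, f a * ((wt i : ℝ) * wt j * wt k * (triDeriv a i j k * triDeriv b i j k))
          = (f a * triDeriv a i j k) * ((wt i : ℝ) * wt j * wt k * triDeriv b i j k) :=
        fun a => by ring
      simp only [this]
      rw [← Finset.sum_mul, h1, zero_mul]
    simp only [triDeriv_orthogonal] at h3
    have := nrm_pos (emb b)
    simpa [this.ne'] using h3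
  simp [h2]

/-! ### Functions on the quotient that separate tangent vectors -/

section

variable {V U : Type*} [AddCommGroup V] [Module ℝ V] [AddCommGroup U] [Module ℝ U]
  [FiniteDimensional ℝ V] [FiniteDimensional ℝ U] {f : SO5 → V →ₗ[ℝ] U} {p : SO5 → V}

theorem HasLieDeriv.app {x : SO5} {X : so5} {f' : V →ₗ[ℝ] U} {p' : V} (hf : HasLieDeriv f x X f')
    (hp : HasLieDeriv p x X p') : HasLieDeriv (fun y => f y (p y)) x X (f' (p x) + f x p') :=
  hf.bilin LinearMap.id hp

theorem SmoothMap.app (hf : SmoothMap f) (hp : SmoothMap p) : SmoothMap fun y => f y (p y) :=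
  hf.bilin LinearMap.id hp

end

theorem hasLieDeriv_inv_mulVec (w : Fin 5 → ℝ) (x : SO5) (X : so5) :
    HasLieDeriv (fun y => (y⁻¹ : SO5).1 *ᵥ w) x X (-(X.1 *ᵥ ((x⁻¹ : SO5).1 *ᵥ w))) := by
  have h := (hasLieDeriv_coe_inv x X).map ((Matrix.mulVecBilin ℝ ℝ).flip w)
  have e : (Matrix.mulVecBilin ℝ ℝ).flip w (-(X.1 * (x⁻¹ : SO5).1))
      = -(X.1 *ᵥ ((x⁻¹ : SO5).1 *ᵥ w)) := by
    rw [map_neg, Matrix.mulVec_mulVec]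
    rfl
  rw [e] at h
  exact h

theorem smoothMap_inv_mulVec (w : Fin 5 → ℝ) : SmoothMap fun y : SO5 => (y⁻¹ : SO5).1 *ᵥ w := by
  have h : SmoothMap fun y : SO5 => (y⁻¹ : SO5).1 :=
    SmoothMap.coe.map (Matrix.transposeLinearEquiv (Fin 5) (Fin 5) ℝ ℝ).toLinearMap
  exact h.map ((Matrix.mulVecBilin ℝ ℝ).flip w)

theorem inv_mul_mulVec (x k : SO5) (w : Fin 5 → ℝ) :
    ((x * k)⁻¹ : SO5).1 *ᵥ w = (k⁻¹ : SO5).1 *ᵥ ((x⁻¹ : SO5).1 *ᵥ w) := by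
  rw [Matrix.mulVec_mulVec, mul_inv_rev]
  rfl

/-- The functions on the Berger space that are obtained from the invariant cubic form. -/
def cubicFun (u v w : Fin 5 → ℝ) : BergerSpace → ℝ :=
  Quotient.lift (fun y : SO5 => tri ((y⁻¹ : SO5).1 *ᵥ u) ((y⁻¹ : SO5).1 *ᵥ v) ((y⁻¹ : SO5).1 *ᵥ w))
    (by
      intro y z h
      have hk : (y⁻¹ * z)⁻¹ ∈ SO3irr := inv_mem (QuotientGroup.leftRel_apply.1 h)
      have e : ∀ w, (z⁻¹ : SO5).1 *ᵥ w = ((y⁻¹ * z)⁻¹ : SO5).1 *ᵥ ((y⁻¹ : SO5).1 *ᵥ w) := by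
        intro w
        rw [← inv_mul_mulVec, mul_inv_cancel_left]
      change tri _ _ _ = tri _ _ _
      rw [e u, e v, e w, tri_invariant hk])

theorem smooth_cubicFun (u v w : Fin 5 → ℝ) : IsSmooth fun x => cubicFun u v w x :=
  smoothMap_real.1 ((((smoothMap_inv_mulVec u).map tri).app (smoothMap_inv_mulVec v)).app
    (smoothMap_inv_mulVec w))

theorem lieDeriv_cubicFun (u v w : Fin 5 → ℝ) (x : SO5) (X : so5) :
    lieDeriv (fun y => cubicFun (x.1 *ᵥ u) (x.1 *ᵥ v) (x.1 *ᵥ w) y) x X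
      = -(tri (X.1 *ᵥ u) v w + tri u (X.1 *ᵥ v) w + tri u v (X.1 *ᵥ w)) := by
  have h := (((hasLieDeriv_inv_mulVec (x.1 *ᵥ u) x X).map tri).app
    (hasLieDeriv_inv_mulVec (x.1 *ᵥ v) x X)).app (hasLieDeriv_inv_mulVec (x.1 *ᵥ w) x X)
  have e : ∀ u, (x⁻¹ : SO5).1 *ᵥ (x.1 *ᵥ u) = u := fun u => by
    rw [Matrix.mulVec_mulVec, SO5.coe_inv, SO5.transpose_mul, Matrix.one_mulVec]
  simp only [e] at h
  refine h.lieDeriv_eq.trans ?_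
  simp only [map_neg, LinearMap.neg_apply, LinearMap.add_apply]
  ring

/-- The functions `cubicFun` suffice: when their vectors are translated by `x`, their derivatives at
`x` are the coefficients of the infinitesimal action on the cubic form, and `eq_zero_of_tri`
applies. -/
theorem eq_of_lieDeriv_eq {x : SO5} {X Y : 𝔪} (h : ∀ f : BergerSpace → ℝ, IsSmooth (fun x => f x) →
    lieDeriv (fun y => f y) x X = lieDeriv (fun y => f y) x Y) : X = Y := by
  rw [← sub_eq_zero]
  refine eq_zero_of_tri fun u v w => ?_
  have hs := smooth_cubicFun (x.1 *ᵥ u) (x.1 *ᵥ v) (x.1 *ᵥ w)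
  have h1 : lieDerivLinear hs x X = lieDerivLinear hs x Y := h _ hs
  rw [← neg_eq_zero, ← lieDeriv_cubicFun u v w x (X - Y).1]
  change lieDerivLinear hs x (X.1 - Y.1) = 0
  rw [map_sub, h1, sub_self]

/-- Koszul's argument. The difference `S` of two such connections is symmetric by torsion-freeness,
and `g(S(ξ, η), ζ)` is skew in `η, ζ` by metricity; alternating the two symmetries gives `g(S(ξ, η),
ζ) = -g(S(ξ, η), ζ)`. Every tangent vector is the value of some `ζ`, namely of an `extend`. -/
theorem IsLeviCivita.eq_leviCivita {D : VectorField → VectorField → VectorField}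
    (hD : IsLeviCivita D) : D = leviCivita := by
  funext ξ₀ η₀
  refine VectorField.ext fun x => ?_
  let S : VectorField → VectorField → 𝔪 := fun ξ η => D ξ η x - leviCivita ξ η x
  have hsymm : ∀ ξ η, S ξ η = S η ξ := by
    intro ξ η
    have : D ξ η x - D η ξ x = leviCivita ξ η x - leviCivita η ξ x := by
      refine eq_of_lieDeriv_eq (x := x) fun f hf => ?_
      have h1 := hD.torsion_free f hf ξ η x
      have h2 := isLeviCivita_leviCivita.torsion_free f hf ξ η x
      rw [h1] at h2
      change lieDerivLinear hf x ((D ξ η x).1 - (D η ξ x).1)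
        = lieDerivLinear hf x ((leviCivita ξ η x).1 - (leviCivita η ξ x).1)
      rw [map_sub, map_sub]
      exact h2
    change D ξ η x - _ = D η ξ x - _
    rw [sub_eq_sub_iff_add_eq_add] at this ⊢
    rw [this, add_comm]
  have hskew : ∀ ξ η ζ : VectorField, gL (S ξ η) (ζ x) = -gL (S ξ ζ) (η x) := by
    intro ξ η ζ
    have h1 := hD.metric ξ η ζ x
    have h2 := isLeviCivita_leviCivita.metric ξ η ζ x
    rw [h1, g_comm (η x), g_comm (η x)] at h2
    simp only [S, map_sub, LinearMap.sub_apply, gL_apply]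
    linarith
  rw [← sub_eq_zero]
  change S ξ₀ η₀ = 0
  refine eq_of_g_eq fun i => ?_
  have hz : ∀ ζ : VectorField, gL (S ξ₀ η₀) (ζ x) = 0 := by
    intro ζ
    have h1 := hskew ξ₀ η₀ ζ
    have h2 := hskew ζ ξ₀ η₀
    have h3 := hskew η₀ ζ ξ₀
    rw [hsymm ζ ξ₀] at h2
    rw [hsymm η₀ ζ, hsymm η₀ ξ₀] at h3
    linarith
  have h := hz (extend x (frame i))
  rw [extend_self] at h
  rw [← gL_apply, ← gL_apply, h, map_zero, LinearMap.zero_apply]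

/-! ## Curvature and covariant derivatives -/

/-- The action of `𝔪` on `ℝ⁵`. -/
def act : 𝔪 →ₗ[ℝ] (Fin 5 → ℝ) →ₗ[ℝ] (Fin 5 → ℝ) := Matrix.mulVecBilin ℝ ℝ ∘ₗ coeL ∘ₗ 𝔪.subtype

theorem act_apply (X : 𝔪) (w : Fin 5 → ℝ) : act X w = X.1.1 *ᵥ w := rfl

theorem hasLieDeriv_Ad_inv (W : so5) (x : SO5) (X : so5) :
    HasLieDeriv (fun y => Ad y⁻¹ W) x X (-⁅X, Ad x⁻¹ W⁆) := by
  refine HasLieDeriv.of_injective (L := coeL) (fun _ _ h => Subtype.ext h) ?_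
  have h := (hasLieDeriv_coe_inv x X).bilin (LinearMap.mul ℝ (Matrix (Fin 5) (Fin 5) ℝ))
    ((hasLieDeriv_coe x X).map (LinearMap.mulLeft ℝ W.1))
  have e1 : ∀ y : SO5, coeL (Ad y⁻¹ W)
      = LinearMap.mul ℝ (Matrix (Fin 5) (Fin 5) ℝ) (y⁻¹ : SO5).1 (LinearMap.mulLeft ℝ W.1 y.1) := by
    intro y
    change (y⁻¹ : SO5).1 * W.1 * ((y⁻¹)⁻¹ : SO5).1 = (y⁻¹ : SO5).1 * (W.1 * y.1)
    rw [inv_inv, Matrix.mul_assoc]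
  simp only [e1]
  convert h using 1
  change -(X.1 * ((x⁻¹ : SO5).1 * W.1 * ((x⁻¹)⁻¹ : SO5).1)
    - (x⁻¹ : SO5).1 * W.1 * ((x⁻¹)⁻¹ : SO5).1 * X.1)
    = -(X.1 * (x⁻¹ : SO5).1) * (W.1 * x.1) + (x⁻¹ : SO5).1 * (W.1 * (x.1 * X.1))
  rw [inv_inv]
  noncomm_ring

theorem extend_apply (x : SO5) (X : 𝔪) (y : SO5) :
    extend x X y = proj (Ad y⁻¹ (Ad x X.1)) := by
  rw [← Ad_mul]
  rfl

theorem hasLieDeriv_extend (x : SO5) (Y : 𝔪) (X : so5) :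
    HasLieDeriv (fun y => extend x Y y) x X (-proj ⁅X, Y.1⁆) := by
  have h := (hasLieDeriv_Ad_inv (Ad x Y.1) x X).map proj
  rw [← Ad_mul, inv_mul_cancel, Ad_one, map_neg] at h
  simp only [← extend_apply] at h
  exact h

/-- Needed at all points `y`, as it is differentiated again. Away from `x` the element `Ad y⁻¹ (Ad x
Z)` has an isotropy part whose bracket with `𝔪` contributes, so it must not be projected before
bracketing. -/
theorem leviCivita_extend_right (η : VectorField) (x : SO5) (Z : 𝔪) (y : SO5) :
    leviCivita η (extend x Z) y = -proj ⁅(η y).1, Ad y⁻¹ (Ad x Z.1)⁆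
      + (1 / 2 : ℝ) • br (η y) (extend x Z y) := by
  have h := (hasLieDeriv_Ad_inv (Ad x Z.1) y (η y).1).map proj
  rw [map_neg] at h
  rw [leviCivita_apply, ← h.lieD_eq]
  simp only [extend_apply]

/-- Differentiating the field gives `-[X, Z]_𝔪`, and the connection term gives half of the bracket
back. -/
theorem leviCivita_extend_self (η : VectorField) (x : SO5) (Z : 𝔪) :
    leviCivita η (extend x Z) x = -((1 / 2 : ℝ) • br (η x) Z) := by
  rw [leviCivita_extend_right, extend_self, ← Ad_mul, inv_mul_cancel, Ad_one, ← br_apply]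
  module

theorem leviCivita_leviCivita_extend (x : SO5) (X Y Z : 𝔪) :
    leviCivita (extend x X) (leviCivita (extend x Y) (extend x Z)) x
      = proj ⁅Y.1, ⁅X.1, Z.1⁆⁆ + (1 / 2 : ℝ) • br (br X Y) Z
        - (1 / 2 : ℝ) • br Y (br X Z) - (1 / 4 : ℝ) • br X (br Y Z) := by
  have hY := hasLieDeriv_extend x Y X.1
  have hZ := hasLieDeriv_extend x Z X.1
  have hA := hasLieDeriv_Ad_inv (Ad x Z.1) x X.1
  have h1 := ((hY.map 𝔪.subtype).bilin lieBil hA).map (-proj)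
  have h2 := (hY.bilin br hZ).smul (1 / 2 : ℝ)
  have h := (h1.add h2).lieD_eq
  rw [← Ad_mul, inv_mul_cancel, Ad_one] at h
  rw [leviCivita_apply, leviCivita_extend_self, extend_self, extend_self]
  have e : (fun y => leviCivita (extend x Y) (extend x Z) y) = fun y =>
      (-proj) (lieBil (𝔪.subtype (extend x Y y)) (Ad y⁻¹ (Ad x Z.1)))
        + (1 / 2 : ℝ) • br (extend x Y y) (extend x Z y) :=
    funext fun y => leviCivita_extend_right _ _ _ _
  rw [e, h, extend_self, extend_self, ← br_apply, ← br_apply]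
  change -proj (⁅(-br X Y).1, Z.1⁆ + ⁅Y.1, -⁅X.1, Z.1⁆⁆) + _ + _ = _
  rw [Submodule.coe_neg, neg_lie, lie_neg]
  simp only [map_add, map_neg, ← br_apply (br X Y) Z, LinearMap.neg_apply, map_smul]
  module

/-- The Jacobi identity merges the two unprojected double brackets into `[[X, Y], Z]`. The point `x`
disappears, as homogeneity requires. -/
theorem curvature_eq (x : SO5) (X Y Z : 𝔪) : curvature leviCivita x X Y Z
    = -proj ⁅⁅X.1, Y.1⁆, Z.1⁆ + (1 / 2 : ℝ) • br (br X Y) Z + (1 / 4 : ℝ) • br X (br Y Z)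
      - (1 / 4 : ℝ) • br Y (br X Z) := by
  have hj := congrArg proj (leibniz_lie X.1 Y.1 Z.1)
  rw [map_add] at hj
  simp only [curvature, leviCivita_leviCivita_extend, leviCivita_extend_self, extend_self]
  rw [hj, br_skew Y X]
  simp only [map_neg, map_smul, LinearMap.neg_apply, LinearMap.smul_apply]
  module

theorem hasLieDeriv_extend_mem (x : SO5) (Y X : 𝔪) :
    HasLieDeriv (fun y => extend x Y y) x X (-br X Y) := hasLieDeriv_extend x Y X.1

/-- The covariant derivative of the tensor field `x ↦ γ(x⁻¹v)`. -/
def nab (γ : (Fin 5 → ℝ) →ₗ[ℝ] 𝔪 →ₗ[ℝ] 𝔪 →ₗ[ℝ] ℝ) (w : Fin 5 → ℝ) (X Y Z : 𝔪) : ℝ :=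
  -γ (act X w) Y Z - (1 / 2) * γ w (br X Y) Z - (1 / 2) * γ w Y (br X Z)

/-- Moving `x` differentiates `x⁻¹v` to `-X(x⁻¹v)` and each extended argument to minus a full
bracket; the connection terms return half of the latter. The computation takes place on `SO(5)` and
needs no invariance of `γ`. -/
theorem covDeriv_equivariant (γ : (Fin 5 → ℝ) →ₗ[ℝ] 𝔪 →ₗ[ℝ] 𝔪 →ₗ[ℝ] ℝ) (v : Fin 5 → ℝ) :
    covDeriv leviCivita (fun x (Y : Fin 2 → 𝔪) => γ ((x⁻¹ : SO5).1 *ᵥ v) (Y 0) (Y 1))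
      = fun x Y => nab γ ((x⁻¹ : SO5).1 *ᵥ v) (Y 0) (Y 1) (Y 2) := by
  funext x Y
  have hw := hasLieDeriv_inv_mulVec v x (Y 0).1
  have h := (((hw.map γ).app (hasLieDeriv_extend_mem x (Y 1) (Y 0))).app
    (hasLieDeriv_extend_mem x (Y 2) (Y 0))).lieDeriv_eq
  rw [covDeriv]
  refine (congrArg₂ _ h rfl).trans ?_
  simp [Fin.sum_univ_two, leviCivita_extend_self, extend_self, Function.update, nab, act_apply]
  ring

theorem covDeriv_covDeriv_equivariant (γ : (Fin 5 → ℝ) →ₗ[ℝ] 𝔪 →ₗ[ℝ] 𝔪 →ₗ[ℝ] ℝ)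
    (v : Fin 5 → ℝ) (x : SO5) (Y : Fin 4 → 𝔪) :
    covDeriv leviCivita (covDeriv leviCivita
      (fun x (Y : Fin 2 → 𝔪) => γ ((x⁻¹ : SO5).1 *ᵥ v) (Y 0) (Y 1))) x Y
      = -nab γ (act (Y 0) ((x⁻¹ : SO5).1 *ᵥ v)) (Y 1) (Y 2) (Y 3)
        - (1 / 2) * nab γ ((x⁻¹ : SO5).1 *ᵥ v) (br (Y 0) (Y 1)) (Y 2) (Y 3)
        - (1 / 2) * nab γ ((x⁻¹ : SO5).1 *ᵥ v) (Y 1) (br (Y 0) (Y 2)) (Y 3)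
        - (1 / 2) * nab γ ((x⁻¹ : SO5).1 *ᵥ v) (Y 1) (Y 2) (br (Y 0) (Y 3)) := by
  rw [covDeriv_equivariant, covDeriv]
  have hw := hasLieDeriv_inv_mulVec v x (Y 0).1
  rw [← act_apply] at hw
  have h1 := hasLieDeriv_extend_mem x (Y 1) (Y 0)
  have h2 := hasLieDeriv_extend_mem x (Y 2) (Y 0)
  have h3 := hasLieDeriv_extend_mem x (Y 3) (Y 0)
  have a := (((((h1.map act).app hw).map γ).app h2).app h3).neg
  have b := (((hw.map γ).app ((h1.map br).app h2)).app h3).smul (-(1 / 2) : ℝ)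
  have c := (((hw.map γ).app h2).app ((h1.map br).app h3)).smul (-(1 / 2) : ℝ)
  have h := ((a.add b).add c).lieDeriv_eq
  have e : (fun y => nab γ ((y⁻¹ : SO5).1 *ᵥ v) (extend x (Y 1) y) (extend x (Y 2) y)
      (extend x (Y 3) y)) = fun y =>
      -γ (act (extend x (Y 1) y) ((y⁻¹ : SO5).1 *ᵥ v)) (extend x (Y 2) y) (extend x (Y 3) y)
      + (-(1 / 2) : ℝ) • γ ((y⁻¹ : SO5).1 *ᵥ v) (br (extend x (Y 1) y) (extend x (Y 2) y))
        (extend x (Y 3) y)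
      + (-(1 / 2) : ℝ) • γ ((y⁻¹ : SO5).1 *ᵥ v) (extend x (Y 2) y)
        (br (extend x (Y 1) y) (extend x (Y 3) y)) := by
    funext y
    simp only [nab, smul_eq_mul]
    ring
  rw [← e] at h
  refine (congrArg₂ _ h (Fin.sum_univ_three _)).trans ?_
  generalize (x⁻¹ : SO5).1 *ᵥ v = w
  simp [Function.update, nab, leviCivita_extend_self, extend_self]
  ring

theorem covDeriv_parallel (T : 𝔪 →ₗ[ℝ] 𝔪 →ₗ[ℝ] 𝔪 →ₗ[ℝ] ℝ) (x : SO5) (Y : Fin 4 → 𝔪) :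
    covDeriv leviCivita (fun _ (Y : Fin 3 → 𝔪) => T (Y 0) (Y 1) (Y 2)) x Y
      = -(1 / 2) * (T (br (Y 0) (Y 1)) (Y 2) (Y 3) + T (Y 1) (br (Y 0) (Y 2)) (Y 3)
        + T (Y 1) (Y 2) (br (Y 0) (Y 3))) := by
  have h := ((((hasLieDeriv_extend_mem x (Y 1) (Y 0)).map T).app
    (hasLieDeriv_extend_mem x (Y 2) (Y 0))).app (hasLieDeriv_extend_mem x (Y 3) (Y 0))).lieDeriv_eq
  rw [covDeriv]
  refine (congrArg₂ _ h (Fin.sum_univ_three _)).trans ?_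
  simp [Function.update, leviCivita_extend_self, extend_self]
  ring

/-! ## The equivariant quadratic map -/

/-- The coefficients of the quadratic map in the adapted bases. -/
def quadTable : List (List (List ℤ)) := [
  [[0, -4, 0, 0, 0, 0, 0],
   [-4, 0, 0, 0, 0, 0, 0],
   [0, 0, 0, 0, 0, 0, 0],
   [0, 0, 0, 0, 0, 0, -4],
   [0, 0, 0, 0, 0, -4, 0],
   [0, 0, 0, 0, -4, 0, 24],
   [0, 0, 0, -4, 0, 24, 0]],
  [[0, 0, 0, 0, 0, 0, 4],
   [0, 0, 0, 2, 0, 6, 0],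
   [0, 0, 0, 0, -2, 0, 6],
   [0, 2, 0, 0, 0, 0, 0],
   [0, 0, -2, 0, 0, 0, 0],
   [0, 6, 0, 0, 0, 0, 0],
   [4, 0, 6, 0, 0, 0, 0]],
  [[0, 0, 0, 0, 0, -4, 0],
   [0, 0, 0, 0, -2, 0, -6],
   [0, 0, 0, -2, 0, 6, 0],
   [0, 0, -2, 0, 0, 0, 0],
   [0, -2, 0, 0, 0, 0, 0],
   [-4, 0, 6, 0, 0, 0, 0],
   [0, -6, 0, 0, 0, 0, 0]],
  [[0, 0, 4, 0, 0, 0, 0],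
   [0, 0, 0, 0, 0, 0, 0],
   [4, 0, 0, 0, 0, 0, 0],
   [0, 0, 0, 0, 0, 4, 0],
   [0, 0, 0, 0, 0, 0, -4],
   [0, 0, 0, 4, 0, 24, 0],
   [0, 0, 0, 0, -4, 0, -24]],
  [[-8, 0, 0, 0, 0, 0, 0],
   [0, 0, 0, 0, 0, 0, 0],
   [0, 0, 0, 0, 0, 0, 0],
   [0, 0, 0, 4, 0, 0, 0],
   [0, 0, 0, 0, 4, 0, 0],
   [0, 0, 0, 0, 0, -36, 0],
   [0, 0, 0, 0, 0, 0, -36]]]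


/-- The entries of `quadTable`. -/
def qst (j : Fin 5) (a b : Fin 7) : ℤ := lookup quadTable j a b

/-- Multiples of the inverse squared norms of the adapted basis. -/
def inrm (a : Fin 7) : ℤ := [6, 10, 10, 15, 15, 1, 1].getD a 0

theorem inrm_mul_nrm : ∀ a, inrm a * nrm (emb a) = 30 := by decide

theorem inv_nrm (a : Fin 7) : 1 / (6 * (nrm (emb a) : ℝ)) = inrm a / 180 := by
  have h : (inrm a : ℝ) * nrm (emb a) = 30 := by exact_mod_cast inrm_mul_nrm a
  have := nrm_pos' (emb a)
  field_simp
  linarith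

/-- The symmetric endomorphism of `ℝ⁵` defined by the cubic form and a vector. -/
def cubicEnd : (Fin 5 → ℝ) →ₗ[ℝ] Matrix (Fin 5) (Fin 5) ℝ where
  toFun w := Matrix.of fun i j => tri w (Pi.single i 1) (Pi.single j 1)
  map_add' v w := by ext; simp
  map_smul' c w := by ext; simp

theorem cubicEnd_apply (w : Fin 5 → ℝ) (i j : Fin 5) :
    cubicEnd w i j = tri w (Pi.single i 1) (Pi.single j 1) := rfl

theorem tri_eq_sum (w u v : Fin 5 → ℝ) :
    tri w u v = ∑ i, ∑ j, (u i * v j) * cubicEnd w i j := by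
  have := bilin_expand (Pi.basisFun ℝ (Fin 5)) (Pi.basisFun ℝ (Fin 5)) (tri w) u v
  simpa [cubicEnd_apply] using this

theorem cubicEnd_invariant {k : SO5} (hk : k ∈ SO3irr) (w : Fin 5 → ℝ) :
    cubicEnd (k.1 *ᵥ w) = k.1 * cubicEnd w * k.1ᵀ := by
  have h : k.1ᵀ * cubicEnd (k.1 *ᵥ w) * k.1 = cubicEnd w := by
    ext i j
    rw [cubicEnd_apply w, ← tri_invariant hk, tri_eq_sum, Matrix.mul_apply]
    simp only [Matrix.mul_apply, Matrix.transpose_apply, Finset.sum_mul, Matrix.mulVec_single_one,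
      Matrix.col_apply]
    rw [Finset.sum_comm]
    exact Finset.sum_congr rfl fun a _ => Finset.sum_congr rfl fun b _ => by ring
  calc cubicEnd (k.1 *ᵥ w) = (k.1 * k.1ᵀ) * cubicEnd (k.1 *ᵥ w) * (k.1 * k.1ᵀ) := by
        rw [SO5.mul_transpose, Matrix.one_mul, Matrix.mul_one]
    _ = k.1 * (k.1ᵀ * cubicEnd (k.1 *ᵥ w) * k.1) * k.1ᵀ := by simp only [Matrix.mul_assoc]
    _ = _ := by rw [h]

/-- The equivariant map from `ℝ⁵` to the symmetric bilinear forms on `𝔪`. -/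
def quad : (Fin 5 → ℝ) →ₗ[ℝ] 𝔪 →ₗ[ℝ] 𝔪 →ₗ[ℝ] ℝ where
  toFun w := LinearMap.mk₂ ℝ
    (fun X Y => (cubicEnd w * (X.1.1 * Y.1.1 + Y.1.1 * X.1.1)).trace)
    (fun X X' Y => by
      rw [← Matrix.trace_add, ← Matrix.mul_add]
      congr 2
      change (X.1.1 + X'.1.1) * _ + _ * (X.1.1 + X'.1.1) = _
      noncomm_ring)
    (fun c X Y => by
      change (_ * ((c • X.1.1) * Y.1.1 + Y.1.1 * (c • X.1.1))).trace = _
      rw [Matrix.smul_mul, Matrix.mul_smul, ← smul_add, Matrix.mul_smul, Matrix.trace_smul])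
    (fun X Y Y' => by
      rw [← Matrix.trace_add, ← Matrix.mul_add]
      congr 2
      change _ * (Y.1.1 + Y'.1.1) + (Y.1.1 + Y'.1.1) * _ = _
      noncomm_ring)
    (fun c X Y => by
      change (_ * (X.1.1 * (c • Y.1.1) + (c • Y.1.1) * X.1.1)).trace = _
      rw [Matrix.mul_smul, Matrix.smul_mul, ← smul_add, Matrix.mul_smul, Matrix.trace_smul])
  map_add' v w := by
    ext X Y
    simp only [map_add, Matrix.add_mul, Matrix.trace_add, LinearMap.mk₂_apply, LinearMap.add_apply]
  map_smul' c w := by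
    ext X Y
    simp only [map_smul, Matrix.smul_mul, Matrix.trace_smul, LinearMap.mk₂_apply,
      LinearMap.smul_apply, RingHom.id_apply]

theorem quad_apply (w : Fin 5 → ℝ) (X Y : 𝔪) :
    quad w X Y = (cubicEnd w * (X.1.1 * Y.1.1 + Y.1.1 * X.1.1)).trace := rfl

theorem quad_symm (w : Fin 5 → ℝ) (X Y : 𝔪) : quad w X Y = quad w Y X := by
  rw [quad_apply, quad_apply, add_comm]

theorem quad_invariant (k : SO3irr) (w : Fin 5 → ℝ) (X Y : 𝔪) :
    quad (k.1.1 *ᵥ w) (isotropyRep k X) (isotropyRep k Y) = quad w X Y := by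
  have hX : ∀ X : 𝔪, (isotropyRep k X).1.1 = k.1.1 * X.1.1 * k.1.1ᵀ := fun X => rfl
  have h1 := SO5.transpose_mul k.1
  rw [quad_apply, quad_apply, cubicEnd_invariant k.2, hX, hX]
  calc _ = (k.1.1 * (cubicEnd w * ((k.1.1ᵀ * k.1.1) * X.1.1 * (k.1.1ᵀ * k.1.1) * Y.1.1
        + (k.1.1ᵀ * k.1.1) * Y.1.1 * (k.1.1ᵀ * k.1.1) * X.1.1) * k.1.1ᵀ)).trace := by
        congr 1
        noncomm_ring
    _ = _ := by
        rw [h1, Matrix.trace_mul_comm]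
        simp only [Matrix.one_mul, Matrix.mul_one]
        rw [Matrix.mul_assoc, h1, Matrix.mul_one]

-- `Matrix.diagonal wt` is three times the inverse Gram matrix. It raises an index of the cubic
-- form, turning a bilinear form into an endomorphism, and accounts for the factor 3.
set_option maxRecDepth 100000 in
theorem quad_table : ∀ (j : Fin 5) (a b : Fin 7), 3 * qst j a b =
    (Matrix.diagonal wt * Matrix.of (triInt j)
      * (M (emb a) * M (emb b) + M (emb b) * M (emb a))).trace := by
  decide +kernel

theorem fvec_eq (i : Fin 5) :
    fvec i = (![1, 1, 1, 1, √3] : Fin 5 → ℝ) i • (Pi.single i 1 : Fin 5 → ℝ) := by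
  ext l
  rw [fvec, dil, Matrix.mulVec_diagonal]
  by_cases h : l = i
  · subst h; simp
  · simp [h]

theorem dil_cubicEnd_dil (j : Fin 5) :
    dil * cubicEnd (fvec j) * dil = castR (Matrix.of (triInt j)) := by
  ext i k
  rw [dil, Matrix.mul_diagonal, Matrix.diagonal_mul]
  change _ = (triInt j i k : ℝ)
  rw [← tri_fvec, fvec_eq i, fvec_eq k, cubicEnd_apply]
  simp only [map_smul, LinearMap.smul_apply, smul_eq_mul]
  ring

theorem quad_mvec (j : Fin 5) (a b : Fin 7) :
    quad (fvec j) (mvec a) (mvec b) = qst j a b := by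
  have hd : (3 : ℝ) • (dil' * dil') = castR (Matrix.diagonal wt) := by
    rw [dil', Matrix.diagonal_mul_diagonal, castR, Matrix.diagonal_map (by simp),
      ← Matrix.diagonal_smul]
    congr 1
    ext i
    fin_cases i <;> simp [wt, ← mul_inv]
  have hS : dil' * cubicEnd (fvec j) * dil = dil' * dil' * castR (Matrix.of (triInt j)) := by
    rw [← dil_cubicEnd_dil]
    calc _ = dil' * (dil' * dil) * cubicEnd (fvec j) * dil := by
          rw [dil'_mul_dil, Matrix.mul_one]
      _ = _ := by simp only [Matrix.mul_assoc]
  have h : (3 : ℝ) * quad (fvec j) (mvec a) (mvec b) = ((3 * qst j a b : ℤ) : ℝ) := by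
    rw [quad_table, ← trace_castR, castR_mul, castR_mul, ← hd, quad_apply]
    change 3 * (cubicEnd (fvec j) * (bmat _ * bmat _ + bmat _ * bmat _)).trace = _
    have e : bmat (emb a) * bmat (emb b) + bmat (emb b) * bmat (emb a)
        = dil * (castR (M (emb a) * M (emb b) + M (emb b) * M (emb a)) * dil') := by
      rw [bmat_mul, bmat_mul, ← Matrix.add_mul, ← Matrix.mul_add, Matrix.mul_assoc]
      congr 3
      ext; simp
    rw [e, ← Matrix.mul_assoc, ← Matrix.mul_assoc, Matrix.trace_mul_comm, ← Matrix.mul_assoc,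
      ← Matrix.mul_assoc, hS, Matrix.smul_mul, Matrix.smul_mul, Matrix.trace_smul, smul_eq_mul]
  push_cast at h
  linarith

/-! ### Reduction of multilinear identities to the adapted bases -/

/-- Linearity is assumed of an unbundled function, so that a multilinear identity can be reduced to
basis vectors one argument at a time after `revert`. -/
theorem eq_of_mvec {V : Type*} [AddCommGroup V] [Module ℝ V] {F G : 𝔪 → V} (hF : IsLinearMap ℝ F)
    (hG : IsLinearMap ℝ G) (h : ∀ a, F (mvec a) = G (mvec a)) (X : 𝔪) : F X = G X := by
  have : hF.mk' F = hG.mk' G := mbas.ext fun a => by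
    rw [mbas_apply]
    exact h a
  exact LinearMap.congr_fun this X

theorem eq_of_fvec {V : Type*} [AddCommGroup V] [Module ℝ V] {F G : (Fin 5 → ℝ) → V}
    (hF : IsLinearMap ℝ F) (hG : IsLinearMap ℝ G) (h : ∀ j, F (fvec j) = G (fvec j))
    (w : Fin 5 → ℝ) : F w = G w := by
  have : hF.mk' F = hG.mk' G := fvec_ext h
  exact LinearMap.congr_fun this w

theorem act_mvec (a : Fin 7) (j : Fin 5) :
    act (mvec a) (fvec j) = ∑ i, (M (emb a) i j : ℝ) • fvec i := mvec_fvec a j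

theorem isLinearMap_coe {V W : Type*} [AddCommGroup V] [Module ℝ V] [AddCommGroup W] [Module ℝ W]
    (L : V →ₗ[ℝ] W) : IsLinearMap ℝ fun X => L X := ⟨L.map_add, L.map_smul⟩

theorem isLinearMap_sum {ι V W : Type*} [Fintype ι] [AddCommGroup V] [Module ℝ V] [AddCommGroup W]
    [Module ℝ W] (c : ι → ℝ) (L : ι → V →ₗ[ℝ] W) : IsLinearMap ℝ fun X => ∑ i, c i • L i X := by
  convert isLinearMap_coe (∑ i, c i • L i) using 2
  simp

theorem isLinearMap_flip {V W U : Type*} [AddCommGroup V] [Module ℝ V] [AddCommGroup W] [Module ℝ W]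
    [AddCommGroup U] [Module ℝ U] (L : V →ₗ[ℝ] W →ₗ[ℝ] U) (w : W) : IsLinearMap ℝ fun X => L X w :=
  isLinearMap_coe (L.flip w)

/-! ### The Killing equation -/

set_option maxRecDepth 100000 in
theorem killing_table : ∀ (j : Fin 5) (a b c : Fin 7),
    ∑ k, M (emb a) k j * qst k b c + ∑ k, M (emb b) k j * qst k c a
      + ∑ k, M (emb c) k j * qst k a b = 0 := by decide +kernel

/-- The polarised Killing equation. On the diagonal it says that `X` annihilates the vector dual to
`X ∧ X`, of which `quad` is a multiple by multiplicity one. The mixed form is also what the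
divergence needs. -/
theorem quad_act_cyclic (w : Fin 5 → ℝ) (X Y Z : 𝔪) :
    quad (act X w) Y Z + quad (act Y w) Z X + quad (act Z w) X Y = 0 := by
  revert X
  refine eq_of_mvec (by constructor <;> intros <;> simp <;> ring) ⟨by simp, by simp⟩ fun a => ?_
  revert Y
  refine eq_of_mvec (by constructor <;> intros <;> simp <;> ring) ⟨by simp, by simp⟩ fun b => ?_
  revert Z
  refine eq_of_mvec (by constructor <;> intros <;> simp <;> ring) ⟨by simp, by simp⟩ fun c => ?_
  revert w
  refine eq_of_fvec (by constructor <;> intros <;> simp <;> ring) ⟨by simp, by simp⟩ fun j => ?_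
  simp only [act_mvec, map_sum, map_smul, LinearMap.sum_apply, LinearMap.smul_apply, quad_mvec,
    smul_eq_mul]
  exact_mod_cast killing_table j a b c

theorem quad_act_self (w : Fin 5 → ℝ) (X : 𝔪) : quad (act X w) X X = 0 := by
  have := quad_act_cyclic w X X X
  linarith

set_option maxRecDepth 100000 in
theorem trace_table : ∀ j, ∑ a, inrm a * qst j a a = 0 := by decide +kernel

/-- The trace is an invariant linear functional on the nontrivial irreducible module `ℝ⁵`, so it has
to vanish. -/
theorem trace_quad (w : Fin 5 → ℝ) : ∑ i, quad w (frame i) (frame i) = 0 := by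
  rw [sum_frame]
  revert w
  refine eq_of_fvec (by constructor <;> intros <;> simp [mul_add, Finset.sum_add_distrib,
    Finset.mul_sum, mul_left_comm]) ⟨by simp, by simp⟩ fun j => ?_
  simp only [quad_mvec, inv_nrm, smul_eq_mul, div_mul_eq_mul_div]
  rw [← Finset.sum_div]
  have : (∑ a, (inrm a : ℝ) * qst j a a) = 0 := by exact_mod_cast trace_table j
  rw [this, zero_div]

/-! ### The terms of the rough Laplacian -/

set_option maxRecDepth 100000 in
theorem act_act_table : ∀ i j, ∑ e, inrm e * ∑ k, M (emb e) k j * M (emb e) i k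
    = if i = j then -84 else 0 := by decide +kernel

/-- The Casimir operator of `so(5)` minus that of the isotropy algebra, both scalar on `ℝ⁵`: `-7/15
= -(2/3 - 1/5)`. -/
theorem sum_act_act (w : Fin 5 → ℝ) :
    ∑ i, act (frame i) (act (frame i) w) = (-7 / 15 : ℝ) • w := by
  refine (sum_frame (act.compl₂ (act.flip w))).trans ?_
  simp only [LinearMap.compl₂_apply, LinearMap.flip_apply]
  revert w
  refine eq_of_fvec (isLinearMap_sum _ fun e => act (mvec e) ∘ₗ act (mvec e))
    (IsLinearMap.isLinearMap_smul _) fun j => ?_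
  have h : ∀ i, ∑ e, (inrm e / 180 : ℝ) * ∑ k, (M (emb e) k j : ℝ) * M (emb e) i k
      = if i = j then (-7 / 15 : ℝ) else 0 := by
    intro i
    have := congrArg (fun z : ℤ => (z : ℝ) / 180) (act_act_table i j)
    push_cast at this
    simp only [div_mul_eq_mul_div]
    rw [← Finset.sum_div, this]
    split_ifs <;> norm_num
  have e : ∀ e, act (mvec e) (act (mvec e) (fvec j))
      = ∑ i, (∑ k, (M (emb e) k j : ℝ) * M (emb e) i k) • fvec i := by
    intro e
    simp only [act_mvec, map_sum, map_smul, Finset.smul_sum, smul_smul, Finset.sum_smul]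
    exact Finset.sum_comm
  simp only [e, inv_nrm, Finset.smul_sum, smul_smul]
  rw [Finset.sum_comm]
  simp only [← Finset.sum_smul, h]
  simp

set_option maxRecDepth 100000 in
theorem br_br_table : ∀ i j, ∑ e, inrm e * ∑ k, cst (emb e) j (emb k) * cst (emb e) k (emb i)
    = if i = j then -3600 else 0 := by decide +kernel

/-- The Casimir operator of `so(5)` is `-1` on `𝔪` and that of the isotropy algebra is `-2/5`. The
latter is also the contribution of the isotropy part of the inner bracket, which leaves `-1 + 2/5 +
2/5`. -/
theorem sum_br_br (Y : 𝔪) : ∑ i, br (frame i) (br (frame i) Y) = (-1 / 5 : ℝ) • Y := by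
  refine (sum_frame (br.compl₂ (br.flip Y))).trans ?_
  simp only [LinearMap.compl₂_apply, LinearMap.flip_apply]
  revert Y
  refine eq_of_mvec (isLinearMap_sum _ fun e => br (mvec e) ∘ₗ br (mvec e))
    (IsLinearMap.isLinearMap_smul _) fun j => ?_
  have h : ∀ i, ∑ e, (inrm e / 180 : ℝ) * ((1 / 100) *
      ∑ k, (cst (emb e) j (emb k) : ℝ) * cst (emb e) k (emb i)) = if i = j then (-1 / 5 : ℝ) else 0 := by
    intro i
    have := congrArg (fun z : ℤ => (z : ℝ) / 18000) (br_br_table i j)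
    push_cast at this
    have e : ∀ e : Fin 7, (inrm e / 180 : ℝ) * ((1 / 100) *
        ∑ k, (cst (emb e) j (emb k) : ℝ) * cst (emb e) k (emb i)) = (inrm e *
        ∑ k, (cst (emb e) j (emb k) : ℝ) * cst (emb e) k (emb i)) / 18000 := fun e => by ring
    simp only [e]
    rw [← Finset.sum_div, this]
    split_ifs <;> norm_num
  have e : ∀ e, br (mvec e) (br (mvec e) (mvec j)) = ∑ i, ((1 / 100) *
      ∑ k, (cst (emb e) j (emb k) : ℝ) * cst (emb e) k (emb i)) • mvec i := by
    intro e
    simp only [br_mvec, map_sum, map_smul, Finset.smul_sum, smul_smul, Finset.sum_smul,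
      Finset.mul_sum]
    rw [Finset.sum_comm]
    refine Finset.sum_congr rfl fun a _ => Finset.sum_congr rfl fun b _ => ?_
    congr 1
    ring
  simp only [e, inv_nrm, Finset.smul_sum, smul_smul]
  rw [Finset.sum_comm]
  simp only [← Finset.sum_smul, h]
  simp

set_option maxRecDepth 100000 in
theorem act_br_table : ∀ (j : Fin 5) (a b : Fin 7), ∑ e, inrm e * ∑ k, M (emb e) k j *
    (∑ l, cst (emb e) a (emb l) * qst k l b + ∑ l, cst (emb e) b (emb l) * qst k a l)
      = 480 * qst j a b := by decide +kernel

/-- The left side is an equivariant map from `ℝ⁵` to `Sym² 𝔪`, hence a multiple of `quad` by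
multiplicity one; the same applies to `sum_quad_br` and `sum_quad_curv`. -/
theorem sum_act_br (w : Fin 5 → ℝ) (Y Z : 𝔪) :
    ∑ i, (quad (act (frame i) w) (br (frame i) Y) Z + quad (act (frame i) w) Y (br (frame i) Z))
      = (4 / 15 : ℝ) * quad w Y Z := by
  refine (sum_frame (LinearMap.mk₂ ℝ (fun e e' => quad (act e w) (br e' Y) Z
    + quad (act e w) Y (br e' Z)) (by intros; simp; ring) (by intros; simp; ring)
    (by intros; simp; ring) (by intros; simp; ring))).trans ?_
  simp only [LinearMap.mk₂_apply]
  revert Y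
  refine eq_of_mvec (by constructor <;> intros <;> simp [Finset.sum_add_distrib, Finset.mul_sum,
    mul_add, mul_left_comm] <;> ring) (isLinearMap_flip ((4 / 15 : ℝ) • quad w) Z) fun a => ?_
  revert Z
  refine eq_of_mvec (by constructor <;> intros <;> simp [Finset.sum_add_distrib, Finset.mul_sum,
    mul_add, mul_left_comm] <;> ring) (isLinearMap_coe ((4 / 15 : ℝ) • quad w (mvec a))) fun b => ?_
  revert w
  refine eq_of_fvec (by constructor <;> intros <;> simp [Finset.sum_add_distrib, Finset.mul_sum,
    mul_add, mul_left_comm] <;> ring) (isLinearMap_coe ((4 / 15 : ℝ) • (quad.flip (mvec a)).flip (mvec b)))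
    fun j => ?_
  -- `1800 = 180 · 10`: inverse norms are `inrm / 180`, and one bracket contributes the denominator
  -- 10.
  have h := congrArg (fun z : ℤ => (z : ℝ) / 1800) (act_br_table j a b)
  push_cast at h
  rw [Finset.sum_div] at h
  rw [quad_mvec]
  refine (Finset.sum_congr rfl fun e _ => ?_).trans (h.trans (by ring))
  simp only [act_mvec, br_mvec, map_sum, map_smul, LinearMap.sum_apply, LinearMap.smul_apply,
    quad_mvec, smul_eq_mul, inv_nrm, Finset.mul_sum, Finset.sum_div, mul_add, add_div,
    Finset.sum_add_distrib]
  congr 1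
  · rw [Finset.sum_comm]
    exact Finset.sum_congr rfl fun k _ => Finset.sum_congr rfl fun l _ => by ring
  · rw [Finset.sum_comm]
    exact Finset.sum_congr rfl fun k _ => Finset.sum_congr rfl fun l _ => by ring

set_option maxRecDepth 100000 in
theorem quad_br_table : ∀ (j : Fin 5) (a b : Fin 7), ∑ e, inrm e * ∑ k, cst (emb e) a (emb k) *
    ∑ l, cst (emb e) b (emb l) * qst j k l = -600 * qst j a b := by decide +kernel

theorem sum_quad_br (w : Fin 5 → ℝ) (Y Z : 𝔪) :
    ∑ i, quad w (br (frame i) Y) (br (frame i) Z) = (-1 / 30 : ℝ) * quad w Y Z := by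
  refine (sum_frame ((quad w).compl₁₂ (br.flip Y) (br.flip Z))).trans ?_
  simp only [LinearMap.compl₁₂_apply, LinearMap.flip_apply]
  revert Y
  refine eq_of_mvec (by constructor <;> intros <;> simp [Finset.sum_add_distrib, Finset.mul_sum,
    mul_add, mul_left_comm]) (isLinearMap_flip ((-1 / 30 : ℝ) • quad w) Z) fun a => ?_
  revert Z
  refine eq_of_mvec (by constructor <;> intros <;> simp [Finset.sum_add_distrib, Finset.mul_sum,
    mul_add, mul_left_comm]) (isLinearMap_coe ((-1 / 30 : ℝ) • quad w (mvec a))) fun b => ?_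
  revert w
  refine eq_of_fvec (by constructor <;> intros <;> simp [Finset.sum_add_distrib, Finset.mul_sum,
    mul_add, mul_left_comm])
    (isLinearMap_coe ((-1 / 30 : ℝ) • (quad.flip (mvec a)).flip (mvec b))) fun j => ?_
  have h := congrArg (fun z : ℤ => (z : ℝ) / 18000) (quad_br_table j a b)
  push_cast at h
  rw [Finset.sum_div] at h
  rw [quad_mvec]
  refine (Finset.sum_congr rfl fun e _ => ?_).trans (h.trans (by ring))
  simp only [br_mvec, map_sum, map_smul, LinearMap.sum_apply, LinearMap.smul_apply,
    quad_mvec, smul_eq_mul, inv_nrm, Finset.mul_sum, Finset.sum_div]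
  rw [Finset.sum_comm]
  exact Finset.sum_congr rfl fun k _ => Finset.sum_congr rfl fun l _ => by ring

/-! ## The Einstein condition and the curvature action -/

/-- The algebraic expression of the curvature. -/
def curv (X Y Z : 𝔪) : 𝔪 :=
  -proj ⁅⁅X.1, Y.1⁆, Z.1⁆ + (1 / 2 : ℝ) • br (br X Y) Z + (1 / 4 : ℝ) • br X (br Y Z)
    - (1 / 4 : ℝ) • br Y (br X Z)

theorem curvature_leviCivita (x : SO5) (X Y Z : 𝔪) : curvature leviCivita x X Y Z = curv X Y Z :=
  curvature_eq x X Y Z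

theorem isLinearMap_curv₁ (Y Z : 𝔪) : IsLinearMap ℝ fun X => curv X Y Z := by
  constructor
  · intros
    simp [curv]
    module
  · intros
    simp [curv]
    module

theorem isLinearMap_curv₂ (X Z : 𝔪) : IsLinearMap ℝ fun Y => curv X Y Z := by
  constructor
  · intros
    simp [curv]
    module
  · intros
    simp [curv]
    module

theorem isLinearMap_curv₃ (X Y : 𝔪) : IsLinearMap ℝ fun Z => curv X Y Z := by
  constructor
  · intros
    simp [curv]
    module
  · intros
    simp [curv]
    module

/-- The curvature in the adapted basis, up to a factor. -/
def cuv (x y z d : Fin 7) : ℤ := -4 * ∑ c : Fin 10, cst (emb x) y c * cst c z (emb d)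
  + 2 * ∑ c : Fin 7, cst (emb x) y (emb c) * cst (emb c) z (emb d)
  + ∑ c : Fin 7, cst (emb y) z (emb c) * cst (emb x) c (emb d)
  - ∑ c : Fin 7, cst (emb x) z (emb c) * cst (emb y) c (emb d)

theorem sum_smul_sum {ι κ V : Type*} [Fintype ι] [Fintype κ] [AddCommGroup V] [Module ℝ V]
    (f : ι → ℝ) (h : ι → κ → ℝ) (r : ℝ) (v : κ → V) :
    ∑ c, f c • r • ∑ d, h c d • v d = r • ∑ d, (∑ c, f c * h c d) • v d := by
  simp only [Finset.smul_sum, smul_smul, Finset.sum_smul]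
  rw [Finset.sum_comm]
  refine Finset.sum_congr rfl fun a _ => Finset.sum_congr rfl fun b _ => ?_
  congr 1
  ring

theorem br_br_mvec_left (x y z : Fin 7) : br (br (mvec x) (mvec y)) (mvec z)
    = (1 / 100 : ℝ) • ∑ d, (∑ c : Fin 7, (cst (emb x) y (emb c) : ℝ) * cst (emb c) z (emb d))
      • mvec d := by
  rw [br_mvec, map_smul, LinearMap.smul_apply, map_sum, LinearMap.sum_apply]
  simp only [map_smul, LinearMap.smul_apply, br_mvec]
  rw [sum_smul_sum, smul_smul]
  norm_num

theorem br_br_mvec_right (x y z : Fin 7) : br (mvec x) (br (mvec y) (mvec z))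
    = (1 / 100 : ℝ) • ∑ d, (∑ c : Fin 7, (cst (emb y) z (emb c) : ℝ) * cst (emb x) c (emb d))
      • mvec d := by
  rw [br_mvec, map_smul, map_sum]
  simp only [map_smul, br_mvec]
  rw [sum_smul_sum, smul_smul]
  norm_num

/-- Here the inner bracket is not projected, so the intermediate index runs over all ten basis
elements. -/
theorem proj_lie_lie_mvec (x y z : Fin 7) : proj ⁅⁅(mvec x).1, (mvec y).1⁆, (mvec z).1⁆
    = (1 / 100 : ℝ) • ∑ d, (∑ c : Fin 10, (cst (emb x) y c : ℝ) * cst c z (emb d)) • mvec d := by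
  change proj ⁅⁅bas (emb x), bas (emb y)⁆, bas (emb z)⁆ = _
  rw [lie_bas]
  change proj (lieBil.flip (bas (emb z)) _) = _
  simp only [map_smul, map_sum]
  change (1 / 10 : ℝ) • ∑ c, (cst (emb x) y c : ℝ) • proj ⁅bas c, bas (emb z)⁆ = _
  simp only [proj_lie_bas]
  rw [sum_smul_sum, smul_smul]
  norm_num

/-- `400 = 4 · 10²`: two brackets, and the coefficients `-1, ½, ¼, -¼` of the curvature cleared by
4. -/
theorem curv_mvec (x y z : Fin 7) :
    curv (mvec x) (mvec y) (mvec z) = (1 / 400 : ℝ) • ∑ d, (cuv x y z d : ℝ) • mvec d := by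
  rw [curv, br_br_mvec_left, br_br_mvec_right, br_br_mvec_right, proj_lie_lie_mvec]
  simp only [cuv, Finset.smul_sum, smul_smul, ← Finset.sum_neg_distrib, ← Finset.sum_add_distrib,
    ← Finset.sum_sub_distrib, ← neg_smul, ← add_smul, ← sub_smul]
  refine Finset.sum_congr rfl fun d _ => ?_
  congr 1
  push_cast
  ring

set_option maxRecDepth 100000 in
theorem ricci_table : ∀ x y : Fin 7,
    ∑ e, cuv e x y e = if x = y then 1080 * nrm (emb x) else 0 := by decide +kernel

/-- For a normal homogeneous metric defined by `-B`, `Ric` is `¼` plus half the isotropy Casimir on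
`𝔪`, here `¼ + ½ · 2/5`. -/
theorem ricci_leviCivita (x : SO5) (X Y : 𝔪) : ricci leviCivita x X Y = (9 / 20 : ℝ) * g X Y := by
  simp only [ricci, curvature_leviCivita]
  refine (sum_frame (gL ∘ₗ (isLinearMap_curv₁ X Y).mk')).trans ?_
  simp only [LinearMap.comp_apply, IsLinearMap.mk'_apply]
  revert X
  refine eq_of_mvec ?_ (isLinearMap_flip ((9 / 20 : ℝ) • gL) Y) fun a => ?_
  · exact isLinearMap_sum _ fun e => gL.flip (mvec e) ∘ₗ (isLinearMap_curv₂ (mvec e) Y).mk'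
  revert Y
  refine eq_of_mvec ?_ (isLinearMap_coe ((9 / 20 : ℝ) • gL (mvec a))) fun b => ?_
  · exact isLinearMap_sum _ fun e => gL.flip (mvec e) ∘ₗ (isLinearMap_curv₃ (mvec e) (mvec a)).mk'
  have h : ∀ e, (1 / (6 * (nrm (emb e) : ℝ))) • gL (curv (mvec e) (mvec a) (mvec b)) (mvec e)
      = (cuv e a b e : ℝ) / 400 := by
    intro e
    have := nrm_pos' (emb e)
    rw [curv_mvec, map_smul, LinearMap.smul_apply, map_sum, LinearMap.sum_apply,
      Finset.sum_eq_single e]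
    · rw [map_smul, LinearMap.smul_apply, gL_apply, g_mvec, if_pos rfl]
      simp only [smul_eq_mul]
      field_simp
    · intro d _ hd
      rw [map_smul, LinearMap.smul_apply, gL_apply, g_mvec, if_neg hd, smul_zero]
    · simp
  have h2 := congrArg (fun z : ℤ => (z : ℝ) / 400) (ricci_table a b)
  push_cast at h2
  simp only [h]
  rw [← Finset.sum_div, h2, g_mvec]
  split_ifs <;> ring

set_option maxRecDepth 100000 in
theorem curvatureAction_table : ∀ (j : Fin 5) (a b : Fin 7),
    ∑ e, inrm e * ∑ d, cuv e a b d * qst j d e = 21000 * qst j a b := by decide +kernel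

theorem sum_quad_curv (w : Fin 5 → ℝ) (X Y : 𝔪) :
    ∑ i, quad w (curv (frame i) X Y) (frame i) = (7 / 24 : ℝ) * quad w X Y := by
  refine (sum_frame (quad w ∘ₗ (isLinearMap_curv₁ X Y).mk')).trans ?_
  simp only [LinearMap.comp_apply, IsLinearMap.mk'_apply]
  revert X
  refine eq_of_mvec ?_ (isLinearMap_flip ((7 / 24 : ℝ) • quad w) Y) fun a => ?_
  · exact isLinearMap_sum _ fun e => (quad w).flip (mvec e) ∘ₗ (isLinearMap_curv₂ (mvec e) Y).mk'
  revert Y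
  refine eq_of_mvec ?_ (isLinearMap_coe ((7 / 24 : ℝ) • quad w (mvec a))) fun b => ?_
  · exact isLinearMap_sum _ fun e =>
      (quad w).flip (mvec e) ∘ₗ (isLinearMap_curv₃ (mvec e) (mvec a)).mk'
  revert w
  refine eq_of_fvec ?_
    (isLinearMap_coe ((7 / 24 : ℝ) • (quad.flip (mvec a)).flip (mvec b))) fun j => ?_
  · exact isLinearMap_sum _ fun e => (quad.flip (curv (mvec e) (mvec a) (mvec b))).flip (mvec e)
  -- `72000 = 180 · 400`, from the inverse norms and from `curv_mvec`.
  have h := congrArg (fun z : ℤ => (z : ℝ) / 72000) (curvatureAction_table j a b)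
  push_cast at h
  rw [Finset.sum_div] at h
  rw [quad_mvec]
  refine (Finset.sum_congr rfl fun e _ => ?_).trans (h.trans (by ring))
  simp only [curv_mvec, map_sum, map_smul, LinearMap.sum_apply, LinearMap.smul_apply,
    quad_mvec, smul_eq_mul, inv_nrm, Finset.mul_sum, Finset.sum_div]
  exact Finset.sum_congr rfl fun d _ => by ring

/-! ## The destabilizing tensors -/

/-- The symmetric tensor field `x ↦ quad (x⁻¹v)`. -/
def tensorField : (Fin 5 → ℝ) →ₗ[ℝ] SymTensor where
  toFun v := ⟨fun x => quad ((x⁻¹ : SO5).1 *ᵥ v), by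
    refine ⟨fun X Y => ?_, fun x X Y => quad_symm _ X Y, fun x k X Y => ?_⟩
    · exact smoothMap_real.1 ((smoothMap_inv_mulVec v).map ((quad.flip X).flip Y))
    · have h : (x⁻¹ : SO5).1 *ᵥ v = k.1.1 *ᵥ (((x * k)⁻¹ : SO5).1 *ᵥ v) := by
        rw [inv_mul_mulVec, Matrix.mulVec_mulVec, SO5.coe_inv k.1, SO5.mul_transpose,
          Matrix.one_mulVec]
      change quad (((x * k)⁻¹ : SO5).1 *ᵥ v) X Y = quad ((x⁻¹ : SO5).1 *ᵥ v) _ _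
      rw [h, quad_invariant]⟩
  map_add' v w := by
    apply Subtype.ext
    funext x
    change quad (_ *ᵥ (v + w)) = quad _ + quad _
    rw [Matrix.mulVec_add, map_add]
  map_smul' c v := by
    apply Subtype.ext
    funext x
    change quad (_ *ᵥ (c • v)) = c • quad _
    rw [Matrix.mulVec_smul, map_smul]

theorem tensorField_apply (v : Fin 5 → ℝ) (x : SO5) :
    (tensorField v).1 x = quad ((x⁻¹ : SO5).1 *ᵥ v) := rfl

theorem toTensor_tensorField (v : Fin 5 → ℝ) : toTensor (tensorField v)
    = fun x (Y : Fin 2 → 𝔪) => quad ((x⁻¹ : SO5).1 *ᵥ v) (Y 0) (Y 1) := rfl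

theorem isTraceFree_tensorField (v : Fin 5 → ℝ) : IsTraceFree (tensorField v) :=
  fun _ => trace_quad _

theorem nab_quad_self (w : Fin 5 → ℝ) (X : 𝔪) : nab quad w X X X = 0 := by
  rw [nab, quad_act_self, br_self]
  simp

theorem isKilling_tensorField (v : Fin 5 → ℝ) : IsKilling leviCivita (tensorField v) := by
  intro x X
  rw [toTensor_tensorField, covDeriv_equivariant]
  exact nab_quad_self _ X

/-- The trace of a symmetric form against the skew endomorphism `br Y` vanishes. -/
theorem sum_frame_skew (q : 𝔪 →ₗ[ℝ] 𝔪 →ₗ[ℝ] ℝ) (hq : ∀ X Y, q X Y = q Y X) (Y : 𝔪) :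
    ∑ i, q (frame i) (br Y (frame i)) = 0 := by
  have h : ∀ i, q (frame i) (br Y (frame i))
      = ∑ j, g (br Y (frame i)) (frame j) * q (frame i) (frame j) := by
    intro i
    conv_lhs => rw [eq_sum_frame (br Y (frame i))]
    simp only [map_sum, map_smul, smul_eq_mul]
  have h' : ∀ i j, g (br Y (frame i)) (frame j) * q (frame i) (frame j)
      = -(g (br Y (frame j)) (frame i) * q (frame j) (frame i)) := by
    intro i j
    rw [g_br, g_comm, hq]
    ring
  have e : ∑ i, q (frame i) (br Y (frame i)) = -∑ i, q (frame i) (br Y (frame i)) := by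
    simp only [h]
    conv_lhs => rw [Finset.sum_comm]
    rw [← Finset.sum_neg_distrib]
    refine Finset.sum_congr rfl fun i _ => ?_
    rw [← Finset.sum_neg_distrib]
    exact Finset.sum_congr rfl fun j _ => h' _ _
  linarith

/-- Tracing the polarised Killing equation trades the divergence for the derivative of the trace, up
to a term that pairs a symmetric form with a skew endomorphism. -/
theorem isDivergenceFree_tensorField (v : Fin 5 → ℝ) :
    IsDivergenceFree leviCivita (tensorField v) := by
  intro x Y
  rw [toTensor_tensorField, covDeriv_equivariant]
  suffices h : ∀ w, ∑ i, nab quad w (frame i) (frame i) Y = 0 from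
    (congrArg Neg.neg (h ((x⁻¹ : SO5).1 *ᵥ v))).trans neg_zero
  intro w
  have h1 : ∀ X, nab quad w X X Y
      = (1 / 2) * quad (act Y w) X X + (1 / 2) * quad w X (br Y X) := by
    intro X
    have h := quad_act_cyclic w X X Y
    rw [quad_symm _ Y X] at h
    rw [nab, br_self, br_skew X Y, map_zero, LinearMap.zero_apply, map_neg]
    linarith
  have h2 : ∑ i, quad w (frame i) (br Y (frame i)) = 0 := sum_frame_skew _ (quad_symm w) Y
  simp only [h1, Finset.sum_add_distrib, ← Finset.mul_sum, trace_quad, h2]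
  simp

theorem roughLaplacian_tensorField (v : Fin 5 → ℝ) :
    roughLaplacian leviCivita (tensorField v) = (19 / 60 : ℝ) • toTensor (tensorField v) := by
  funext x Y
  rw [roughLaplacian, toTensor_tensorField]
  simp only [covDeriv_covDeriv_equivariant, Pi.smul_apply, smul_eq_mul]
  generalize (x⁻¹ : SO5).1 *ᵥ v = w
  change -∑ i, (-nab quad (act (frame i) w) (frame i) (Y 0) (Y 1)
    - 1 / 2 * nab quad w (br (frame i) (frame i)) (Y 0) (Y 1)
    - 1 / 2 * nab quad w (frame i) (br (frame i) (Y 0)) (Y 1)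
    - 1 / 2 * nab quad w (frame i) (Y 0) (br (frame i) (Y 1))) = _
  -- Each term that mixes `act` and `br` arises twice with weight `½`, the product of the two
  -- brackets twice with weight `¼`; the first slot drops out because `br e e = 0`.
  have h : ∀ e : 𝔪, -nab quad (act e w) e (Y 0) (Y 1) - 1 / 2 * nab quad w (br e e) (Y 0) (Y 1)
      - 1 / 2 * nab quad w e (br e (Y 0)) (Y 1) - 1 / 2 * nab quad w e (Y 0) (br e (Y 1))
      = quad (act e (act e w)) (Y 0) (Y 1)
        + (quad (act e w) (br e (Y 0)) (Y 1) + quad (act e w) (Y 0) (br e (Y 1)))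
        + (1 / 4) * quad w (br e (br e (Y 0))) (Y 1) + (1 / 4) * quad w (Y 0) (br e (br e (Y 1)))
        + (1 / 2) * quad w (br e (Y 0)) (br e (Y 1)) := by
    intro e
    simp only [nab, br_self, map_zero, LinearMap.zero_apply]
    ring
  simp only [h, Finset.sum_add_distrib, ← Finset.mul_sum]
  rw [← Finset.sum_add_distrib, sum_act_br, sum_quad_br]
  have e1 : ∑ i, quad (act (frame i) (act (frame i) w)) (Y 0) (Y 1)
      = (-7 / 15) * quad w (Y 0) (Y 1) := by
    have := congrArg (fun u => quad u (Y 0) (Y 1)) (sum_act_act w)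
    simpa using this
  have e2 : ∑ i, quad w (br (frame i) (br (frame i) (Y 0))) (Y 1)
      = (-1 / 5) * quad w (Y 0) (Y 1) := by
    have := congrArg (fun u => quad w u (Y 1)) (sum_br_br (Y 0))
    simpa using this
  have e3 : ∑ i, quad w (Y 0) (br (frame i) (br (frame i) (Y 1)))
      = (-1 / 5) * quad w (Y 0) (Y 1) := by
    have := congrArg (fun u => quad w (Y 0) u) (sum_br_br (Y 1))
    simpa using this
  rw [e1, e2, e3]
  ring

theorem curvatureAction_tensorField (v : Fin 5 → ℝ) :
    curvatureAction leviCivita (tensorField v) = (7 / 24 : ℝ) • toTensor (tensorField v) := by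
  funext x Y
  simp only [curvatureAction, curvature_leviCivita, tensorField_apply]
  exact sum_quad_curv _ _ _

theorem lichnerowicz_tensorField (v : Fin 5 → ℝ) :
    lichnerowicz leviCivita (tensorField v) = (19 / 30 : ℝ) • toTensor (tensorField v) := by
  funext x Y
  have h1 : ∑ i, ricci leviCivita x (Y 0) (frame i) * (tensorField v).1 x (frame i) (Y 1)
      = (9 / 20 : ℝ) * (tensorField v).1 x (Y 0) (Y 1) := by
    conv_rhs => rw [eq_sum_frame (Y 0)]
    simp [ricci_leviCivita, Finset.mul_sum, mul_assoc]
  have h2 : ∑ i, ricci leviCivita x (Y 1) (frame i) * (tensorField v).1 x (Y 0) (frame i)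
      = (9 / 20 : ℝ) * (tensorField v).1 x (Y 0) (Y 1) := by
    conv_rhs => rw [eq_sum_frame (Y 1)]
    simp [ricci_leviCivita, Finset.mul_sum, mul_assoc]
  rw [lichnerowicz, roughLaplacian_tensorField, curvatureAction_tensorField, h1, h2]
  simp only [Pi.smul_apply, smul_eq_mul, toTensor]
  ring

/-! ### Injectivity, the vector module and instability -/

/-- Columns in which the first row of the table of `quad` has its entries. -/
def col (j : Fin 5) : Fin 7 := [1, 6, 5, 2, 0].getD j 0

theorem qst_col : ∀ i j, i ≠ j → qst i 0 (col j) = 0 := by decide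

theorem qst_col_ne_zero : ∀ j, qst j 0 (col j) ≠ 0 := by decide

theorem span_fvec (w : Fin 5 → ℝ) : w = ∑ j, (dil' *ᵥ w) j • fvec j := by
  simp only [fvec, ← Matrix.mulVec_smul, ← Matrix.mulVec_sum]
  have : ∑ j, (dil' *ᵥ w) j • (Pi.single j 1 : Fin 5 → ℝ) = dil' *ᵥ w := by
    ext i
    simp [Pi.single_apply]
  rw [this, Matrix.mulVec_mulVec, dil_mul_dil', Matrix.one_mulVec]

/-- The entry in row 0 and column `col j` is nonzero only in the `j`-th table, so it isolates the
`j`-th coefficient of `w`. -/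
theorem quad_injective : Function.Injective quad := by
  refine (injective_iff_map_eq_zero quad).2 fun w hw => ?_
  rw [span_fvec w]
  refine Finset.sum_eq_zero fun j _ => ?_
  have h : quad w (mvec 0) (mvec (col j)) = 0 := by rw [hw]; rfl
  rw [span_fvec w, map_sum, LinearMap.sum_apply, LinearMap.sum_apply, Finset.sum_eq_single j] at h
  · rw [map_smul, LinearMap.smul_apply, LinearMap.smul_apply, quad_mvec, smul_eq_mul,
      mul_eq_zero, Int.cast_eq_zero, or_iff_left (qst_col_ne_zero j)] at h
    rw [h, zero_smul]
  · intro i _ hi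
    rw [map_smul, LinearMap.smul_apply, LinearMap.smul_apply, quad_mvec, qst_col i j hi,
      Int.cast_zero, smul_zero]
  · simp

theorem tensorField_injective : Function.Injective tensorField := by
  intro v w h
  have h1 : quad (((1 : SO5)⁻¹ : SO5).1 *ᵥ v) = quad (((1 : SO5)⁻¹ : SO5).1 *ᵥ w) :=
    congrFun (congrArg Subtype.val h) 1
  have h2 := quad_injective h1
  simpa using h2

/-- The space of the destabilizing tensors. -/
def tensorSpace : Submodule ℝ SymTensor := LinearMap.range tensorField

theorem finrank_tensorSpace : Module.finrank ℝ tensorSpace = 5 := by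
  rw [tensorSpace, LinearMap.finrank_range_of_inj tensorField_injective]
  simp

/-- Left translation by `a⁻¹` replaces `x⁻¹v` by `x⁻¹(av)`. -/
theorem isVectorModule_tensorSpace : IsVectorModule tensorSpace := by
  refine ⟨LinearEquiv.ofInjective tensorField tensorField_injective, fun a v x => ?_⟩
  change quad _ = quad _
  congr 1
  rw [mul_inv_rev, inv_inv, Matrix.mulVec_mulVec]
  rfl

theorem isLinearlyUnstable_leviCivita : IsLinearlyUnstable leviCivita := by
  let v : Fin 5 → ℝ := Pi.single 0 1
  have hv : v ≠ 0 := by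
    intro h
    have := congrFun h 0
    simp [v] at this
  refine ⟨tensorField v, fun h => hv (tensorField_injective (by rw [h, map_zero])),
    isTraceFree_tensorField v, isDivergenceFree_tensorField v, ?_⟩
  let N : SO5 → ℝ := fun x => ∑ i, ∑ j, quad ((x⁻¹ : SO5).1 *ᵥ v) (frame i) (frame j) ^ 2
  have hN : Continuous N := by
    refine continuous_finsetSum _ fun i _ => continuous_finsetSum _ fun j _ => ?_
    refine Continuous.pow ?_ 2
    obtain ⟨F, hF, e⟩ := (tensorField v).2.1 (frame i) (frame j)
    have : (fun x : SO5 => quad ((x⁻¹ : SO5).1 *ᵥ v) (frame i) (frame j))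
        = fun x : SO5 => F fun i j => x.1 i j := funext e
    rw [this]
    refine hF.continuous.comp (continuous_pi fun i => continuous_pi fun j => ?_)
    exact continuous_subtype_val.matrix_elem i j
  have hpos : 0 < ∫ x, N x ∂(MeasureTheory.Measure.haar : MeasureTheory.Measure SO5) := by
    refine hN.integral_pos_of_hasCompactSupport_nonneg_nonzero (x := 1)
      (HasCompactSupport.of_compactSpace _) (fun x => by positivity) ?_
    intro h
    have h1 : ∀ i j, quad v (frame i) (frame j) = 0 := by
      intro i j
      have h2 : ∑ i, ∑ j, quad v (frame i) (frame j) ^ 2 = 0 := by simpa [N] using h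
      rw [Finset.sum_eq_zero_iff_of_nonneg fun i _ => by positivity] at h2
      have h3 := h2 i (Finset.mem_univ _)
      rw [Finset.sum_eq_zero_iff_of_nonneg fun i _ => by positivity] at h3
      simpa using h3 j (Finset.mem_univ _)
    refine hv (quad_injective ?_)
    rw [map_zero]
    exact frame.ext fun i => frame.ext fun j => h1 i j
  -- The integrand is a constant multiple of the pointwise squared norm `N`: `19/60 - 2 · 7/24 =
  -- -4/15`.
  have e : innerL2 (fun x Y => roughLaplacian leviCivita (tensorField v) x Y
      - 2 * curvatureAction leviCivita (tensorField v) x Y) (toTensor (tensorField v))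
      = (-4 / 15) * ∫ x, N x ∂(MeasureTheory.Measure.haar : MeasureTheory.Measure SO5) := by
    rw [innerL2, ← MeasureTheory.integral_const_mul]
    refine congrArg _ (funext fun x => ?_)
    simp only [roughLaplacian_tensorField, curvatureAction_tensorField, N, Finset.mul_sum]
    refine Finset.sum_congr rfl fun i _ => Finset.sum_congr rfl fun j _ => ?_
    simp only [Pi.smul_apply, smul_eq_mul, toTensor_tensorField, Matrix.cons_val_zero,
      Matrix.cons_val_one]
    ring
  rw [e]
  linarith

/-! ## The nearly parallel `G₂`-structure -/

/-- The coefficients of the `G₂`-form. -/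
def gst (a b c : Fin 7) : ℤ := (cst (emb a) b (emb c)).sign

/-- The coefficients of the covariant derivative of the `G₂`-form, up to a factor. -/
def covGst (a b c d : Fin 7) : ℤ :=
  ∑ l, gst a b l * gst l c d + ∑ l, gst a c l * gst b l d + ∑ l, gst a d l * gst b c l

/-- The coefficients of the exterior derivative of the `G₂`-form, up to a factor. -/
def extGst (a b c d : Fin 7) : ℤ :=
  covGst a b c d - covGst b a c d + covGst c a b d - covGst d a b c

/-- The sign of the order of two indices. -/
def ord (i j : Fin 7) : ℤ := if i < j then 1 else -1

-- The exclusions leave exactly the arrangements of seven indices, and the product of the `ord` is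
-- the sign of the arrangement. Thus the exterior derivative is a multiple of the Hodge dual,
-- uniformly over all permutations.
set_option maxRecDepth 100000 in
set_option synthInstance.maxSize 2000 in
set_option synthInstance.maxHeartbeats 200000 in
theorem extGst_table : ∀ d e f g : Fin 7, [d, e, f, g].Nodup → ∀ a, a ∉ [d, e, f, g] →
    ∀ b, b ∉ [a, d, e, f, g] → ∀ c, c ∉ [a, b, d, e, f, g] →
    extGst d e f g = 12 * ((ord a b * ord a c * ord a d * ord a e * ord a f * ord a g
      * (ord b c * ord b d * ord b e * ord b f * ord b g)
      * (ord c d * ord c e * ord c f * ord c g) * (ord d e * ord d f * ord d g)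
      * (ord e f * ord e g) * ord f g) * gst a b c) := by
  decide +kernel

theorem sign_eq (σ : Equiv.Perm (Fin 7)) : (Equiv.Perm.sign σ : ℤ) =
    ord (σ 0) (σ 1) * ord (σ 0) (σ 2) * ord (σ 0) (σ 3) * ord (σ 0) (σ 4) * ord (σ 0) (σ 5)
      * ord (σ 0) (σ 6)
      * (ord (σ 1) (σ 2) * ord (σ 1) (σ 3) * ord (σ 1) (σ 4) * ord (σ 1) (σ 5) * ord (σ 1) (σ 6))
      * (ord (σ 2) (σ 3) * ord (σ 2) (σ 4) * ord (σ 2) (σ 5) * ord (σ 2) (σ 6))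
      * (ord (σ 3) (σ 4) * ord (σ 3) (σ 5) * ord (σ 3) (σ 6))
      * (ord (σ 4) (σ 5) * ord (σ 4) (σ 6)) * ord (σ 5) (σ 6) := by
  have h0 : Finset.Ioi (0 : Fin 7) = {1, 2, 3, 4, 5, 6} := by decide
  have h1 : Finset.Ioi (1 : Fin 7) = {2, 3, 4, 5, 6} := by decide
  have h2 : Finset.Ioi (2 : Fin 7) = {3, 4, 5, 6} := by decide
  have h3 : Finset.Ioi (3 : Fin 7) = {4, 5, 6} := by decide
  have h4 : Finset.Ioi (4 : Fin 7) = {5, 6} := by decide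
  have h5 : Finset.Ioi (5 : Fin 7) = {6} := by decide
  have h6 : Finset.Ioi (6 : Fin 7) = ∅ := by decide
  have ho : ∀ i j : Fin 7, (((if i < j then 1 else -1 : ℤˣ)) : ℤ) = ord i j := by
    intro i j
    unfold ord
    split_ifs <;> rfl
  rw [Equiv.Perm.sign_eq_prod_prod_Ioi, Fin.prod_univ_seven, h0, h1, h2, h3, h4, h5, h6]
  simp only [Finset.prod_insert, Finset.prod_singleton, Finset.prod_empty, Units.val_mul, ho,
    Finset.mem_insert, Finset.mem_singleton, Fin.reduceEq, or_self, not_false_eq_true, mul_one,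
    mul_assoc]

theorem extGst_perm (σ : Equiv.Perm (Fin 7)) : extGst (σ 3) (σ 4) (σ 5) (σ 6)
    = 12 * ((Equiv.Perm.sign σ : ℤ) * gst (σ 0) (σ 1) (σ 2)) := by
  rw [sign_eq]
  refine extGst_table _ _ _ _ ?_ _ ?_ _ ?_ _ ?_ <;> simp [σ.injective.eq_iff]

/-- After normalisation all nonzero coefficients of `g([X, Y], Z)` have the same absolute value
`1/√30`; this is why the signs of the structure constants alone determine the `G₂`-form. -/
theorem nrm_cst_table : ∀ a b c : Fin 7, cst (emb a) b (emb c) = 0 ∨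
    nrm (emb c) * cst (emb a) b (emb c) ^ 2 = 20 * (nrm (emb a) * nrm (emb b)) := by decide +kernel

/-- The normalizing factors of the adapted basis. -/
def scl (a : Fin 7) : ℝ := 1 / √(6 * (nrm (emb a) : ℝ))

theorem scl_pos (a : Fin 7) : 0 < scl a := by
  have := nrm_pos' (emb a)
  unfold scl
  positivity

theorem scl_sq (a : Fin 7) : scl a ^ 2 = 1 / (6 * (nrm (emb a) : ℝ)) := by
  have := nrm_pos' (emb a)
  rw [scl, div_pow, one_pow, Real.sq_sqrt (by positivity)]

theorem scl_ne_zero (a : Fin 7) : scl a ≠ 0 := (scl_pos a).ne'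

/-- The orthonormal basis of `𝔪` in which the `G₂`-form has its normal form. -/
def onb : Module.Basis (Fin 7) ℝ 𝔪 := mbas.isUnitSMul fun a => (scl_ne_zero a).isUnit

theorem onb_apply (a : Fin 7) : onb a = scl a • mvec a := by
  rw [onb, Module.Basis.isUnitSMul_apply, mbas_apply]

theorem g_onb (a b : Fin 7) : g (onb a) (onb b) = if a = b then 1 else 0 := by
  rw [onb_apply, onb_apply, ← gL_apply]
  simp only [map_smul, LinearMap.smul_apply, gL_apply, g_mvec, smul_eq_mul]
  split_ifs with h
  · subst h
    have := nrm_pos' (emb a)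
    rw [← mul_assoc, ← sq, scl_sq]
    field_simp
  · simp

theorem eq_sum_onb (X : 𝔪) : X = ∑ a, g X (onb a) • onb a := by
  conv_lhs => rw [eq_sum_mvec X]
  refine Finset.sum_congr rfl fun a _ => ?_
  have h : g X (onb a) = scl a * g X (mvec a) := by
    rw [onb_apply, ← gL_apply, map_smul, gL_apply, smul_eq_mul]
  rw [h, onb_apply, smul_smul]
  congr 1
  calc _ = scl a ^ 2 * g X (mvec a) := by rw [scl_sq]; ring
    _ = _ := by ring

theorem scl_cst (a b c : Fin 7) : √30 * (scl a * scl b * scl c) *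
    ((cst (emb a) b (emb c) : ℝ) / 10 * (6 * nrm (emb c))) = gst a b c := by
  rcases nrm_cst_table a b c with h | h
  · simp [gst, h]
  have ha := nrm_pos' (emb a)
  have hb := nrm_pos' (emb b)
  have hc := nrm_pos' (emb c)
  have h' : (nrm (emb c) : ℝ) * (cst (emb a) b (emb c) : ℝ) ^ 2
      = 20 * ((nrm (emb a) : ℝ) * nrm (emb b)) := by exact_mod_cast h
  have hs : (cst (emb a) b (emb c) : ℝ) = gst a b c * |(cst (emb a) b (emb c) : ℝ)| := by
    rw [gst]
    exact_mod_cast (Int.sign_mul_abs _).symm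
  -- With the sign of the structure constant split off, the remaining factor is nonnegative with
  -- square 1, which avoids computing square roots.
  set p : ℝ := √30 * (scl a * scl b * scl c) *
    (|(cst (emb a) b (emb c) : ℝ)| / 10 * (6 * nrm (emb c))) with hp
  have hp0 : 0 ≤ p := by
    have := scl_pos a
    have := scl_pos b
    have := scl_pos c
    positivity
  have hp2 : p ^ 2 = 1 := by
    have e : p ^ 2 = √30 ^ 2 * (scl a ^ 2 * scl b ^ 2 * scl c ^ 2) *
        (36 / 100 * nrm (emb c) * (nrm (emb c) * |(cst (emb a) b (emb c) : ℝ)| ^ 2)) := by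
      rw [hp]; ring
    rw [e, sq_abs, h', scl_sq, scl_sq, scl_sq, Real.sq_sqrt (by norm_num)]
    field_simp
    norm_num
  have hp1 : p = 1 := (pow_eq_one_iff_of_nonneg hp0 two_ne_zero).1 hp2
  calc _ = gst a b c * p := by
        rw [hp]
        generalize |(cst (emb a) b (emb c) : ℝ)| = q at hs
        rw [hs]
        ring
    _ = _ := by rw [hp1, mul_one]

/-- The multilinear map underlying the `G₂`-form. -/
def g2Multi : 𝔪 →ₗ[ℝ] 𝔪 →ₗ[ℝ] 𝔪 →ₗ[ℝ] ℝ := √30 • br.compr₂ gL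

theorem g2Multi_apply (X Y Z : 𝔪) : g2Multi X Y Z = √30 * g (br X Y) Z := rfl

theorem g_br_right (X Y : 𝔪) : g (br X Y) Y = 0 := by
  have h1 := g_br X Y Y
  have h2 := g_comm Y (br X Y)
  linarith

theorem g_br_left (X Y : 𝔪) : g (br X Y) X = 0 := by
  rw [g_br, br_self, ← gL_apply, map_zero, neg_zero]

theorem g_zero_left (X : 𝔪) : g 0 X = 0 := by
  rw [← gL_apply, map_zero, LinearMap.zero_apply]

/-- The `G₂`-form. -/
def g2Form : 𝔪 [⋀^Fin 3]→ₗ[ℝ] ℝ where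
  toFun v := g2Multi (v 0) (v 1) (v 2)
  map_update_add' {inst} v i X Y := by
    -- The field quantifies over all decidability instances on `Fin 3`; fixing the standard one lets
    -- `Function.update` compute.
    obtain rfl := Subsingleton.elim inst (instDecidableEqFin 3)
    fin_cases i <;> simp [Function.update]
  map_update_smul' {inst} v i c X := by
    obtain rfl := Subsingleton.elim inst (instDecidableEqFin 3)
    fin_cases i <;> simp [Function.update]
  map_eq_zero_of_eq' v i j h hij := by
    simp only [g2Multi_apply]
    fin_cases i <;> fin_cases j <;> simp at hij h <;>
      simp [h, br_self, g_br_left, g_br_right, g_zero_left]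

theorem g2Form_apply (v : Fin 3 → 𝔪) : g2Form v = g2Multi (v 0) (v 1) (v 2) := rfl

theorem g2Form_invariant (k : SO3irr) : g2Form.compLinearMap (isotropyRep k) = g2Form := by
  ext v
  rw [AlternatingMap.compLinearMap_apply, g2Form_apply, g2Form_apply, g2Multi_apply, g2Multi_apply,
    ← isotropyRep_br]
  exact congrArg _ (ip_Ad k.1 _ _)

theorem g2Multi_onb (a b c : Fin 7) : g2Multi (onb a) (onb b) (onb c) = gst a b c := by
  rw [← scl_cst, g2Multi_apply, onb_apply, onb_apply, onb_apply, ← gL_apply]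
  have h : gL (br (mvec a) (mvec b)) (mvec c)
      = (cst (emb a) b (emb c) : ℝ) / 10 * (6 * nrm (emb c)) := by
    rw [br_mvec, map_smul, LinearMap.smul_apply, map_sum, LinearMap.sum_apply,
      Finset.sum_eq_single c]
    · rw [map_smul, LinearMap.smul_apply, gL_apply, g_mvec, if_pos rfl]
      simp only [smul_eq_mul]
      ring
    · intro d _ hd
      rw [map_smul, LinearMap.smul_apply, gL_apply, g_mvec, if_neg hd, smul_zero]
    · simp
  simp only [map_smul, LinearMap.smul_apply, h, smul_eq_mul]
  ring

theorem br_onb (a b : Fin 7) : br (onb a) (onb b) = (1 / √30) • ∑ c, (gst a b c : ℝ) • onb c := by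
  conv_lhs => rw [eq_sum_onb (br (onb a) (onb b))]
  rw [Finset.smul_sum]
  refine Finset.sum_congr rfl fun c _ => ?_
  rw [← g2Multi_onb, g2Multi_apply, smul_smul, ← mul_assoc, one_div_mul_cancel (by positivity),
    one_mul]

theorem covDeriv_g2Form (x : SO5) (a b c d : Fin 7) :
    covDeriv leviCivita (fun _ Y => g2Form Y) x ![onb a, onb b, onb c, onb d]
      = -(1 / (2 * √30)) * covGst a b c d := by
  have h := covDeriv_parallel g2Multi x ![onb a, onb b, onb c, onb d]
  refine Eq.trans h ?_
  change -(1 / 2) * (g2Multi (br (onb a) (onb b)) (onb c) (onb d)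
    + g2Multi (onb b) (br (onb a) (onb c)) (onb d) + g2Multi (onb b) (onb c) (br (onb a) (onb d))) = _
  simp only [br_onb, map_smul, map_sum, LinearMap.smul_apply, LinearMap.sum_apply, g2Multi_onb,
    covGst, smul_eq_mul]
  push_cast
  ring

theorem extDeriv_g2Form (x : SO5) (a b c d : Fin 7) :
    extDeriv leviCivita (fun _ Y => g2Form Y) x ![onb a, onb b, onb c, onb d]
      = -(1 / (2 * √30)) * extGst a b c d := by
  rw [extDeriv, Fin.sum_univ_four]
  have e0 : (Fin.cons (onb a) fun j => ![onb a, onb b, onb c, onb d] ((0 : Fin 4).succAbove j) :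
      Fin 4 → 𝔪) = ![onb a, onb b, onb c, onb d] := by
    ext i; fin_cases i <;> rfl
  have e1 : (Fin.cons (onb b) fun j => ![onb a, onb b, onb c, onb d] ((1 : Fin 4).succAbove j) :
      Fin 4 → 𝔪) = ![onb b, onb a, onb c, onb d] := by
    ext i; fin_cases i <;> rfl
  have e2 : (Fin.cons (onb c) fun j => ![onb a, onb b, onb c, onb d] ((2 : Fin 4).succAbove j) :
      Fin 4 → 𝔪) = ![onb c, onb a, onb b, onb d] := by
    ext i; fin_cases i <;> rfl
  have e3 : (Fin.cons (onb d) fun j => ![onb a, onb b, onb c, onb d] ((3 : Fin 4).succAbove j) :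
      Fin 4 → 𝔪) = ![onb d, onb a, onb b, onb c] := by
    ext i; fin_cases i <;> rfl
  have h0 := covDeriv_g2Form x a b c d
  have h1 := covDeriv_g2Form x b a c d
  have h2 := covDeriv_g2Form x c a b d
  have h3 := covDeriv_g2Form x d a b c
  rw [← e0] at h0
  rw [← e1] at h1
  rw [← e2] at h2
  rw [← e3] at h3
  refine (congrArg₂ _ (congrArg₂ _ (congrArg₂ _ (congrArg _ h0) (congrArg _ h1)) (congrArg _ h2))
    (congrArg _ h3)).trans ?_
  simp only [extGst]
  push_cast
  simp
  ring

theorem exists_nearlyParallelG2 : ∃ (φ : 𝔪 [⋀^Fin 3]→ₗ[ℝ] ℝ) (τ : ℝ),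
    τ ^ 2 = 6 / 5 ∧ IsNearlyParallelG2 leviCivita φ τ := by
  -- `-(6/√30)` is the factor `-1/(2√30)` of `extDeriv_g2Form` times the 12 of `extGst_perm`; its
  -- sign belongs to the orientation of `onb`.
  refine ⟨g2Form, -(6 / √30), ?_, ?_, g2Form_invariant, onb, g_onb, ?_, ?_⟩
  · rw [neg_sq, div_pow, Real.sq_sqrt (by norm_num)]
    norm_num
  · have : (0 : ℝ) < √30 := by positivity
    exact neg_ne_zero.2 (by positivity)
  · intro i j k hij hjk
    rw [g2Form_apply]
    change g2Multi (onb i) (onb j) (onb k) = _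
    rw [g2Multi_onb]
    have key : ∀ i j k : Fin 7, i < j → j < k → gst i j k =
        if (i, j, k) ∈ [(0, 1, 2), (0, 3, 4), (0, 5, 6), (1, 3, 5)] then 1
        else if (i, j, k) ∈ [(1, 4, 6), (2, 3, 6), (2, 4, 5)] then -1 else 0 := by decide +kernel
    rw [key i j k hij hjk, g2Coeff]
    push_cast
    rfl
  · intro x σ
    rw [extDeriv_g2Form, extGst_perm, g2Form_apply]
    change _ = _ * (_ * g2Multi (onb (σ 0)) (onb (σ 1)) (onb (σ 2)))
    rw [g2Multi_onb]
    push_cast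
    ring

end Berger
end

theorem theorem1p3 :
    (∃ D : Berger.VectorField → Berger.VectorField → Berger.VectorField, Berger.IsLeviCivita D) ∧
    ∀ D : Berger.VectorField → Berger.VectorField → Berger.VectorField, Berger.IsLeviCivita D →
      (∃ (φ : Berger.𝔪 [⋀^Fin 3]→ₗ[ℝ] ℝ) (τ : ℝ),
        τ ^ 2 = 6 / 5 ∧ Berger.IsNearlyParallelG2 D φ τ) ∧
      Berger.IsEinstein D (9 / 20) ∧
      Berger.IsLinearlyUnstable D ∧
      (∃ V : Submodule ℝ Berger.SymTensor, Module.finrank ℝ V = 5 ∧ Berger.IsVectorModule V ∧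
        ∀ h ∈ V, Berger.IsTraceFree h ∧ Berger.IsDivergenceFree D h ∧ Berger.IsKilling D h ∧
          Berger.lichnerowicz D h = (19 / 30 : ℝ) • Berger.toTensor h) ∧
      (19 / 30 : ℝ) < 2 * (9 / 20) := by
  refine ⟨⟨Berger.leviCivita, Berger.isLeviCivita_leviCivita⟩, fun D hD => ?_⟩
  -- By uniqueness every claim about `D` becomes one about the explicit connection.
  obtain rfl := hD.eq_leviCivita
  refine ⟨Berger.exists_nearlyParallelG2, Berger.ricci_leviCivita,
    Berger.isLinearlyUnstable_leviCivita, ⟨Berger.tensorSpace, Berger.finrank_tensorSpace,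
      Berger.isVectorModule_tensorSpace, ?_⟩, by norm_num⟩
  rintro _ ⟨v, rfl⟩
  exact ⟨Berger.isTraceFree_tensorField v, Berger.isDivergenceFree_tensorField v,
    Berger.isKilling_tensorField v, Berger.lichnerowicz_tensorField v⟩
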